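/- Let $(X_i)_{i\ge 1}$ be a strictly stationary sequence of real random variables with marginal distribution function $F$; put $\bar F=1-F$, $M_{s,r}=\max_{s<i\le r}X_i$, $M_r=M_{0,r}$, $N_s(u)=\sum_{i=1}^s I(X_i>u)$, $F_r(u)=\Pr(M_r\le u)$, $\tau_r(u)=r\bar F(u)$ and $\theta_r(u)=-\log F_r(u)/\tau_r(u)$. Assume that the sequence has extremal index $\theta\in(0,1]$, that is, for every $t>0$ there are levels $u_n(t)$ with $n\bar F(u_n(t))\to t$ and $\Pr(M_n\le u_n(t))\to e^{-\theta t}$. For $k=\lfloor n/r\rfloor$ let $$\hat F^{\mathrm{dj}}_{n,r}(u)=\frac1k\sum_{i=1}^k I(M_{(i-1)r,ir}\le u),\quad \hat F^{\mathrm{sl}}_{n,r}(u)=\frac1{n-r+1}\sum_{i=0}^{n-r} I(M_{i,i+r}\le u),\quad \hat\tau_{n,r}(u)=\frac1k\sum_{i=1}^{rk}I(X_i>u),$$ and define the disjoint and sliding blocks estimators $\hat\theta^{\mathrm{dj}}_{n,r}(u)=-\log\hat F^{\mathrm{dj}}_{n,r}(u)/\hat\tau_{n,r}(u)$ and $\hat\theta^{\mathrm{sl}}_{n,r}(u)=-\log\hat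 F^{\mathrm{sl}}_{n,r}(u)/\hat\tau_{n,r}(u)$. (Where these expressions are undefined, any fixed convention may be used.) Let $\mathcal F_{a,b}(u)$ be the $\sigma$-field generated by the events $\{X_i\le u\}$, $a\le i\le b$, and let $\rho_{n,l}(u)$ be the supremum of $|\mathrm{corr}(\xi,\eta)|$ over $t\in\{1,\dots,n-l\}$ and over square-integrable random variables $\xi,\eta$ of positive variance, measurable with respect to $\mathcal F_{1,t}(u)$ and $\mathcal F_{t+l,n}(u)$ respectively ($0$ if there are none). Let $(u_r)$ be real thresholds with $r\bar F(u_r)\to\tau\in(0,\infty)$, let $r_n,l_n,s_n$ be positive integer sequences, $k_n=\lfloor n/r_n\rfloor$, and let $(\pi_j)_{j\ge1}$ be a probability distribution on the positive integers, with $m_p=\sum_j j^p\pi_j$. Assume that, as $n\to\infty$, 1. $l_n=o(r_n)$, $r_n=o(n)$, $\sum_{l=l_n}^n\rho_{n,l}(u_{r_n})=o(r_n)$; 2. $\sum_{l=1}^n\rho_{n,l}(u_{r_n})=o(r_n^{1/2})$; 3. $l_n=o(s_n)$, $s_n=o(r_n)$, $\rho_{n,l_n}(u_{r_n})=o(s_n/n)$;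 4. $\Pr\{N_{s_n}(u_{r_n})=j\mid M_{s_n}>u_{r_n}\}\to\pi_j$ for all $j\ge1$, and $\mathbb E[N_{s_n}^2(u_{r_n})\mid M_{s_n}>u_{r_n}]\to m_2<\infty$; 5. $\mathbb E[N_{r_n}^{2p}(u_{r_n})]=O(1)$ for some constant $p>1$; 6. $\theta_{r_n}(u_{r_n})-\theta=o(k_n^{-1/2})$. Then, with $\alpha=\theta\tau$ and $c^2=(m_2-m_1^2)/m_1^2$, $$\sqrt{k_n}\begin{pmatrix}\hat\theta^{\mathrm{dj}}_{n,r_n}(u_{r_n})-\theta\\ \hat\theta^{\mathrm{sl}}_{n,r_n}(u_{r_n})-\theta\end{pmatrix}\xrightarrow{d}N(\mathbf 0,\mathbf V),$$ where $\mathbf V=(v_{ij})_{i,j=1}^2$ is the symmetric positive semidefinite matrix with $$v_{11}=\frac{\theta^2}{\alpha^2}(e^\alpha-1-\alpha)+\frac{\theta^2c^2}{\alpha},\qquad v_{22}=v_{12}=2\frac{\theta^2}{\alpha^3}\Bigl(e^\alpha-1-\alpha-\frac{\alpha^2}2\Bigr)+\frac{\theta^2c^2}{\alpha}.$$ Moreover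 $v_{22}=v_{12}\le v_{11}$, so the asymptotic variance of the sliding blocks estimator does not exceed that of the disjoint blocks estimator. -/

import Mathlib

open MeasureTheory ProbabilityTheory Filter Asymptotics
open scoped Topology

noncomputable section

namespace SlidingBlocks

variable {Ω : Type*} [MeasurableSpace Ω]

/-! Sequences are indexed from zero: `X i` is the `(i + 1)`-st observation, so that the block
`X_{s+1}, …, X_r` consists of the `X i` with `s ≤ i < r`. -/

/-- Strict stationarity: every shift of the sequence has the same law, on `ℝ^ℕ`, as the sequence. -/
def StrictlyStationary (X : ℕ → Ω → ℝ) (P : Measure Ω) : Prop :=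
  ∀ h : ℕ, IdentDistrib (fun ω (i : ℕ) => X (i + h) ω) (fun ω (i : ℕ) => X i ω) P P

/-- The tail function `u ↦ 1 - F(u)`, where `F(u) = Pr(X_1 ≤ u)` is the marginal distribution
function. -/
def tail (X : ℕ → Ω → ℝ) (P : Measure Ω) (u : ℝ) : ℝ :=
  1 - P.real {ω | X 0 ω ≤ u}

/-- The block maximum `M_{s,r} = max_{s < i ≤ r} X_i` (equal to `-∞` for an empty block). -/
def blockMax (X : ℕ → Ω → ℝ) (s r : ℕ) (ω : Ω) : EReal :=
  (Finset.Ico s r).sup fun i => (X i ω : EReal)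

/-- `F_r(u) = Pr(M_r ≤ u)`. -/
def maxCdf (X : ℕ → Ω → ℝ) (P : Measure Ω) (r : ℕ) (u : ℝ) : ℝ :=
  P.real {ω | blockMax X 0 r ω ≤ (u : EReal)}

/-- The number `N_s(u)` of exceedances of `u` among the first `s` observations. -/
def exceedances (X : ℕ → Ω → ℝ) (s : ℕ) (u : ℝ) (ω : Ω) : ℕ :=
  ∑ i ∈ Finset.range s, Set.indicator {ω | u < X i ω} (fun _ => 1) ω

/-- `θ ∈ (0, 1]` is the extremal index of the sequence: for each `τ > 0` there are levels `u_n(τ)`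
with `n (1 - F(u_n(τ))) → τ` and `Pr(M_n ≤ u_n(τ)) → exp (-θ τ)`. -/
def HasExtremalIndex (X : ℕ → Ω → ℝ) (P : Measure Ω) (θ : ℝ) : Prop :=
  0 < θ ∧ θ ≤ 1 ∧ ∀ τ : ℝ, 0 < τ → ∃ v : ℕ → ℝ,
    Tendsto (fun n : ℕ => (n : ℝ) * tail X P (v n)) atTop (𝓝 τ) ∧
    Tendsto (fun n : ℕ => maxCdf X P n (v n)) atTop (𝓝 (Real.exp (-(θ * τ))))

/-- `τ_r(u) = r (1 - F(u))`. -/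
def tauR (X : ℕ → Ω → ℝ) (P : Measure Ω) (r : ℕ) (u : ℝ) : ℝ :=
  (r : ℝ) * tail X P u

/-- `θ_r(u) = - log F_r(u) / τ_r(u)`. -/
def thetaR (X : ℕ → Ω → ℝ) (P : Measure Ω) (r : ℕ) (u : ℝ) : ℝ :=
  -Real.log (maxCdf X P r u) / tauR X P r u

/-- The disjoint blocks estimator of `F_r(u)`, from the `k = ⌊n / r⌋` maxima of disjoint blocks. -/
def cdfDisjoint (X : ℕ → Ω → ℝ) (n r : ℕ) (u : ℝ) (ω : Ω) : ℝ :=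
  (1 / ((n / r : ℕ) : ℝ)) * ∑ i ∈ Finset.range (n / r),
    Set.indicator {ω | blockMax X (i * r) ((i + 1) * r) ω ≤ (u : EReal)} (fun _ => (1 : ℝ)) ω

/-- The sliding blocks estimator of `F_r(u)`, from the `n - r + 1` maxima of sliding blocks. -/
def cdfSliding (X : ℕ → Ω → ℝ) (n r : ℕ) (u : ℝ) (ω : Ω) : ℝ :=
  (1 / ((n - r + 1 : ℕ) : ℝ)) * ∑ i ∈ Finset.range (n - r + 1),
    Set.indicator {ω | blockMax X i (i + r) ω ≤ (u : EReal)} (fun _ => (1 : ℝ)) ω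

/-- The mean number of exceedances per block, `k⁻¹ ∑_{i ≤ r k} I(X_i > u)` with `k = ⌊n / r⌋`. -/
def tauHat (X : ℕ → Ω → ℝ) (n r : ℕ) (u : ℝ) (ω : Ω) : ℝ :=
  (1 / ((n / r : ℕ) : ℝ)) * (exceedances X (r * (n / r)) u ω : ℝ)

/-- The disjoint blocks estimator of the extremal index. -/
def thetaDisjoint (X : ℕ → Ω → ℝ) (n r : ℕ) (u : ℝ) (ω : Ω) : ℝ :=
  -Real.log (cdfDisjoint X n r u ω) / tauHat X n r u ω

/-- The sliding blocks estimator of the extremal index. -/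
def thetaSliding (X : ℕ → Ω → ℝ) (n r : ℕ) (u : ℝ) (ω : Ω) : ℝ :=
  -Real.log (cdfSliding X n r u ω) / tauHat X n r u ω

/-- The σ-field `F_{a,b}(u)` generated by the events `{X_i ≤ u}` for `i ∈ {a, …, b}`, where
observations are numbered from one (the observation with number `i + 1` is `X i`). -/
@[reducible] def exceedanceField (X : ℕ → Ω → ℝ) (a b : ℕ) (u : ℝ) : MeasurableSpace Ω :=
  MeasurableSpace.generateFrom {A | ∃ i : ℕ, a ≤ i + 1 ∧ i + 1 ≤ b ∧ A = {ω | X i ω ≤ u}}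

/-- The correlation coefficient of two random variables. -/
def corr (ξ η : Ω → ℝ) (P : Measure Ω) : ℝ :=
  cov[ξ, η; P] / (Real.sqrt Var[ξ; P] * Real.sqrt Var[η; P])

/-- The maximal correlation coefficient `ρ_{n,l}(u)`: the supremum of `|corr(ξ, η)|` over
`t ∈ {1, …, n - l}` and over square-integrable `ξ`, `η` of positive variance, measurable with
respect to `F_{1,t}(u)` and `F_{t+l,n}(u)`. It is `0` if there are no such variables. -/
def maxCorr (X : ℕ → Ω → ℝ) (P : Measure Ω) (n l : ℕ) (u : ℝ) : ℝ :=
  sSup {c : ℝ | ∃ t : ℕ, 1 ≤ t ∧ t + l ≤ n ∧ ∃ ξ η : Ω → ℝ,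
    Measurable[exceedanceField X 1 t u] ξ ∧ MemLp ξ 2 P ∧ 0 < Var[ξ; P] ∧
    Measurable[exceedanceField X (t + l) n u] η ∧ MemLp η 2 P ∧ 0 < Var[η; P] ∧
    c = |corr ξ η P|}

/-- The moment `m_p = ∑_{j ≥ 1} j^p π_j` of a distribution on the positive integers. -/
def clusterMoment (π : PMF ℕ+) (p : ℕ) : ℝ :=
  ∑' j : ℕ+, (j : ℝ) ^ p * (π j).toReal

/-- The squared coefficient of variation `c² = (m_2 - m_1²) / m_1²`. -/
def sqCoeffVar (π : PMF ℕ+) : ℝ :=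
  (clusterMoment π 2 - clusterMoment π 1 ^ 2) / clusterMoment π 1 ^ 2

/-- Asymptotic variance `v_{11}` of the disjoint blocks estimator. -/
def varDisjoint (θ α c2 : ℝ) : ℝ :=
  θ ^ 2 / α ^ 2 * (Real.exp α - 1 - α) + θ ^ 2 * c2 / α

/-- Asymptotic variance `v_{22}` of the sliding blocks estimator, which is also the asymptotic
covariance `v_{12}`. -/
def varSliding (θ α c2 : ℝ) : ℝ :=
  2 * (θ ^ 2 / α ^ 3) * (Real.exp α - 1 - α - α ^ 2 / 2) + θ ^ 2 * c2 / α

/-- The asymptotic covariance matrix `V`. -/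
def asympCov (θ α c2 : ℝ) : Matrix (Fin 2) (Fin 2) ℝ :=
  !![varDisjoint θ α c2, varSliding θ α c2; varSliding θ α c2, varSliding θ α c2]

end SlidingBlocks

end

open SlidingBlocks

/-!
The estimators depend on the observations only through the binary sequence of exceedances of the
threshold, so the argument takes place under laws `μ n` of binary sequences whose mixing
coefficients are the maximal correlations of the exceedance fields. With `k = ⌊n / r⌋` blocks, three
statistics matter: the number of blocks without ones, the number of windows of length `r` without
ones divided by `r`, and the number of ones, all centred.

*Void probabilities.* A block of length `r` is nearly a union of `r / s` independent blocks of
length `s`. Hence the probability that `x r` consecutive places contain no ones tends to `e^(-α x)`,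
uniformly for bounded `x` (`BlockArray.eventually_abs_void_sub_exp_le`), and a block of length `s`
contains a one with probability about `α s / r` (`BlockArray.tendsto_div_mul_one_sub_void`).

*Covariances.* Two windows without ones whose starting points are `x r ≤ r` places apart form one
such window of length `(1 + x) r`, and windows further apart decouple. So their indicators have
covariance about `e^(-α (1 + x)) - e^(-2 α)`, which, summed over all windows, gives the variance of
the sliding statistic and its covariance with the disjoint one. The number of ones is asymptotically
uncorrelated with windows that it does not meet, and vanishes on a window without ones: its
covariance with the indicator of such a window is about `-τ e^(-α)`
(`ClusterArray.eventually_abs_integral_win_mul_dev_add_le`). Its variance per block tends to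
`α m₂`, because the clusters of exceedances come in nearly uncorrelated blocks of length `s`
(`ClusterArray.tendsto_integral_dev_sq`); the mean cluster size is `m₁ = 1 / θ`, as the second
moments make the cluster sizes uniformly integrable (`clusterMoment_one_eq`).

*Central limit theorem.* For a linear combination of the three statistics, groups of `q + 2` blocks
are split into big and small blocks. The big blocks are separated by at least `l` places, so their
characteristic functions nearly multiply; the moment condition controls the Taylor expansion of each
factor, and the rest of the sample is negligible in `L²` as `q` grows
(`ClusterArray.tendsto_integral_exp_sampleSum`).

*Delta method.* The errors of both estimators are, up to terms that vanish in probability, linear in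
the three statistics (`tendstoInMeasure_sub_linearError`), so the Cramér–Wold device and Lévy's
theorem give the bivariate limit (`tendstoInDistribution_linearError`). The matrix `V` is positive
semidefinite because its quadratic form is a limit of variances, and the comparison of the two
variances amounts to `(α - 2) e^α + α + 2 ≥ 0` (`varSliding_le_varDisjoint`).
-/

namespace SlidingBlocks

/-! ### Functions of finitely many places of a binary sequence -/

/-- A function of a binary sequence that depends on finitely many coordinates only. -/
@[fun_prop]
def Cylindrical {β : Type*} (f : (ℕ → Bool) → β) : Prop := ∃ m : ℕ, DependsOn f (Set.Iio m)

namespace Cylindrical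

variable {β γ δ : Type*} {f g : (ℕ → Bool) → ℝ}

theorem of_dependsOn {f : (ℕ → Bool) → β} {s : Set ℕ} {m : ℕ} (h : DependsOn f s)
    (hs : ∀ i ∈ s, i < m) : Cylindrical f :=
  ⟨m, fun _ _ hxy => h fun i hi => hxy i (hs i hi)⟩

theorem comp₂ {f : (ℕ → Bool) → β} {g : (ℕ → Bool) → γ} (F : β → γ → δ) (hf : Cylindrical f)
    (hg : Cylindrical g) : Cylindrical fun x => F (f x) (g x) := by
  obtain ⟨m, hm⟩ := hf
  obtain ⟨k, hk⟩ := hg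
  refine ⟨max m k, fun x y hxy => ?_⟩
  dsimp only
  rw [hm fun i hi => hxy i (Set.mem_Iio.2 (lt_max_of_lt_left hi)),
    hk fun i hi => hxy i (Set.mem_Iio.2 (lt_max_of_lt_right hi))]

theorem comp {f : (ℕ → Bool) → β} (F : β → γ) (hf : Cylindrical f) :
    Cylindrical fun x => F (f x) := comp₂ (fun a _ => F a) hf hf

@[fun_prop]
theorem const (c : β) : Cylindrical fun _ => c := ⟨0, fun _ _ _ => rfl⟩

@[fun_prop]
theorem add (hf : Cylindrical f) (hg : Cylindrical g) : Cylindrical fun x => f x + g x :=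
  comp₂ _ hf hg

@[fun_prop]
theorem sub (hf : Cylindrical f) (hg : Cylindrical g) : Cylindrical fun x => f x - g x :=
  comp₂ _ hf hg

@[fun_prop]
theorem mul (hf : Cylindrical f) (hg : Cylindrical g) : Cylindrical fun x => f x * g x :=
  comp₂ _ hf hg

@[fun_prop]
theorem div (hf : Cylindrical f) (hg : Cylindrical g) : Cylindrical fun x => f x / g x :=
  comp₂ _ hf hg

@[fun_prop]
theorem neg (hf : Cylindrical f) : Cylindrical fun x => -f x := comp _ hf

@[fun_prop]
theorem abs (hf : Cylindrical f) : Cylindrical fun x => |f x| := comp _ hf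

@[fun_prop]
theorem pow (hf : Cylindrical f) (k : ℕ) : Cylindrical fun x => f x ^ k := comp (· ^ k) hf

@[fun_prop]
theorem rpow (hf : Cylindrical f) (k : ℝ) : Cylindrical fun x => f x ^ k := comp (· ^ k) hf

@[fun_prop]
theorem sum {ι : Type*} {f : ι → (ℕ → Bool) → ℝ} (s : Finset ι) (hf : ∀ i, Cylindrical (f i)) :
    Cylindrical fun x => ∑ i ∈ s, f i x := by
  classical
  induction s using Finset.induction_on with
  | empty => simpa using const 0
  | insert a s ha ih => simpa [Finset.sum_insert ha] using (hf a).add ih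

variable [NormedAddCommGroup β]

theorem measurable_and_bounded {f : (ℕ → Bool) → β} (hf : Cylindrical f) :
    StronglyMeasurable f ∧ ∃ C, ∀ x, ‖f x‖ ≤ C := by
  obtain ⟨m, hm⟩ := hf
  let ext : (Fin m → Bool) → ℕ → Bool := fun y i => if h : i < m then y ⟨i, h⟩ else false
  have hfac : f = (fun y => f (ext y)) ∘ fun x (i : Fin m) => x i := by
    funext x
    exact hm fun i hi => by simp [ext, show i < m from hi]
  constructor
  · rw [hfac]
    refine StronglyMeasurable.comp_measurable (StronglyMeasurable.of_discrete) ?_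
    exact measurable_pi_lambda _ fun i => measurable_pi_apply _
  · refine ⟨∑ y, ‖f (ext y)‖, fun x => ?_⟩
    rw [congrFun hfac x]
    exact Finset.single_le_sum (f := fun y => ‖f (ext y)‖) (fun _ _ => norm_nonneg _)
      (Finset.mem_univ fun i : Fin m => x i)

theorem integrable {μ : Measure (ℕ → Bool)} [IsFiniteMeasure μ] {f : (ℕ → Bool) → β}
    (hf : Cylindrical f) : Integrable f μ := by
  obtain ⟨h, C, hC⟩ := hf.measurable_and_bounded
  exact Integrable.of_bound h.aestronglyMeasurable C (ae_of_all _ hC)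

end Cylindrical

/-! ### Counts and voids of binary sequences -/

/-- The left shift by `h` places. -/
def shift (h : ℕ) (x : ℕ → Bool) : ℕ → Bool := fun i => x (i + h)

theorem measurable_shift (h : ℕ) : Measurable (shift h) :=
  measurable_pi_lambda _ fun _ => measurable_pi_apply _

theorem shift_shift (h k : ℕ) (x : ℕ → Bool) : shift h (shift k x) = shift (h + k) x := by
  funext i
  simp [shift, add_assoc]

theorem dependsOn_shift {β : Type*} {f : (ℕ → Bool) → β} {a b : ℕ}
    (hf : DependsOn f (Set.Ico a b)) (h : ℕ) :
    DependsOn (fun x => f (shift h x)) (Set.Ico (a + h) (b + h)) := fun x y hxy =>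
  hf fun i hi => hxy (i + h) ⟨by have := hi.1; omega, by have := hi.2; omega⟩

theorem Cylindrical.shift {β : Type*} {f : (ℕ → Bool) → β} (hf : Cylindrical f) (h : ℕ) :
    Cylindrical fun x => f (shift h x) := by
  obtain ⟨m, hm⟩ := hf
  exact ⟨m + h, fun x y hxy => hm fun i hi => hxy (i + h) (Nat.add_lt_add_right hi h)⟩

/-- The indicator of a one at place `i`, as a real number. -/
def ind (i : ℕ) (x : ℕ → Bool) : ℝ := if x i then 1 else 0

/-- The number of ones at the places `a ≤ i < b`. -/
def cnt (a b : ℕ) (x : ℕ → Bool) : ℝ := ∑ i ∈ Finset.Ico a b, ind i x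

/-- The indicator of the event that there are no ones at the places `a ≤ i < b`. -/
def emp (a b : ℕ) (x : ℕ → Bool) : ℝ := ∏ i ∈ Finset.Ico a b, (1 - ind i x)

theorem dependsOn_ind (i : ℕ) : DependsOn (ind i) {i} := fun x y h => by
  simp [ind, h i rfl]

theorem dependsOn_cnt (a b : ℕ) : DependsOn (cnt a b) (Set.Ico a b) := fun x y h =>
  Finset.sum_congr rfl fun i hi => by simp [ind, h i (by simpa using hi)]

theorem dependsOn_emp (a b : ℕ) : DependsOn (emp a b) (Set.Ico a b) := fun x y h =>
  Finset.prod_congr rfl fun i hi => by simp [ind, h i (by simpa using hi)]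

@[fun_prop]
theorem cylindrical_ind (i : ℕ) : Cylindrical (ind i) :=
  .of_dependsOn (m := i + 1) (dependsOn_ind i) (by simp)

@[fun_prop]
theorem cylindrical_cnt (a b : ℕ) : Cylindrical (cnt a b) :=
  .of_dependsOn (dependsOn_cnt a b) (fun _ h => h.2)

@[fun_prop]
theorem cylindrical_emp (a b : ℕ) : Cylindrical (emp a b) :=
  .of_dependsOn (dependsOn_emp a b) (fun _ h => h.2)

theorem ind_nonneg (i : ℕ) (x : ℕ → Bool) : 0 ≤ ind i x := by
  unfold ind; split_ifs <;> norm_num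

theorem ind_le_one (i : ℕ) (x : ℕ → Bool) : ind i x ≤ 1 := by
  unfold ind; split_ifs <;> norm_num

theorem ind_shift (i h : ℕ) (x : ℕ → Bool) : ind i (shift h x) = ind (i + h) x := rfl

theorem cnt_nonneg (a b : ℕ) (x : ℕ → Bool) : 0 ≤ cnt a b x :=
  Finset.sum_nonneg fun i _ => ind_nonneg i x

theorem emp_nonneg (a b : ℕ) (x : ℕ → Bool) : 0 ≤ emp a b x :=
  Finset.prod_nonneg fun i _ => sub_nonneg.2 (ind_le_one i x)

theorem emp_le_one (a b : ℕ) (x : ℕ → Bool) : emp a b x ≤ 1 :=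
  Finset.prod_le_one (fun i _ => sub_nonneg.2 (ind_le_one i x))
    fun i _ => by linarith [ind_nonneg i x]

theorem cnt_shift (a b h : ℕ) (x : ℕ → Bool) : cnt a b (shift h x) = cnt (a + h) (b + h) x := by
  unfold cnt
  rw [← Finset.sum_Ico_add' (fun i => ind i x)]
  rfl

theorem emp_shift (a b h : ℕ) (x : ℕ → Bool) : emp a b (shift h x) = emp (a + h) (b + h) x := by
  unfold emp
  rw [← Finset.prod_Ico_add' (fun i => 1 - ind i x)]
  rfl

theorem cnt_add_cnt {a b c : ℕ} (hab : a ≤ b) (hbc : b ≤ c) (x : ℕ → Bool) :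
    cnt a b x + cnt b c x = cnt a c x :=
  Finset.sum_Ico_consecutive _ hab hbc

theorem emp_mul_emp {a b c : ℕ} (hab : a ≤ b) (hbc : b ≤ c) (x : ℕ → Bool) :
    emp a b x * emp b c x = emp a c x :=
  Finset.prod_Ico_consecutive _ hab hbc

theorem cnt_mono {a b c d : ℕ} (hca : c ≤ a) (hbd : b ≤ d) (x : ℕ → Bool) :
    cnt a b x ≤ cnt c d x :=
  Finset.sum_le_sum_of_subset_of_nonneg (Finset.Ico_subset_Ico hca hbd)
    fun i _ _ => ind_nonneg i x

theorem emp_eq_ite (a b : ℕ) (x : ℕ → Bool) [Decidable (∀ i ∈ Finset.Ico a b, x i = false)] :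
    emp a b x = if ∀ i ∈ Finset.Ico a b, x i = false then 1 else 0 := by
  split_ifs with h
  · exact Finset.prod_eq_one fun i hi => by simp [ind, h i hi]
  · push Not at h
    obtain ⟨i, hi, hx⟩ := h
    exact Finset.prod_eq_zero hi (by simp [ind, Bool.eq_true_of_not_eq_false hx])

theorem emp_anti {a b c d : ℕ} (hca : c ≤ a) (hbd : b ≤ d) (x : ℕ → Bool) :
    emp c d x ≤ emp a b x := by
  classical
  rw [emp_eq_ite, emp_eq_ite]
  split_ifs with h1 h2
  · rfl
  · exact absurd (fun i hi => h1 i (Finset.Ico_subset_Ico hca hbd hi)) h2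
  · norm_num
  · rfl

theorem emp_mul_self (a b : ℕ) (x : ℕ → Bool) : emp a b x * emp a b x = emp a b x := by
  classical
  rw [emp_eq_ite]; split_ifs <;> norm_num

theorem one_sub_emp_le_cnt (a b : ℕ) (x : ℕ → Bool) : 1 - emp a b x ≤ cnt a b x := by
  classical
  rw [emp_eq_ite]
  split_ifs with h
  · simpa using cnt_nonneg a b x
  · push Not at h
    obtain ⟨i, hi, hx⟩ := h
    rw [sub_zero]
    refine le_trans ?_ (Finset.single_le_sum (fun i _ => ind_nonneg i x) hi)
    simp [ind, Bool.eq_true_of_not_eq_false hx]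

/-- A block without ones has count zero. -/
theorem cnt_mul_emp {a b c d : ℕ} (hca : c ≤ a) (hbd : b ≤ d) (x : ℕ → Bool) :
    cnt a b x * emp c d x = 0 := by
  classical
  rw [emp_eq_ite]
  split_ifs with h
  · rw [mul_one]
    exact Finset.sum_eq_zero fun i hi => by
      simp [ind, h i (Finset.Ico_subset_Ico hca hbd hi)]
  · simp

/-! ### Stationary mixing laws -/

/-- A stationary law on binary sequences for which square-integrable functions of the coordinates
`i < t` and of the coordinates `t + l ≤ i < N` have correlation at most `ρ`. -/
structure MixingLaw (μ : Measure (ℕ → Bool)) (N l : ℕ) (ρ : ℝ) : Prop where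
  map_shift : ∀ h, μ.map (shift h) = μ
  nonneg : 0 ≤ ρ
  mixing : ∀ (t : ℕ) (f g : (ℕ → Bool) → ℝ), DependsOn f (Set.Iio t) →
    DependsOn g (Set.Ico (t + l) N) →
    |∫ x, f x * g x ∂μ - (∫ x, f x ∂μ) * ∫ x, g x ∂μ|
      ≤ ρ * (√(∫ x, f x ^ 2 ∂μ) * √(∫ x, g x ^ 2 ∂μ))

/-- The probability of a one at a given place. -/
noncomputable def rate (μ : Measure (ℕ → Bool)) : ℝ := ∫ x, ind 0 x ∂μ

/-- The probability that there are no ones at `m` consecutive places. -/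
noncomputable def void (μ : Measure (ℕ → Bool)) (m : ℕ) : ℝ := ∫ x, emp 0 m x ∂μ

theorem integral_mono_cyl {μ : Measure (ℕ → Bool)} [IsFiniteMeasure μ] {f g : (ℕ → Bool) → ℝ}
    (hf : Cylindrical f) (hg : Cylindrical g) (h : ∀ x, f x ≤ g x) :
    ∫ x, f x ∂μ ≤ ∫ x, g x ∂μ :=
  integral_mono hf.integrable hg.integrable h

theorem integral_le_const {μ : Measure (ℕ → Bool)} [IsProbabilityMeasure μ] {f : (ℕ → Bool) → ℝ}
    {c : ℝ} (hf : Cylindrical f) (h : ∀ x, f x ≤ c) : ∫ x, f x ∂μ ≤ c := by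
  simpa using integral_mono_cyl (μ := μ) hf (.const c) h

theorem integral_sub_cyl {μ : Measure (ℕ → Bool)} [IsFiniteMeasure μ] {f g : (ℕ → Bool) → ℝ}
    (hf : Cylindrical f) (hg : Cylindrical g) :
    ∫ x, f x - g x ∂μ = ∫ x, f x ∂μ - ∫ x, g x ∂μ :=
  integral_sub hf.integrable hg.integrable

theorem integral_add_cyl {μ : Measure (ℕ → Bool)} [IsFiniteMeasure μ] {f g : (ℕ → Bool) → ℝ}
    (hf : Cylindrical f) (hg : Cylindrical g) :
    ∫ x, f x + g x ∂μ = ∫ x, f x ∂μ + ∫ x, g x ∂μ :=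
  integral_add hf.integrable hg.integrable

theorem integral_sum_cyl {μ : Measure (ℕ → Bool)} [IsFiniteMeasure μ] {ι : Type*} (s : Finset ι)
    {f : ι → (ℕ → Bool) → ℝ} (hf : ∀ i, Cylindrical (f i)) :
    ∫ x, ∑ i ∈ s, f i x ∂μ = ∑ i ∈ s, ∫ x, f i x ∂μ :=
  integral_finsetSum _ fun i _ => (hf i).integrable

theorem abs_integral_le_of_abs_le {μ : Measure (ℕ → Bool)} [IsFiniteMeasure μ]
    {f g : (ℕ → Bool) → ℝ} (hf : Cylindrical f) (hg : Cylindrical g) (h : ∀ x, |f x| ≤ g x) :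
    |∫ x, f x ∂μ| ≤ ∫ x, g x ∂μ :=
  (abs_integral_le_integral_abs).trans (integral_mono_cyl hf.abs hg h)

/-- The Cauchy–Schwarz inequality for functions of finitely many coordinates. -/
theorem integral_mul_le_sqrt {μ : Measure (ℕ → Bool)} [IsFiniteMeasure μ]
    {f g : (ℕ → Bool) → ℝ} (hf : Cylindrical f) (hg : Cylindrical g) :
    |∫ x, f x * g x ∂μ| ≤ √(∫ x, f x ^ 2 ∂μ) * √(∫ x, g x ^ 2 ∂μ) := by
  rw [← Real.sqrt_mul (integral_nonneg fun x => sq_nonneg _)]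
  refine Real.abs_le_sqrt ?_
  have key : ∀ t : ℝ, 0 ≤ (∫ x, g x ^ 2 ∂μ) * (t * t) + (2 * ∫ x, f x * g x ∂μ) * t
      + ∫ x, f x ^ 2 ∂μ := fun t => by
    have h : ∫ x, (f x + t * g x) ^ 2 ∂μ = (∫ x, g x ^ 2 ∂μ) * (t * t)
        + (2 * ∫ x, f x * g x ∂μ) * t + ∫ x, f x ^ 2 ∂μ := by
      have e : ∀ x, (f x + t * g x) ^ 2 = (t * t) * g x ^ 2 + (2 * t) * (f x * g x) + f x ^ 2 :=
        fun x => by ring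
      simp_rw [e]
      rw [integral_add_cyl (by fun_prop) (by fun_prop), integral_add_cyl (by fun_prop)
        (by fun_prop), integral_const_mul, integral_const_mul]
      ring
    rw [← h]
    exact integral_nonneg fun x => sq_nonneg _
  have := discrim_le_zero key
  unfold discrim at this
  linarith

/-- Minkowski's inequality for functions of finitely many coordinates. -/
theorem sqrt_integral_add_sq_le {μ : Measure (ℕ → Bool)} [IsFiniteMeasure μ]
    {f g : (ℕ → Bool) → ℝ} (hf : Cylindrical f) (hg : Cylindrical g) :
    √(∫ x, (f x + g x) ^ 2 ∂μ) ≤ √(∫ x, f x ^ 2 ∂μ) + √(∫ x, g x ^ 2 ∂μ) := by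
  refine Real.sqrt_le_iff.2 ⟨by positivity, ?_⟩
  have e : ∀ x, (f x + g x) ^ 2 = f x ^ 2 + 2 * (f x * g x) + g x ^ 2 := fun x => by ring
  simp_rw [e]
  rw [integral_add_cyl (by fun_prop) (by fun_prop), integral_add_cyl (by fun_prop)
    (by fun_prop), integral_const_mul, add_sq, Real.sq_sqrt (integral_nonneg fun x => sq_nonneg _),
    Real.sq_sqrt (integral_nonneg fun x => sq_nonneg _)]
  have := (le_abs_self _).trans (integral_mul_le_sqrt (μ := μ) hf hg)
  linarith

theorem abs_integral_le_sqrt {μ : Measure (ℕ → Bool)} [IsProbabilityMeasure μ]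
    {f : (ℕ → Bool) → ℝ} (hf : Cylindrical f) : |∫ x, f x ∂μ| ≤ √(∫ x, f x ^ 2 ∂μ) := by
  simpa using integral_mul_le_sqrt (μ := μ) hf (.const 1)

section Bounds

variable {μ : Measure (ℕ → Bool)}

theorem rate_nonneg : 0 ≤ rate μ := integral_nonneg fun x => ind_nonneg 0 x

theorem void_nonneg (m : ℕ) : 0 ≤ void μ m := integral_nonneg fun x => emp_nonneg 0 m x

variable [IsProbabilityMeasure μ]

theorem void_le_one (m : ℕ) : void μ m ≤ 1 := integral_le_const (by fun_prop) (emp_le_one 0 m)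

theorem void_anti {m k : ℕ} (h : m ≤ k) : void μ k ≤ void μ m :=
  integral_mono_cyl (by fun_prop) (by fun_prop) (emp_anti le_rfl h)

end Bounds

namespace MixingLaw

variable {μ : Measure (ℕ → Bool)} {N l : ℕ} {ρ : ℝ}

theorem integral_shift {E : Type*} [NormedAddCommGroup E] [NormedSpace ℝ E]
    (hμ : MixingLaw μ N l ρ) {f : (ℕ → Bool) → E} (hf : Cylindrical f) (h : ℕ) :
    ∫ x, f (shift h x) ∂μ = ∫ x, f x ∂μ := by
  conv_rhs => rw [← hμ.map_shift h]
  exact (integral_map (measurable_shift h).aemeasurable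
    hf.measurable_and_bounded.1.aestronglyMeasurable).symm

/-- The mixing inequality for functions with given bounds on their second moments. -/
theorem abs_cov_le_of_sq_le (hμ : MixingLaw μ N l ρ) {t c : ℕ} {f g : (ℕ → Bool) → ℝ} {A B : ℝ}
    (hf : DependsOn f (Set.Iio t)) (hg : DependsOn g (Set.Ico c N)) (hc : t + l ≤ c)
    (hA : ∫ x, f x ^ 2 ∂μ ≤ A) (hB : ∫ x, g x ^ 2 ∂μ ≤ B) :
    |∫ x, f x * g x ∂μ - (∫ x, f x ∂μ) * ∫ x, g x ∂μ| ≤ ρ * (√A * √B) := by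
  refine (hμ.mixing t f g hf fun x y h => hg fun i hi => h i ⟨hc.trans hi.1, hi.2⟩).trans ?_
  have := hμ.nonneg
  gcongr

theorem integral_ind (hμ : MixingLaw μ N l ρ) (i : ℕ) : ∫ x, ind i x ∂μ = rate μ := by
  simpa [ind_shift, rate] using hμ.integral_shift (cylindrical_ind 0) i

variable [IsProbabilityMeasure μ]

theorem integral_emp (hμ : MixingLaw μ N l ρ) (a b : ℕ) : ∫ x, emp a b x ∂μ = void μ (b - a) := by
  rcases le_total a b with h | h
  · simpa [emp_shift, Nat.sub_add_cancel h, void] using hμ.integral_shift (cylindrical_emp 0 (b - a)) a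
  · simp [void, emp, h, Nat.sub_eq_zero_of_le h]

theorem integral_cnt (hμ : MixingLaw μ N l ρ) (a m : ℕ) :
    ∫ x, cnt a (a + m) x ∂μ = m * rate μ := by
  unfold cnt
  rw [integral_sum_cyl _ fun i => cylindrical_ind i]
  simp [hμ.integral_ind]

theorem integral_one_sub_emp_le (hμ : MixingLaw μ N l ρ) (a m : ℕ) :
    ∫ x, (1 - emp a (a + m) x) ∂μ ≤ m * rate μ := by
  rw [← hμ.integral_cnt a m]
  exact integral_mono_cyl (by fun_prop) (by fun_prop) (one_sub_emp_le_cnt a _)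

theorem void_sub_void_le (hμ : MixingLaw μ N l ρ) (m d : ℕ) :
    void μ m - void μ (m + d) ≤ d * rate μ := by
  refine le_trans ?_ (hμ.integral_one_sub_emp_le m d)
  rw [void, void, ← integral_sub_cyl (by fun_prop) (by fun_prop)]
  refine integral_mono_cyl (by fun_prop) (by fun_prop) fun x => ?_
  rw [← emp_mul_emp (Nat.zero_le m) (Nat.le_add_right m d)]
  nlinarith [emp_nonneg 0 m x, emp_le_one 0 m x, emp_nonneg m (m + d) x, emp_le_one m (m + d) x]

theorem abs_void_sub_void_le (hμ : MixingLaw μ N l ρ) {m k d : ℕ} (h : m ≤ k + d)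
    (h' : k ≤ m + d) : |void μ m - void μ k| ≤ d * rate μ := by
  have h1 := hμ.void_sub_void_le m d
  have h2 := hμ.void_sub_void_le k d
  have h3 := void_anti (μ := μ) h
  have h4 := void_anti (μ := μ) h'
  rw [abs_le]
  constructor <;> linarith

theorem abs_cov_le_of_abs_le_one (hμ : MixingLaw μ N l ρ) {t c : ℕ} {f g : (ℕ → Bool) → ℝ}
    (hf : DependsOn f (Set.Iio t)) (hg : DependsOn g (Set.Ico c N)) (hc : t + l ≤ c)
    (hA : ∀ x, |f x| ≤ 1) (hB : ∀ x, |g x| ≤ 1) :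
    |∫ x, f x * g x ∂μ - (∫ x, f x ∂μ) * ∫ x, g x ∂μ| ≤ ρ := by
  have hf' : Cylindrical f := ⟨t, hf⟩
  have hg' : Cylindrical g := .of_dependsOn hg fun i hi => hi.2
  have h := hμ.abs_cov_le_of_sq_le (A := 1) (B := 1) hf hg hc
    (integral_le_const (by fun_prop) fun x => (sq_le_one_iff_abs_le_one _).2 (hA x))
    (integral_le_const (by fun_prop) fun x => (sq_le_one_iff_abs_le_one _).2 (hB x))
  simpa using h

/-- The mixing inequality for complex-valued functions of modulus at most one. -/
theorem norm_cov_le (hμ : MixingLaw μ N l ρ) {t c : ℕ} {f g : (ℕ → Bool) → ℂ}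
    (hf : DependsOn f (Set.Iio t)) (hg : DependsOn g (Set.Ico c N)) (hc : t + l ≤ c)
    (hA : ∀ x, ‖f x‖ ≤ 1) (hB : ∀ x, ‖g x‖ ≤ 1) :
    ‖∫ x, f x * g x ∂μ - (∫ x, f x ∂μ) * ∫ x, g x ∂μ‖ ≤ 4 * ρ := by
  have hf' : Cylindrical f := ⟨t, hf⟩
  have hg' : Cylindrical g := .of_dependsOn hg fun i hi => hi.2
  have e : ∀ F : (ℕ → Bool) → ℂ, Cylindrical F →
      ∫ x, F x ∂μ = ((∫ x, (F x).re ∂μ : ℝ) : ℂ) + ((∫ x, (F x).im ∂μ : ℝ) : ℂ) * Complex.I :=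
    fun F hF => (integral_re_add_im (𝕜 := ℂ) hF.integrable).symm
  have hfg : Cylindrical fun x => f x * g x := .comp₂ _ hf' hg'
  have cfr : Cylindrical fun x => (f x).re := .comp _ hf'
  have cfi : Cylindrical fun x => (f x).im := .comp _ hf'
  have cgr : Cylindrical fun x => (g x).re := .comp _ hg'
  have cgi : Cylindrical fun x => (g x).im := .comp _ hg'
  rw [e _ hfg, e _ hf', e _ hg']
  simp only [Complex.mul_re, Complex.mul_im]
  rw [integral_sub_cyl (by fun_prop) (by fun_prop), integral_add_cyl (by fun_prop) (by fun_prop)]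
  have dep : ∀ (F : (ℕ → Bool) → ℂ) (s : Set ℕ) (G : ℂ → ℝ), DependsOn F s →
      DependsOn (fun x => G (F x)) s := fun F s G h x y hxy => congrArg G (h hxy)
  have hre : ∀ z : ℂ, ‖z‖ ≤ 1 → |z.re| ≤ 1 := fun z hz => (Complex.abs_re_le_norm z).trans hz
  have him : ∀ z : ℂ, ‖z‖ ≤ 1 → |z.im| ≤ 1 := fun z hz => (Complex.abs_im_le_norm z).trans hz
  have h1 := hμ.abs_cov_le_of_abs_le_one (dep f _ Complex.re hf) (dep g _ Complex.re hg) hc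
    (fun x => hre _ (hA x)) (fun x => hre _ (hB x))
  have h2 := hμ.abs_cov_le_of_abs_le_one (dep f _ Complex.im hf) (dep g _ Complex.im hg) hc
    (fun x => him _ (hA x)) (fun x => him _ (hB x))
  have h3 := hμ.abs_cov_le_of_abs_le_one (dep f _ Complex.re hf) (dep g _ Complex.im hg) hc
    (fun x => hre _ (hA x)) (fun x => him _ (hB x))
  have h4 := hμ.abs_cov_le_of_abs_le_one (dep f _ Complex.im hf) (dep g _ Complex.re hg) hc
    (fun x => him _ (hA x)) (fun x => hre _ (hB x))
  rw [abs_le] at h1 h2 h3 h4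
  refine (Complex.norm_le_abs_re_add_abs_im _).trans ?_
  simp only [Complex.sub_re, Complex.sub_im, Complex.add_re, Complex.add_im, Complex.mul_re,
    Complex.mul_im, Complex.ofReal_re, Complex.ofReal_im, Complex.I_re, Complex.I_im]
  refine (add_le_add (b := 2 * ρ) (d := 2 * ρ) (abs_le.2 ⟨?_, ?_⟩) (abs_le.2 ⟨?_, ?_⟩)).trans
    (by linarith) <;> linarith [h1.1, h1.2, h2.1, h2.2, h3.1, h3.2, h4.1, h4.2]

/-- Two blocks without ones are asymptotically independent, even when they are adjacent: dropping
the first `l` places of the second block opens the gap that the mixing inequality needs. -/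
theorem abs_integral_emp_mul_emp_sub_le (hμ : MixingLaw μ N l ρ) {a b c d : ℕ} (hbc : b ≤ c)
    (hd : d ≤ N) :
    |∫ x, emp a b x * emp c d x ∂μ - void μ (b - a) * void μ (d - c)| ≤ ρ + 2 * (l * rate μ) := by
  have h1 : |∫ x, emp a b x * emp (c + l) d x ∂μ
      - (∫ x, emp a b x ∂μ) * ∫ x, emp (c + l) d x ∂μ| ≤ ρ := by
    refine hμ.abs_cov_le_of_abs_le_one (t := b) (c := c + l) (fun x y h => ?_) (fun x y h => ?_)
      (by omega) (fun x => ?_) (fun x => ?_)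
    · exact dependsOn_emp a b fun i hi => h i hi.2
    · exact dependsOn_emp (c + l) d fun i hi => h i ⟨hi.1, hi.2.trans_le hd⟩
    · exact abs_le.2 ⟨by linarith [emp_nonneg a b x], emp_le_one _ _ _⟩
    · exact abs_le.2 ⟨by linarith [emp_nonneg (c + l) d x], emp_le_one _ _ _⟩
  have hpt : ∀ x, 0 ≤ emp (c + l) d x - emp c d x ∧
      emp (c + l) d x - emp c d x ≤ 1 - emp c (c + l) x := fun x => by
    have h0 : emp c d x ≤ emp (c + l) d x := emp_anti (by omega) le_rfl x
    refine ⟨by linarith, ?_⟩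
    rcases le_total (c + l) d with h | h
    · rw [← emp_mul_emp (Nat.le_add_right c l) h]
      nlinarith [emp_nonneg c (c + l) x, emp_le_one c (c + l) x, emp_nonneg (c + l) d x,
        emp_le_one (c + l) d x]
    · have := emp_anti (le_refl c) h x
      linarith [emp_le_one (c + l) d x]
  have h2 : |∫ x, emp a b x * emp (c + l) d x ∂μ - ∫ x, emp a b x * emp c d x ∂μ|
      ≤ l * rate μ := by
    rw [← integral_sub_cyl (by fun_prop) (by fun_prop)]
    refine (abs_integral_le_of_abs_le (g := fun x => 1 - emp c (c + l) x) (by fun_prop)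
      (by fun_prop) fun x => ?_).trans (hμ.integral_one_sub_emp_le c l)
    rw [← mul_sub, abs_mul, abs_of_nonneg (emp_nonneg a b x), abs_of_nonneg (hpt x).1]
    nlinarith [(hpt x).1, (hpt x).2, emp_nonneg a b x, emp_le_one a b x]
  have h3 : |void μ (d - (c + l)) - void μ (d - c)| ≤ l * rate μ :=
    hμ.abs_void_sub_void_le (by omega) (by omega)
  rw [hμ.integral_emp, hμ.integral_emp] at h1
  have h4 := void_nonneg (μ := μ) (b - a)
  have h5 := void_le_one (μ := μ) (b - a)
  have h6 : |void μ (b - a) * (void μ (d - (c + l)) - void μ (d - c))| ≤ l * rate μ := by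
    rw [abs_mul, abs_of_nonneg h4]
    nlinarith [abs_nonneg (void μ (d - (c + l)) - void μ (d - c))]
  rw [abs_le] at *
  constructor <;> linarith [h1.1, h1.2, h2.1, h2.2, h6.1, h6.2]

theorem abs_void_add_sub_le (hμ : MixingLaw μ N l ρ) {m k : ℕ} (h : m + k ≤ N) :
    |void μ (m + k) - void μ m * void μ k| ≤ ρ + 2 * (l * rate μ) := by
  have := hμ.abs_integral_emp_mul_emp_sub_le (a := 0) (b := m) (c := m) (d := m + k) le_rfl h
  simp_rw [emp_mul_emp (Nat.zero_le m) (Nat.le_add_right m k)] at this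
  simpa [void] using this

/-- A block of length `j m` is nearly a union of `j` independent blocks of length `m`. -/
theorem abs_void_mul_sub_pow_le (hμ : MixingLaw μ N l ρ) {m : ℕ} (j : ℕ) (h : j * m ≤ N) :
    |void μ (j * m) - void μ m ^ j| ≤ j * (ρ + 2 * (l * rate μ)) := by
  induction j with
  | zero => simp [void, emp]
  | succ j ih =>
    have h0 : j * m + m ≤ N := by rwa [Nat.succ_mul] at h
    have h1 := hμ.abs_void_add_sub_le h0
    have h2 := ih (by omega)
    have h3 := void_nonneg (μ := μ) m
    have h4 := void_le_one (μ := μ) m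
    have h5 : |(void μ (j * m) - void μ m ^ j) * void μ m|
        ≤ j * (ρ + 2 * (l * rate μ)) := by
      rw [abs_mul, abs_of_nonneg h3]
      nlinarith [abs_nonneg (void μ (j * m) - void μ m ^ j)]
    rw [Nat.succ_mul, pow_succ]
    push_cast
    rw [abs_le] at *
    constructor <;> linarith [h1.1, h1.2, h5.1, h5.2]

/-- The second moment of a sum of centred functions of separated blocks. -/
theorem abs_integral_sum_shift_sq_sub_le (hμ : MixingLaw μ N l ρ) {f : (ℕ → Bool) → ℝ}
    {a b D : ℕ} (m : ℕ) (hf : DependsOn f (Set.Ico a b)) (hD : b + l ≤ a + D)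
    (hN : m * D + b ≤ N + D) (h0 : ∫ x, f x ∂μ = 0) :
    |∫ x, (∑ j ∈ Finset.range m, f (shift (j * D) x)) ^ 2 ∂μ - m * ∫ x, f x ^ 2 ∂μ|
      ≤ (m : ℝ) ^ 2 * (ρ * ∫ x, f x ^ 2 ∂μ) := by
  have hc : Cylindrical f := .of_dependsOn hf fun i hi => hi.2
  have hcs : ∀ j, Cylindrical fun x => f (shift (j * D) x) := fun j => hc.shift _
  have hv : 0 ≤ ∫ x, f x ^ 2 ∂μ := integral_nonneg fun x => sq_nonneg _
  have hsq : ∀ j, ∫ x, f (shift (j * D) x) ^ 2 ∂μ = ∫ x, f x ^ 2 ∂μ := fun j =>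
    hμ.integral_shift (f := fun x => f x ^ 2) (by fun_prop) (j * D)
  have hlt : ∀ i j, i < j → j < m →
      |∫ x, f (shift (i * D) x) * f (shift (j * D) x) ∂μ| ≤ ρ * ∫ x, f x ^ 2 ∂μ := by
    intro i j hij hjm
    have e1 : (i + 1) * D ≤ j * D := Nat.mul_le_mul_right D hij
    have e2 : (j + 1) * D ≤ m * D := Nat.mul_le_mul_right D hjm
    rw [Nat.succ_mul] at e1 e2
    have h1 := hμ.abs_cov_le_of_sq_le (t := b + i * D) (c := a + j * D)
      (f := fun x => f (shift (i * D) x)) (g := fun x => f (shift (j * D) x))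
      (fun x y h => dependsOn_shift hf (i * D) fun k hk => h k hk.2)
      (fun x y h => dependsOn_shift hf (j * D) fun k hk =>
        h k ⟨hk.1, lt_of_lt_of_le hk.2 (by omega)⟩)
      (by omega) (hsq i).le (hsq j).le
    rwa [hμ.integral_shift hc, h0, zero_mul, sub_zero, Real.mul_self_sqrt hv] at h1
  have hne : ∀ i ∈ Finset.range m, ∀ j ∈ Finset.range m,
      |∫ x, f (shift (i * D) x) * f (shift (j * D) x) ∂μ - if i = j then ∫ x, f x ^ 2 ∂μ else 0|
        ≤ ρ * ∫ x, f x ^ 2 ∂μ := by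
    intro i hi j hj
    rw [Finset.mem_range] at hi hj
    rcases lt_trichotomy i j with h | h | h
    · simpa [h.ne] using hlt i j h hj
    · subst h
      simp_rw [← sq]
      simpa [hsq] using mul_nonneg hμ.nonneg hv
    · simp_rw [mul_comm (f (shift (i * D) _))]
      simpa [h.ne'] using hlt j i h hi
  simp_rw [sq (∑ j ∈ Finset.range m, _), Finset.sum_mul_sum]
  rw [integral_sum_cyl _ fun i => .sum _ fun j => (hcs i).mul (hcs j)]
  have e : (m : ℝ) * ∫ x, f x ^ 2 ∂μ
      = ∑ i ∈ Finset.range m, ∑ j ∈ Finset.range m, if i = j then ∫ x, f x ^ 2 ∂μ else 0 := by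
    rw [Finset.sum_congr rfl fun i hi => Finset.sum_ite_eq (Finset.range m) i _,
      Finset.sum_congr rfl fun i hi => if_pos hi]
    simp
  rw [e, ← Finset.sum_sub_distrib]
  refine (Finset.abs_sum_le_sum_abs _ _).trans ?_
  have : ∀ i ∈ Finset.range m, |∫ x, ∑ j ∈ Finset.range m,
      f (shift (i * D) x) * f (shift (j * D) x) ∂μ
        - ∑ j ∈ Finset.range m, if i = j then ∫ x, f x ^ 2 ∂μ else 0|
      ≤ m * (ρ * ∫ x, f x ^ 2 ∂μ) := by
    intro i hi
    rw [integral_sum_cyl _ fun j => (hcs i).mul (hcs j), ← Finset.sum_sub_distrib]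
    refine (Finset.abs_sum_le_sum_abs _ _).trans ((Finset.sum_le_sum (hne i hi)).trans ?_)
    simp
  refine (Finset.sum_le_sum this).trans ?_
  simp [sq, mul_assoc]

theorem integral_sum_shift_sq_le (hμ : MixingLaw μ N l ρ) {f : (ℕ → Bool) → ℝ}
    {a b D : ℕ} (m : ℕ) (hf : DependsOn f (Set.Ico a b)) (hD : b + l ≤ a + D)
    (hN : m * D + b ≤ N + D) (h0 : ∫ x, f x ∂μ = 0) :
    ∫ x, (∑ j ∈ Finset.range m, f (shift (j * D) x)) ^ 2 ∂μ
      ≤ (m + (m : ℝ) ^ 2 * ρ) * ∫ x, f x ^ 2 ∂μ := by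
  have := (abs_le.1 (hμ.abs_integral_sum_shift_sq_sub_le m hf hD hN h0)).2
  linarith

/-- The expectation of a product of functions of separated blocks nearly factorizes. -/
theorem norm_integral_prod_shift_sub_le (hμ : MixingLaw μ N l ρ) {f : (ℕ → Bool) → ℂ}
    {b D : ℕ} (m : ℕ) (hf : DependsOn f (Set.Ico 0 b)) (hD : b + l ≤ D)
    (hN : m * D + b ≤ N + D) (h1 : ∀ x, ‖f x‖ ≤ 1) :
    ‖∫ x, ∏ j ∈ Finset.range m, f (shift (j * D) x) ∂μ - (∫ x, f x ∂μ) ^ m‖ ≤ m * (4 * ρ) := by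
  have hc : Cylindrical f := .of_dependsOn hf fun i hi => hi.2
  induction m with
  | zero => simp
  | succ m ih =>
    rw [Nat.succ_mul] at hN
    have hprod : ∀ x, ‖∏ j ∈ Finset.range m, f (shift (j * D) x)‖ ≤ 1 := fun x => by
      rw [norm_prod]
      exact Finset.prod_le_one (fun _ _ => norm_nonneg _) fun _ _ => h1 _
    have hdep : DependsOn (fun x => ∏ j ∈ Finset.range m, f (shift (j * D) x))
        (Set.Iio (m * D - l)) := fun x y h => Finset.prod_congr rfl fun j hj => by
      have e : (j + 1) * D ≤ m * D := Nat.mul_le_mul_right D (Finset.mem_range.1 hj)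
      rw [Nat.succ_mul] at e
      refine dependsOn_shift hf (j * D) fun k hk => h k ?_
      have := hk.2
      exact Set.mem_Iio.2 (by omega)
    have hdep' : DependsOn (fun x => f (shift (m * D) x)) (Set.Ico (m * D) N) := fun x y h =>
      dependsOn_shift hf (m * D) fun k hk => h k ⟨by simpa using hk.1, hk.2.trans_le (by omega)⟩
    have key : ‖∫ x, (∏ j ∈ Finset.range m, f (shift (j * D) x)) * f (shift (m * D) x) ∂μ
        - (∫ x, ∏ j ∈ Finset.range m, f (shift (j * D) x) ∂μ) * ∫ x, f x ∂μ‖ ≤ 4 * ρ := by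
      rcases Nat.eq_zero_or_pos m with rfl | hm
      · simpa [hμ.integral_shift hc] using hμ.nonneg
      · have hmD : D ≤ m * D := Nat.le_mul_of_pos_left D hm
        have := hμ.norm_cov_le hdep hdep' (by omega) hprod (fun x => h1 _)
        rwa [hμ.integral_shift hc] at this
    have ih' := ih (by omega)
    have hfn : ‖∫ x, f x ∂μ‖ ≤ 1 := by
      simpa using norm_integral_le_of_norm_le_const (μ := μ) (ae_of_all _ h1)
    simp_rw [Finset.prod_range_succ]
    rw [pow_succ]
    calc ‖∫ x, (∏ j ∈ Finset.range m, f (shift (j * D) x)) * f (shift (m * D) x) ∂μ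
          - (∫ x, f x ∂μ) ^ m * ∫ x, f x ∂μ‖
        = ‖(∫ x, (∏ j ∈ Finset.range m, f (shift (j * D) x)) * f (shift (m * D) x) ∂μ
          - (∫ x, ∏ j ∈ Finset.range m, f (shift (j * D) x) ∂μ) * ∫ x, f x ∂μ)
          + (∫ x, ∏ j ∈ Finset.range m, f (shift (j * D) x) ∂μ - (∫ x, f x ∂μ) ^ m)
            * ∫ x, f x ∂μ‖ := by congr 1; ring
      _ ≤ 4 * ρ + m * (4 * ρ) * 1 := by
          refine (norm_add_le _ _).trans (add_le_add key ?_)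
          rw [norm_mul]
          exact mul_le_mul ih' hfn (norm_nonneg _) (by have := hμ.nonneg; positivity)
      _ = (m + 1 : ℕ) * (4 * ρ) := by push_cast; ring

end MixingLaw

/-! ### Void probabilities of long blocks -/

theorem abs_exp_neg_sub_exp_neg_le {x y : ℝ} (hx : 0 ≤ x) (hy : 0 ≤ y) :
    |Real.exp (-x) - Real.exp (-y)| ≤ |x - y| := by
  wlog h : x ≤ y generalizing x y
  · rw [abs_sub_comm, abs_sub_comm x]
    exact this hy hx (le_of_not_ge h)
  have h1 : Real.exp (-y) ≤ Real.exp (-x) := Real.exp_le_exp.2 (by linarith)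
  have h2 : Real.exp (-x) ≤ 1 := Real.exp_le_one_iff.2 (by linarith)
  rw [abs_of_nonneg (by linarith), abs_of_nonpos (by linarith)]
  have h3 : Real.exp (-y) = Real.exp (-x) * Real.exp (x - y) := by
    rw [← Real.exp_add]; congr 1; ring
  have h4 := Real.add_one_le_exp (x - y)
  nlinarith [Real.exp_pos (-x)]

/-- An array of stationary laws of binary sequences, with blocks of length `r n` that contain on
average about `τ` ones and none with probability about `exp (-α)`. The mixing coefficients are so
small that blocks of the intermediate length `s n` decouple when shortened by `l n` places. -/
structure BlockArray (μ : ℕ → Measure (ℕ → Bool)) (r l s : ℕ → ℕ) (ρ : ℕ → ℝ) (τ α : ℝ) :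
    Prop where
  prob : ∀ n, IsProbabilityMeasure (μ n)
  law : ∀ n, MixingLaw (μ n) n (l n) (ρ n)
  r_pos : ∀ n, 0 < r n
  l_pos : ∀ n, 0 < l n
  s_pos : ∀ n, 0 < s n
  l_div_s : Tendsto (fun n => (l n : ℝ) / s n) atTop (𝓝 0)
  s_div_r : Tendsto (fun n => (s n : ℝ) / r n) atTop (𝓝 0)
  r_div_n : Tendsto (fun n => (r n : ℝ) / n) atTop (𝓝 0)
  mix : Tendsto (fun n => n * ρ n / s n) atTop (𝓝 0)
  tendsto_rate : Tendsto (fun n => r n * rate (μ n)) atTop (𝓝 τ)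
  tendsto_void : Tendsto (fun n => void (μ n) (r n)) atTop (𝓝 (Real.exp (-α)))
  alpha_pos : 0 < α

namespace BlockArray

variable {μ : ℕ → Measure (ℕ → Bool)} {r l s : ℕ → ℕ} {ρ : ℕ → ℝ} {τ α : ℝ}

theorem r_pos' (hA : BlockArray μ r l s ρ τ α) (n : ℕ) : (0 : ℝ) < r n := Nat.cast_pos.2 (hA.r_pos n)

theorem s_pos' (hA : BlockArray μ r l s ρ τ α) (n : ℕ) : (0 : ℝ) < s n := Nat.cast_pos.2 (hA.s_pos n)

theorem rho_nonneg (hA : BlockArray μ r l s ρ τ α) (n : ℕ) : 0 ≤ ρ n := (hA.law n).nonneg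

theorem l_div_r (hA : BlockArray μ r l s ρ τ α) :
    Tendsto (fun n => (l n : ℝ) / r n) atTop (𝓝 0) := by
  have := hA.l_div_s.mul hA.s_div_r
  rw [mul_zero] at this
  refine this.congr fun n => ?_
  have := (hA.s_pos' n).ne'
  field_simp

theorem tendsto_r (hA : BlockArray μ r l s ρ τ α) :
    Tendsto (fun n => (r n : ℝ)) atTop atTop := by
  have h := hA.l_div_r
  have h1 : Tendsto (fun n => (r n : ℝ)⁻¹) atTop (𝓝 0) := by
    refine squeeze_zero (fun n => by have := hA.r_pos' n; positivity) (fun n => ?_) h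
    rw [inv_eq_one_div]
    have : (1 : ℝ) ≤ l n := Nat.one_le_cast.2 (hA.l_pos n)
    gcongr
  have h2 := Tendsto.inv_tendsto_nhdsGT_zero (tendsto_nhdsWithin_iff.2 ⟨h1,
    Eventually.of_forall fun n => inv_pos.2 (hA.r_pos' n)⟩)
  exact h2.congr fun n => inv_inv _

theorem eventually_mul_r_le (hA : BlockArray μ r l s ρ τ α) (C : ℕ) :
    ∀ᶠ n in atTop, C * r n ≤ n := by
  have h := hA.r_div_n.eventually_le_const (show (0 : ℝ) < ((C : ℝ) + 1)⁻¹ by positivity)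
  filter_upwards [h, eventually_gt_atTop 0] with n hn hn0
  have : (0 : ℝ) < n := Nat.cast_pos.2 hn0
  rw [div_le_iff₀ this, inv_mul_eq_div, le_div_iff₀ (by positivity)] at hn
  have := hA.r_pos' n
  exact_mod_cast (show (C : ℝ) * r n ≤ n by nlinarith)

theorem eventually_l_le_r (hA : BlockArray μ r l s ρ τ α) : ∀ᶠ n in atTop, l n ≤ r n := by
  filter_upwards [hA.l_div_r.eventually_le_const one_pos] with n hn
  rw [div_le_one (hA.r_pos' n)] at hn
  exact_mod_cast hn

theorem eventually_l_le_s (hA : BlockArray μ r l s ρ τ α) : ∀ᶠ n in atTop, l n ≤ s n := by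
  filter_upwards [hA.l_div_s.eventually_le_const one_pos] with n hn
  rw [div_le_one (hA.s_pos' n)] at hn
  exact_mod_cast hn

/-- The sum of the mixing errors over the `r / s` blocks of length `s` within a block of length `r`
vanishes. -/
theorem tendsto_div_mul_rho (hA : BlockArray μ r l s ρ τ α) :
    Tendsto (fun n => (r n : ℝ) / s n * ρ n) atTop (𝓝 0) := by
  have := hA.r_div_n.mul hA.mix
  rw [mul_zero] at this
  refine this.congr' ?_
  filter_upwards [eventually_gt_atTop 0] with n hn
  have : (n : ℝ) ≠ 0 := Nat.cast_ne_zero.2 hn.ne'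
  field_simp

theorem tendsto_mul_rho_div_r (hA : BlockArray μ r l s ρ τ α) :
    Tendsto (fun n : ℕ => (n : ℝ) / r n * ρ n) atTop (𝓝 0) := by
  have := hA.s_div_r.mul hA.mix
  rw [mul_zero] at this
  refine this.congr fun n => ?_
  have := (hA.s_pos' n).ne'
  field_simp

theorem tendsto_rho (hA : BlockArray μ r l s ρ τ α) : Tendsto ρ atTop (𝓝 0) := by
  have := hA.tendsto_mul_rho_div_r.mul hA.r_div_n
  rw [mul_zero] at this
  refine this.congr' ?_
  filter_upwards [eventually_gt_atTop 0] with n hn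
  have : (n : ℝ) ≠ 0 := Nat.cast_ne_zero.2 hn.ne'
  have := (hA.r_pos' n).ne'
  field_simp

theorem tendsto_l_mul_rate (hA : BlockArray μ r l s ρ τ α) :
    Tendsto (fun n => l n * rate (μ n)) atTop (𝓝 0) := by
  have := hA.l_div_r.mul hA.tendsto_rate
  rw [zero_mul] at this
  refine this.congr fun n => ?_
  have := (hA.r_pos' n).ne'
  field_simp

theorem tendsto_s_mul_rate (hA : BlockArray μ r l s ρ τ α) :
    Tendsto (fun n => s n * rate (μ n)) atTop (𝓝 0) := by
  have := hA.s_div_r.mul hA.tendsto_rate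
  rw [zero_mul] at this
  refine this.congr fun n => ?_
  have := (hA.r_pos' n).ne'
  field_simp

theorem tendsto_separation_error (hA : BlockArray μ r l s ρ τ α) :
    Tendsto (fun n => ρ n + 2 * (l n * rate (μ n))) atTop (𝓝 0) := by
  simpa using hA.tendsto_rho.add (hA.tendsto_l_mul_rate.const_mul 2)

theorem tendsto_div_mul_separation_error (hA : BlockArray μ r l s ρ τ α) :
    Tendsto (fun n => (r n : ℝ) / s n * (ρ n + 2 * (l n * rate (μ n)))) atTop (𝓝 0) := by
  have h := hA.tendsto_div_mul_rho.add ((hA.l_div_s.mul hA.tendsto_rate).const_mul 2)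
  simp only [zero_mul, mul_zero, add_zero] at h
  refine h.congr fun n => ?_
  ring

theorem separation_error_nonneg (hA : BlockArray μ r l s ρ τ α) (n : ℕ) :
    0 ≤ ρ n + 2 * (l n * rate (μ n)) := by
  have := hA.rho_nonneg n
  have := rate_nonneg (μ := μ n)
  positivity

/-- A block of length `d` is nearly a union of `d / s` independent blocks of length `s`. -/
theorem abs_void_sub_void_pow_le (hA : BlockArray μ r l s ρ τ α) {n d C : ℕ} (hd : d ≤ C * r n)
    (hn : d ≤ n) :
    |void (μ n) d - void (μ n) (s n) ^ (d / s n)| ≤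
      s n * rate (μ n) + C * ((r n : ℝ) / s n * (ρ n + 2 * (l n * rate (μ n)))) := by
  have := hA.prob n
  have e := Nat.div_add_mod d (s n)
  have e' := Nat.mod_lt d (hA.s_pos n)
  have hle : d / s n * s n ≤ d := Nat.div_mul_le_self d (s n)
  rw [mul_comm] at e
  have h1 := (hA.law n).abs_void_sub_void_le (m := d) (k := d / s n * s n) (d := s n)
    (by omega) (by omega)
  have h2 := (hA.law n).abs_void_mul_sub_pow_le (m := s n) (d / s n) (hle.trans hn)
  have h3 : ((d / s n : ℕ) : ℝ) ≤ C * ((r n : ℝ) / s n) := by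
    refine Nat.cast_div_le.trans ?_
    rw [← mul_div_assoc]
    have : (d : ℝ) ≤ C * r n := by exact_mod_cast hd
    gcongr
  have h4 := mul_le_mul_of_nonneg_right h3 (hA.separation_error_nonneg n)
  rw [← mul_assoc]
  exact (abs_sub_le _ _ _).trans (add_le_add h1 (h2.trans h4))

theorem tendsto_div_nat (hA : BlockArray μ r l s ρ τ α) :
    Tendsto (fun n => ((r n / s n : ℕ) : ℝ)) atTop atTop := by
  have h : Tendsto (fun n => (r n : ℝ) / s n) atTop atTop := by
    have h2 := Tendsto.inv_tendsto_nhdsGT_zero (tendsto_nhdsWithin_iff.2 ⟨hA.s_div_r,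
      Eventually.of_forall fun n => div_pos (hA.s_pos' n) (hA.r_pos' n)⟩)
    exact h2.congr fun n => inv_div _ _
  refine tendsto_atTop_mono (fun n => ?_) (tendsto_atTop_add_const_right _ (-1) h)
  have := Nat.lt_div_mul_add (a := r n) (hA.s_pos n)
  have h2 : (r n : ℝ) < (r n / s n : ℕ) * s n + s n := by exact_mod_cast this
  have h3 := hA.s_pos' n
  have : (r n : ℝ) / s n < (r n / s n : ℕ) + 1 := by
    rw [div_lt_iff₀ h3]; linarith
  linarith

theorem tendsto_div_div_nat (hA : BlockArray μ r l s ρ τ α) :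
    Tendsto (fun n => (r n : ℝ) / s n / (r n / s n : ℕ)) atTop (𝓝 1) := by
  have h := hA.tendsto_div_nat
  have h' : Tendsto (fun n => 1 + ((r n / s n : ℕ) : ℝ)⁻¹) atTop (𝓝 1) := by
    simpa using (tendsto_inv_atTop_zero.comp h).const_add 1
  refine tendsto_of_tendsto_of_tendsto_of_le_of_le' tendsto_const_nhds h' ?_ ?_
  · filter_upwards [h.eventually_gt_atTop 0] with n hn
    rw [le_div_iff₀ hn, one_mul]
    exact Nat.cast_div_le
  · filter_upwards [h.eventually_gt_atTop 0] with n hn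
    have := Nat.lt_div_mul_add (a := r n) (hA.s_pos n)
    have h2 : (r n : ℝ) < (r n / s n : ℕ) * s n + s n := by exact_mod_cast this
    have h3 := hA.s_pos' n
    rw [div_le_iff₀ hn, div_le_iff₀ h3, add_mul, inv_mul_cancel₀ hn.ne']
    nlinarith

theorem eventually_void_pos_and_tendsto_log (hA : BlockArray μ r l s ρ τ α) :
    (∀ᶠ n in atTop, 0 < void (μ n) (s n)) ∧
    Tendsto (fun n => (r n : ℝ) / s n * -Real.log (void (μ n) (s n))) atTop (𝓝 α) := by
  have h1 : Tendsto (fun n => void (μ n) (s n) ^ (r n / s n)) atTop (𝓝 (Real.exp (-α))) := by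
    refine hA.tendsto_void.congr_dist ?_
    refine squeeze_zero' (.of_forall fun n => dist_nonneg) ?_
      (by simpa using hA.tendsto_s_mul_rate.add hA.tendsto_div_mul_separation_error)
    filter_upwards [hA.eventually_mul_r_le 1] with n hn
    rw [one_mul] at hn
    simpa [Real.dist_eq] using hA.abs_void_sub_void_pow_le (n := n) (d := r n) (C := 1) (by simp) hn
  have hj := hA.tendsto_div_nat
  have hpos : ∀ᶠ n in atTop, 0 < void (μ n) (s n) := by
    filter_upwards [h1.eventually_const_lt (Real.exp_pos (-α)), hj.eventually_gt_atTop 0]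
      with n hn hn'
    refine (void_nonneg (s n)).lt_of_ne' fun h0 => ?_
    rw [h0, zero_pow (by exact_mod_cast hn'.ne')] at hn
    exact lt_irrefl _ hn
  refine ⟨hpos, ?_⟩
  have h2 := (Real.continuousAt_log (Real.exp_pos (-α)).ne').tendsto.comp h1
  rw [Real.log_exp] at h2
  have h3 := hA.tendsto_div_div_nat.mul h2.neg
  rw [neg_neg, one_mul] at h3
  refine h3.congr' ?_
  filter_upwards [hj.eventually_gt_atTop 0] with n hn
  simp only [Function.comp_apply, Real.log_pow]
  field_simp

theorem void_eq_exp {n : ℕ} (hA : BlockArray μ r l s ρ τ α) (h : 0 < void (μ n) (s n)) :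
    void (μ n) (s n)
      = Real.exp (-((r n : ℝ) / s n * -Real.log (void (μ n) (s n)) * (s n / r n))) := by
  have := (hA.r_pos' n).ne'
  have := (hA.s_pos' n).ne'
  have e : -((r n : ℝ) / s n * -Real.log (void (μ n) (s n)) * (s n / r n))
    = Real.log (void (μ n) (s n)) := by field_simp
  rw [e, Real.exp_log h]

/-- The probability that a block of length `s` contains a one is asymptotically `α s / r`. -/
theorem tendsto_div_mul_one_sub_void (hA : BlockArray μ r l s ρ τ α) :
    Tendsto (fun n => (r n : ℝ) / s n * (1 - void (μ n) (s n))) atTop (𝓝 α) := by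
  obtain ⟨hpos, hlog⟩ := hA.eventually_void_pos_and_tendsto_log
  have hv : Tendsto (fun n => void (μ n) (s n)) atTop (𝓝 1) := by
    have h := (Real.continuous_exp.tendsto _).comp (hlog.mul hA.s_div_r).neg
    simp only [mul_zero, neg_zero, Real.exp_zero] at h
    refine h.congr' ?_
    filter_upwards [hpos] with n hn using (hA.void_eq_exp hn).symm
  refine tendsto_of_tendsto_of_tendsto_of_le_of_le' (by simpa only [mul_one] using hlog.mul hv)
    hlog ?_ ?_
  · filter_upwards [hpos] with n hn
    have h1 := Real.log_le_sub_one_of_pos (inv_pos.2 hn)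
    rw [Real.log_inv] at h1
    have h2 : (void (μ n) (s n))⁻¹ * void (μ n) (s n) = 1 := inv_mul_cancel₀ hn.ne'
    have : 0 ≤ (r n : ℝ) / s n := by positivity
    simp only [mul_assoc]
    refine mul_le_mul_of_nonneg_left ?_ this
    nlinarith
  · filter_upwards [hpos] with n hn
    have h1 := Real.log_le_sub_one_of_pos hn
    refine mul_le_mul_of_nonneg_left ?_ (by positivity)
    linarith

/-- The exponential limit of the void probabilities, uniformly over block lengths of order `r`. -/
theorem eventually_abs_void_sub_exp_le (hA : BlockArray μ r l s ρ τ α) (C : ℕ) {ε : ℝ}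
    (hε : 0 < ε) : ∀ᶠ n in atTop, ∀ d ≤ C * r n,
      |void (μ n) d - Real.exp (-(α * (d / r n)))| ≤ ε := by
  obtain ⟨hpos, hlog⟩ := hA.eventually_void_pos_and_tendsto_log
  set a : ℕ → ℝ := fun n => (r n : ℝ) / s n * -Real.log (void (μ n) (s n)) with ha
  have herr : Tendsto (fun n => s n * rate (μ n)
      + C * ((r n : ℝ) / s n * (ρ n + 2 * (l n * rate (μ n)))) + a n * (s n / r n)
      + |a n - α| * C) atTop (𝓝 0) := by
    have h1 := (hlog.sub_const α).abs.mul_const (C : ℝ)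
    have h2 := ((hA.tendsto_s_mul_rate.add (hA.tendsto_div_mul_separation_error.const_mul
      (C : ℝ))).add (hlog.mul hA.s_div_r)).add h1
    simpa using h2
  filter_upwards [hpos, herr.eventually_le_const hε, hA.eventually_mul_r_le C,
    hlog.eventually_const_lt hA.alpha_pos] with n hn hne hCn han d hd
  have := hA.prob n
  refine le_trans ?_ hne
  have hr := hA.r_pos' n
  have hs := hA.s_pos' n
  have ha0 : 0 < a n := han
  have h1 := hA.abs_void_sub_void_pow_le hd (hd.trans hCn)
  have h2 : void (μ n) (s n) ^ (d / s n)
      = Real.exp (-(a n * (((d / s n : ℕ) : ℝ) * s n / r n))) := by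
    conv_lhs => rw [hA.void_eq_exp hn]
    rw [← Real.exp_nat_mul]
    congr 1
    simp only [ha]
    ring
  have hle : ((d / s n : ℕ) : ℝ) * s n ≤ d := by exact_mod_cast Nat.div_mul_le_self d (s n)
  have hge : (d : ℝ) ≤ (d / s n : ℕ) * s n + s n := by
    exact_mod_cast (Nat.lt_div_mul_add (a := d) (hA.s_pos n)).le
  have h3 : |void (μ n) (s n) ^ (d / s n) - Real.exp (-(a n * (d / r n)))|
      ≤ a n * (s n / r n) := by
    rw [h2]
    refine (abs_exp_neg_sub_exp_neg_le (by positivity) (by positivity)).trans ?_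
    rw [← mul_sub, abs_mul, abs_of_pos ha0, ← sub_div, abs_div, abs_of_pos hr]
    gcongr
    rw [abs_le]
    constructor <;> linarith
  have h4 : |Real.exp (-(a n * (d / r n))) - Real.exp (-(α * (d / r n)))| ≤ |a n - α| * C := by
    have := hA.alpha_pos
    refine (abs_exp_neg_sub_exp_neg_le (by positivity) (by positivity)).trans ?_
    rw [← sub_mul, abs_mul, abs_of_nonneg (show (0 : ℝ) ≤ d / r n by positivity)]
    gcongr
    rw [div_le_iff₀ hr]
    exact_mod_cast hd
  calc |void (μ n) d - Real.exp (-(α * (d / r n)))|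
      ≤ |void (μ n) d - void (μ n) (s n) ^ (d / s n)|
        + |void (μ n) (s n) ^ (d / s n) - Real.exp (-(a n * (d / r n)))|
        + |Real.exp (-(a n * (d / r n))) - Real.exp (-(α * (d / r n)))| :=
        (abs_sub_le _ (Real.exp (-(a n * (d / r n)))) _).trans
          (add_le_add (abs_sub_le _ _ _) le_rfl)
    _ ≤ _ := by linarith

end BlockArray

/-! ### Covariances of windows without ones -/

theorem emp_mul_emp_of_overlap {a b c d : ℕ} (hac : a ≤ c) (hcb : c ≤ b) (hbd : b ≤ d)
    (x : ℕ → Bool) : emp a b x * emp c d x = emp a d x := by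
  rw [← emp_mul_emp hcb hbd, ← emp_mul_emp (hac.trans hcb) hbd, ← emp_mul_emp hac hcb]
  linear_combination emp a c x * emp b d x * emp_mul_self c b x

/-- The limit covariance of the indicators that two windows of length `r` contain no ones, when the
windows are `x r` places apart: windows at distance at least `r` are disjoint. -/
noncomputable def windowCov (α x : ℝ) : ℝ :=
  Real.exp (-(α * (1 + min x 1))) - Real.exp (-(2 * α))

theorem windowCov_nonneg {α : ℝ} (hα : 0 < α) (x : ℝ) : 0 ≤ windowCov α x := by
  rw [windowCov, sub_nonneg, Real.exp_le_exp]
  nlinarith [min_le_right x 1]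

theorem windowCov_of_one_le (α : ℝ) {x : ℝ} (hx : 1 ≤ x) : windowCov α x = 0 := by
  rw [windowCov, min_eq_right hx, sub_eq_zero]
  congr 1
  ring

theorem windowCov_zero (α : ℝ) : windowCov α 0 = Real.exp (-α) - Real.exp (-(2 * α)) := by
  simp [windowCov]

theorem windowCov_le_one {α : ℝ} (hα : 0 < α) {x : ℝ} (hx : 0 ≤ x) : windowCov α x ≤ 1 := by
  have h1 : Real.exp (-(α * (1 + min x 1))) ≤ 1 := Real.exp_le_one_iff.2 (by
    have : 0 ≤ min x 1 := le_min hx zero_le_one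
    nlinarith)
  have h2 := Real.exp_pos (-(2 * α))
  rw [windowCov]
  linarith

/-- The integral of `windowCov α` over the unit interval. -/
noncomputable def windowCovIntegral (α : ℝ) : ℝ :=
  Real.exp (-α) * (1 - Real.exp (-α)) / α - Real.exp (-(2 * α))

theorem tendsto_mul_one_sub_exp_neg_div {α : ℝ} :
    Tendsto (fun y : ℝ => y * (1 - Real.exp (-(α / y)))) atTop (𝓝 α) := by
  have h : HasDerivAt (fun x : ℝ => 1 - Real.exp (-(α * x))) α 0 := by
    have h1 : HasDerivAt (fun x : ℝ => -(α * x)) (-α) 0 := by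
      simpa [neg_mul] using (hasDerivAt_id (0 : ℝ)).const_mul (-α)
    simpa using h1.exp.const_sub 1
  have h2 := (hasDerivAt_iff_tendsto_slope_zero.1 h).comp
    (tendsto_inv_atTop_nhdsGT_zero.mono_right (nhdsWithin_mono _ fun y (hy : 0 < y) => hy.ne'))
  refine h2.congr fun y => ?_
  simp [div_eq_mul_inv]

/-- The Riemann sums of `windowCov α`. -/
theorem tendsto_sum_windowCov {α : ℝ} (hα : 0 < α) {r : ℕ → ℕ} (hr : ∀ n, 0 < r n)
    (h : Tendsto (fun n => (r n : ℝ)) atTop atTop) :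
    Tendsto (fun n => (∑ d ∈ Finset.range (r n), windowCov α (d / r n)) / r n) atTop
      (𝓝 (windowCovIntegral α)) := by
  have e : ∀ n, (∑ d ∈ Finset.range (r n), windowCov α (d / r n)) / r n
      = Real.exp (-α) * (1 - Real.exp (-α)) / (r n * (1 - Real.exp (-(α / r n))))
        - Real.exp (-(2 * α)) := by
    intro n
    have hr0 : (0 : ℝ) < r n := Nat.cast_pos.2 (hr n)
    have hne : Real.exp (-(α / r n)) ≠ 1 := by
      rw [Ne, Real.exp_eq_one_iff]
      have : 0 < α / r n := by positivity
      linarith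
    have h1 : ∀ d ∈ Finset.range (r n), windowCov α (d / r n)
        = Real.exp (-α) * Real.exp (-(α / r n)) ^ d - Real.exp (-(2 * α)) := fun d hd => by
      have : (d : ℝ) / r n ≤ 1 := by
        rw [div_le_one hr0]
        exact_mod_cast (Finset.mem_range.1 hd).le
      rw [windowCov, min_eq_left this, ← Real.exp_nat_mul, ← Real.exp_add]
      congr 2
      ring
    have h2 : Real.exp (-(α / r n)) ^ r n = Real.exp (-α) := by
      rw [← Real.exp_nat_mul]
      congr 1
      field_simp
    rw [Finset.sum_congr rfl h1, Finset.sum_sub_distrib, ← Finset.mul_sum, geom_sum_eq hne, h2]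
    have h3 : Real.exp (-(α / r n)) - 1 ≠ 0 := sub_ne_zero.2 hne
    have h4 : 1 - Real.exp (-(α / r n)) ≠ 0 := sub_ne_zero.2 hne.symm
    simp only [Finset.sum_const, Finset.card_range, nsmul_eq_mul]
    rw [← neg_sub (1 : ℝ) (Real.exp (-α)), ← neg_sub (1 : ℝ) (Real.exp (-(α / r n))), neg_div_neg_eq]
    field_simp
  simp_rw [e]
  refine (Tendsto.div tendsto_const_nhds ?_ hα.ne').sub_const _
  exact tendsto_mul_one_sub_exp_neg_div.comp h

/-- The distance between two natural numbers. -/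
def natDist (m k : ℕ) : ℕ := (m - k) + (k - m)

theorem sum_natDist (γ : ℕ → ℝ) {m K : ℕ} (h : m ≤ K) :
    ∑ k ∈ Finset.range K, γ (natDist m k)
      = ∑ d ∈ Finset.range m, γ (d + 1) + ∑ d ∈ Finset.range (K - m), γ d := by
  obtain ⟨j, rfl⟩ := Nat.exists_eq_add_of_le h
  rw [Finset.sum_range_add, Nat.add_sub_cancel_left]
  congr 1
  · rw [← Finset.sum_range_reflect]
    refine Finset.sum_congr rfl fun k hk => ?_
    have := Finset.mem_range.1 hk
    unfold natDist
    congr 1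
    omega
  · refine Finset.sum_congr rfl fun k _ => ?_
    unfold natDist
    congr 1
    omega

/-- Sum of a nonnegative function of finite range over the distances to a fixed point: it is at
most its value for an interior point. -/
theorem sum_natDist_bounds {γ : ℕ → ℝ} {r : ℕ} (h0 : ∀ d, 0 ≤ γ d) (h1 : ∀ d, r ≤ d → γ d = 0)
    {m K : ℕ} (h : m ≤ K) :
    ∑ k ∈ Finset.range K, γ (natDist m k) ≤ 2 * ∑ d ∈ Finset.range r, γ d - γ 0 ∧
    (r ≤ m → m + r ≤ K →
      ∑ k ∈ Finset.range K, γ (natDist m k) = 2 * ∑ d ∈ Finset.range r, γ d - γ 0) := by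
  have e1 : ∀ J, r ≤ J → ∑ d ∈ Finset.range J, γ d = ∑ d ∈ Finset.range r, γ d := fun J hJ =>
    (Finset.sum_subset (Finset.range_mono hJ) fun d _ hd => h1 d (by simpa using hd)).symm
  have e2 : ∀ J, ∑ d ∈ Finset.range J, γ d ≤ ∑ d ∈ Finset.range r, γ d := fun J => by
    rw [← e1 (max r J) (le_max_left _ _)]
    exact Finset.sum_le_sum_of_subset_of_nonneg (Finset.range_mono (le_max_right _ _))
      fun d _ _ => h0 d
  have e3 : ∀ J, ∑ d ∈ Finset.range J, γ (d + 1) = ∑ d ∈ Finset.range (J + 1), γ d - γ 0 :=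
    fun J => by rw [Finset.sum_range_succ', add_sub_cancel_right]
  rw [sum_natDist γ h, e3]
  refine ⟨by linarith [e2 (m + 1), e2 (K - m)], fun hm hK => ?_⟩
  rw [e1 (m + 1) (by omega), e1 (K - m) (by omega)]
  ring

/-- The centred indicator that the window of length `k` starting at `m` contains no ones. -/
noncomputable def win (μ : Measure (ℕ → Bool)) (k m : ℕ) (x : ℕ → Bool) : ℝ :=
  emp m (m + k) x - void μ k

@[fun_prop]
theorem cylindrical_win (μ : Measure (ℕ → Bool)) (k m : ℕ) : Cylindrical (win μ k m) :=
  (cylindrical_emp m (m + k)).sub (.const _)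

theorem dependsOn_win (μ : Measure (ℕ → Bool)) (k m : ℕ) :
    DependsOn (win μ k m) (Set.Ico m (m + k)) := fun x y h => by
  simp [win, dependsOn_emp m (m + k) h]

theorem win_shift (μ : Measure (ℕ → Bool)) (k m h : ℕ) (x : ℕ → Bool) :
    win μ k m (shift h x) = win μ k (m + h) x := by
  simp [win, emp_shift, add_right_comm]

theorem abs_win_le_one (μ : Measure (ℕ → Bool)) [IsProbabilityMeasure μ] (k m : ℕ)
    (x : ℕ → Bool) : |win μ k m x| ≤ 1 := by
  have h1 := emp_nonneg m (m + k) x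
  have h2 := emp_le_one m (m + k) x
  have h3 := void_nonneg (μ := μ) k
  have h4 := void_le_one (μ := μ) k
  rw [win, abs_le]
  constructor <;> linarith

theorem MixingLaw.integral_win {μ : Measure (ℕ → Bool)} [IsProbabilityMeasure μ] {N l : ℕ}
    {ρ : ℝ} (hμ : MixingLaw μ N l ρ) (k m : ℕ) : ∫ x, win μ k m x ∂μ = 0 := by
  unfold win
  rw [integral_sub_cyl (by fun_prop) (by fun_prop), hμ.integral_emp]
  simp

theorem MixingLaw.integral_win_mul_win {μ : Measure (ℕ → Bool)} [IsProbabilityMeasure μ]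
    {N l : ℕ} {ρ : ℝ} (hμ : MixingLaw μ N l ρ) (k m m' : ℕ) :
    ∫ x, win μ k m x * win μ k m' x ∂μ
      = ∫ x, emp m (m + k) x * emp m' (m' + k) x ∂μ - void μ k ^ 2 := by
  have e : ∀ x, win μ k m x * win μ k m' x = emp m (m + k) x * emp m' (m' + k) x
      - void μ k * emp m (m + k) x - void μ k * win μ k m' x := fun x => by
    unfold win; ring
  simp_rw [e]
  rw [integral_sub_cyl (by fun_prop) (by fun_prop), integral_sub_cyl (by fun_prop) (by fun_prop),
    integral_const_mul, integral_const_mul, hμ.integral_win, hμ.integral_emp]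
  rw [Nat.add_sub_cancel_left]
  ring

namespace BlockArray

variable {μ : ℕ → Measure (ℕ → Bool)} {r l s : ℕ → ℕ} {ρ : ℕ → ℝ} {τ α : ℝ}

/-- Overlapping windows without ones form one longer window without ones, and disjoint windows are
asymptotically independent. -/
theorem eventually_abs_integral_win_mul_win_sub_le (hA : BlockArray μ r l s ρ τ α) (C : ℕ) {ε : ℝ}
    (hε : 0 < ε) : ∀ᶠ n in atTop, ∀ m ≤ C * r n, ∀ m' ≤ C * r n,
      |∫ x, win (μ n) (r n) m x * win (μ n) (r n) m' x ∂(μ n)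
        - windowCov α ((natDist m m' : ℕ) / r n)| ≤ ε := by
  have hF2 : Tendsto (fun n => void (μ n) (r n) ^ 2) atTop (𝓝 (Real.exp (-(2 * α)))) := by
    have := hA.tendsto_void.pow 2
    rwa [← Real.exp_nat_mul, show ((2 : ℕ) : ℝ) * -α = -(2 * α) by push_cast; ring] at this
  have hF := (tendsto_iff_norm_sub_tendsto_zero.1 hF2).eventually_le_const (half_pos hε)
  filter_upwards [hA.eventually_abs_void_sub_exp_le 2 (half_pos hε), hF,
    hA.tendsto_separation_error.eventually_le_const hε, hA.eventually_mul_r_le (C + 1)]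
    with n hv hF hsep hn m hm m' hm'
  have := hA.prob n
  have hr := hA.r_pos' n
  rw [add_mul, one_mul] at hn
  rw [Real.norm_eq_abs] at hF
  wlog hmm : m ≤ m' generalizing m m'
  · have := this m' hm' m hm (le_of_not_ge hmm)
    simp_rw [mul_comm (win (μ n) (r n) m _)]
    rwa [show natDist m m' = natDist m' m by unfold natDist; omega]
  rw [(hA.law n).integral_win_mul_win, show natDist m m' = m' - m by unfold natDist; omega]
  rcases le_total m' (m + r n) with h | h
  · simp_rw [emp_mul_emp_of_overlap hmm h (show m + r n ≤ m' + r n by omega)]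
    rw [(hA.law n).integral_emp]
    have hle : m' + r n - m ≤ 2 * r n := by omega
    have h1 := hv _ hle
    have e : ((m' + r n - m : ℕ) : ℝ) / r n = 1 + ((m' - m : ℕ) : ℝ) / r n := by
      rw [show m' + r n - m = r n + (m' - m) by omega]
      push_cast
      field_simp
    have hx : ((m' - m : ℕ) : ℝ) / r n ≤ 1 := by
      rw [div_le_one hr]
      exact_mod_cast (show m' - m ≤ r n by omega)
    rw [e] at h1
    rw [windowCov, min_eq_left hx]
    rw [abs_le] at *
    constructor <;> linarith [h1.1, h1.2, hF.1, hF.2]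
  · rw [windowCov_of_one_le α, sub_zero]
    · have h1 := (hA.law n).abs_integral_emp_mul_emp_sub_le (a := m) (b := m + r n) (c := m')
        (d := m' + r n) h (by omega)
      rw [Nat.add_sub_cancel_left, Nat.add_sub_cancel_left, ← sq] at h1
      exact h1.trans hsep
    · rw [one_le_div hr]
      exact_mod_cast (show r n ≤ m' - m by omega)

theorem sum_windowCov_bounds (hA : BlockArray μ r l s ρ τ α) (n q : ℕ) {m : ℕ} (hm : m ≤ q * r n) :
    0 ≤ ∑ m' ∈ Finset.range (q * r n), windowCov α ((natDist m m' : ℕ) / r n) ∧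
    ∑ m' ∈ Finset.range (q * r n), windowCov α ((natDist m m' : ℕ) / r n)
      ≤ 2 * ∑ d ∈ Finset.range (r n), windowCov α (d / r n) - windowCov α 0 ∧
    (r n ≤ m → m + r n ≤ q * r n →
      ∑ m' ∈ Finset.range (q * r n), windowCov α ((natDist m m' : ℕ) / r n)
        = 2 * ∑ d ∈ Finset.range (r n), windowCov α (d / r n) - windowCov α 0) := by
  have h := sum_natDist_bounds (γ := fun d => windowCov α (d / r n)) (r := r n)
    (fun d => windowCov_nonneg hA.alpha_pos _)
    (fun d hd => windowCov_of_one_le α (by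
      rw [one_le_div (hA.r_pos' n)]
      exact_mod_cast hd)) hm
  simp only [Nat.cast_zero, zero_div] at h
  exact ⟨Finset.sum_nonneg fun _ _ => windowCov_nonneg hA.alpha_pos _, h.1, h.2⟩

/-- The sum over `q` blocks of the centred indicators of a block without ones. -/
noncomputable def disjointSum (μ : Measure (ℕ → Bool)) (k q : ℕ) (x : ℕ → Bool) : ℝ :=
  ∑ i ∈ Finset.range q, win μ k (i * k) x

/-- The sum over the windows that start in the first `q` blocks of the centred indicators of a
window without ones, divided by the block length. -/
noncomputable def slidingSum (μ : Measure (ℕ → Bool)) (k q : ℕ) (x : ℕ → Bool) : ℝ :=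
  (∑ m ∈ Finset.range (q * k), win μ k m x) / k

@[fun_prop]
theorem cylindrical_disjointSum (μ : Measure (ℕ → Bool)) (k q : ℕ) :
    Cylindrical (disjointSum μ k q) :=
  Cylindrical.sum _ fun i => cylindrical_win μ k (i * k)

@[fun_prop]
theorem cylindrical_slidingSum (μ : Measure (ℕ → Bool)) (k q : ℕ) :
    Cylindrical (slidingSum μ k q) :=
  (Cylindrical.sum _ fun i => cylindrical_win μ k i).div (.const _)

/-- The limit of the normalized sum of the covariances of a window with all windows near it. -/
theorem tendsto_sum_windowCov_both_sides (hA : BlockArray μ r l s ρ τ α) :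
    Tendsto (fun n => (2 * ∑ d ∈ Finset.range (r n), windowCov α (d / r n) - windowCov α 0) / r n)
      atTop (𝓝 (2 * windowCovIntegral α)) := by
  have h1 := (tendsto_sum_windowCov hA.alpha_pos hA.r_pos hA.tendsto_r).const_mul 2
  have h2 := (tendsto_const_nhds (x := windowCov α 0)).div_atTop hA.tendsto_r
  have h3 := h1.sub h2
  rw [sub_zero] at h3
  refine h3.congr fun n => ?_
  ring

theorem eventually_abs_integral_disjointSum_sq_sub_le (hA : BlockArray μ r l s ρ τ α) (q : ℕ)
    {ε : ℝ} (hε : 0 < ε) : ∀ᶠ n in atTop,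
      |∫ x, disjointSum (μ n) (r n) q x ^ 2 ∂(μ n) - q * windowCov α 0| ≤ ε := by
  filter_upwards [hA.eventually_abs_integral_win_mul_win_sub_le q
    (show 0 < ε / ((q : ℝ) ^ 2 + 1) by positivity)] with n hn
  have := hA.prob n
  have hr := hA.r_pos' n
  have hle : ∀ i ∈ Finset.range q, i * r n ≤ q * r n := fun i hi =>
    Nat.mul_le_mul_right _ (Finset.mem_range.1 hi).le
  simp_rw [sq (disjointSum _ _ _ _), disjointSum, Finset.sum_mul_sum]
  rw [integral_sum_cyl _ fun i => by fun_prop]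
  have e : (q : ℝ) * windowCov α 0 = ∑ i ∈ Finset.range q, ∑ j ∈ Finset.range q,
      windowCov α ((natDist (i * r n) (j * r n) : ℕ) / r n) := by
    have : ∀ i ∈ Finset.range q, ∑ j ∈ Finset.range q,
        windowCov α ((natDist (i * r n) (j * r n) : ℕ) / r n) = windowCov α 0 := fun i hi => by
      rw [Finset.sum_eq_single_of_mem i hi]
      · simp [natDist]
      · intro j _ hji
        refine windowCov_of_one_le α ?_
        rw [one_le_div hr]
        have : r n ≤ natDist (i * r n) (j * r n) := by
          unfold natDist
          rw [← Nat.sub_mul, ← Nat.sub_mul, ← add_mul]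
          exact Nat.le_mul_of_pos_left _ (by omega)
        exact_mod_cast this
    rw [Finset.sum_congr rfl this]
    simp
  rw [e, ← Finset.sum_sub_distrib]
  calc _ ≤ ∑ i ∈ Finset.range q, ∑ j ∈ Finset.range q, ε / ((q : ℝ) ^ 2 + 1) := by
        refine (Finset.abs_sum_le_sum_abs _ _).trans (Finset.sum_le_sum fun i hi => ?_)
        rw [integral_sum_cyl _ fun i => by fun_prop, ← Finset.sum_sub_distrib]
        exact (Finset.abs_sum_le_sum_abs _ _).trans
          (Finset.sum_le_sum fun j hj => hn _ (hle i hi) _ (hle j hj))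
    _ = (q : ℝ) ^ 2 * (ε / ((q : ℝ) ^ 2 + 1)) := by simp [sq, mul_assoc]
    _ ≤ ε := by
        rw [mul_div_assoc', div_le_iff₀ (by positivity)]
        nlinarith

/-- The covariance of a single window with the sliding sum, up to an error that vanishes. -/
theorem eventually_abs_integral_win_mul_slidingSum_sub_le (hA : BlockArray μ r l s ρ τ α) (q : ℕ)
    {ε : ℝ} (hε : 0 < ε) : ∀ᶠ n in atTop, ∀ m ≤ q * r n,
      |∫ x, win (μ n) (r n) m x * slidingSum (μ n) (r n) q x ∂(μ n)
        - (∑ m' ∈ Finset.range (q * r n), windowCov α ((natDist m m' : ℕ) / r n)) / r n| ≤ ε := by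
  filter_upwards [hA.eventually_abs_integral_win_mul_win_sub_le q
    (show 0 < ε / ((q : ℝ) + 1) by positivity)] with n hn m hm
  have := hA.prob n
  have hr := hA.r_pos' n
  simp_rw [slidingSum, mul_div_assoc', Finset.mul_sum]
  rw [integral_div, integral_sum_cyl _ fun i => by fun_prop, ← sub_div, ← Finset.sum_sub_distrib,
    abs_div, abs_of_pos hr, div_le_iff₀ hr]
  calc _ ≤ ∑ m' ∈ Finset.range (q * r n), ε / ((q : ℝ) + 1) :=
        (Finset.abs_sum_le_sum_abs _ _).trans
          (Finset.sum_le_sum fun j hj => hn _ hm _ (Finset.mem_range.1 hj).le)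
    _ = q * r n * (ε / ((q : ℝ) + 1)) := by simp
    _ ≤ ε * r n := by
        rw [mul_div_assoc', div_le_iff₀ (by positivity)]
        nlinarith [mul_pos hε hr]

theorem windowCov_both_sides_le (hA : BlockArray μ r l s ρ τ α) (n : ℕ) :
    (2 * ∑ d ∈ Finset.range (r n), windowCov α (d / r n) - windowCov α 0) / r n ≤ 2 := by
  have hr := hA.r_pos' n
  rw [div_le_iff₀ hr]
  have h1 : ∑ d ∈ Finset.range (r n), windowCov α (d / r n) ≤ ∑ d ∈ Finset.range (r n), 1 :=
    Finset.sum_le_sum fun d _ => windowCov_le_one hA.alpha_pos (by positivity)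
  simp only [Finset.sum_const, Finset.card_range, nsmul_eq_mul, mul_one] at h1
  linarith [windowCov_nonneg hA.alpha_pos 0]

/-- Windows that start in the first or in the last block meet fewer windows than those in the
interior; as there are few of them, this changes the covariance by a bounded amount only. -/
theorem eventually_abs_integral_disjointSum_mul_slidingSum_sub_le
    (hA : BlockArray μ r l s ρ τ α) (q : ℕ) : ∀ᶠ n in atTop,
      |∫ x, disjointSum (μ n) (r n) q x * slidingSum (μ n) (r n) q x ∂(μ n)
        - q * (2 * windowCovIntegral α)| ≤ 6 := by
  have hlim := (tendsto_iff_norm_sub_tendsto_zero.1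
    (hA.tendsto_sum_windowCov_both_sides)).eventually_le_const
      (show (0 : ℝ) < 1 / (q + 1) by positivity)
  filter_upwards [hlim, hA.eventually_abs_integral_win_mul_slidingSum_sub_le q
    (show (0 : ℝ) < 1 / (q + 1) by positivity)] with n hh hn
  have := hA.prob n
  have hr := hA.r_pos' n
  rw [Real.norm_eq_abs] at hh
  have hH2 := hA.windowCov_both_sides_le n
  set H := (2 * ∑ d ∈ Finset.range (r n), windowCov α (d / r n) - windowCov α 0) / r n with hH
  have hle : ∀ i ∈ Finset.range q, i * r n ≤ q * r n := fun i hi =>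
    Nat.mul_le_mul_right _ (Finset.mem_range.1 hi).le
  have hterm : ∀ i ∈ Finset.range q,
      |∫ x, win (μ n) (r n) (i * r n) x * slidingSum (μ n) (r n) q x ∂(μ n)
        - 2 * windowCovIntegral α| ≤ 1 / (q + 1) + 1 / (q + 1)
          + if i = 0 then 2 else 0 := by
    intro i hi
    have h1 := hn _ (hle i hi)
    obtain ⟨h2, h3, h4⟩ := hA.sum_windowCov_bounds n q (hle i hi)
    have h2' := div_nonneg h2 hr.le
    have h3' := div_le_div_of_nonneg_right h3 hr.le
    rw [← hH] at h3'
    set D := (∑ m' ∈ Finset.range (q * r n),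
      windowCov α ((natDist (i * r n) m' : ℕ) / r n)) / r n with hD
    split_ifs with hi0
    · rw [abs_le] at *
      constructor <;> linarith [h1.1, h1.2, hh.1, hh.2]
    · have h5 : D = H := by
        rw [hD, hH, h4 (Nat.le_mul_of_pos_left _ (Nat.pos_of_ne_zero hi0))]
        rw [← Nat.succ_mul]
        exact Nat.mul_le_mul_right _ (Finset.mem_range.1 hi)
      rw [abs_le] at *
      constructor <;> linarith [h1.1, h1.2, hh.1, hh.2]
  have e : ∀ x, disjointSum (μ n) (r n) q x * slidingSum (μ n) (r n) q x
      = ∑ i ∈ Finset.range q, win (μ n) (r n) (i * r n) x * slidingSum (μ n) (r n) q x :=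
    fun x => by rw [disjointSum, Finset.sum_mul]
  simp_rw [e]
  rw [integral_sum_cyl _ fun i => by fun_prop]
  have e2 : (q : ℝ) * (2 * windowCovIntegral α)
      = ∑ i ∈ Finset.range q, 2 * windowCovIntegral α := by simp
  rw [e2, ← Finset.sum_sub_distrib]
  refine (Finset.abs_sum_le_sum_abs _ _).trans ((Finset.sum_le_sum hterm).trans ?_)
  rw [Finset.sum_add_distrib, Finset.sum_const, Finset.card_range, nsmul_eq_mul]
  have h6 : ∑ i ∈ Finset.range q, (if i = 0 then (2 : ℝ) else 0) ≤ 2 := by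
    rw [Finset.sum_ite_eq']
    split_ifs <;> norm_num
  have h7 : (q : ℝ) * (1 / (q + 1) + 1 / (q + 1)) ≤ 2 := by
    rw [← add_div, mul_div_assoc', div_le_iff₀ (by positivity)]
    linarith
  linarith

/-- As for the covariance with `disjointSum`, the windows that start in the first or in the last
block contribute a bounded error. -/
theorem eventually_abs_integral_slidingSum_sq_sub_le
    (hA : BlockArray μ r l s ρ τ α) (q : ℕ) : ∀ᶠ n in atTop,
      |∫ x, slidingSum (μ n) (r n) q x ^ 2 ∂(μ n) - q * (2 * windowCovIntegral α)| ≤ 6 := by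
  have hlim := (tendsto_iff_norm_sub_tendsto_zero.1
    (hA.tendsto_sum_windowCov_both_sides)).eventually_le_const
      (show (0 : ℝ) < 1 / (q + 1) by positivity)
  filter_upwards [hlim, hA.eventually_abs_integral_win_mul_slidingSum_sub_le q
    (show (0 : ℝ) < 1 / (q + 1) by positivity)] with n hh hn
  have := hA.prob n
  have hr := hA.r_pos' n
  rw [Real.norm_eq_abs] at hh
  have hH2 := hA.windowCov_both_sides_le n
  set H := (2 * ∑ d ∈ Finset.range (r n), windowCov α (d / r n) - windowCov α 0) / r n with hH
  have hterm : ∀ m ∈ Finset.range (q * r n),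
      |∫ x, win (μ n) (r n) m x * slidingSum (μ n) (r n) q x ∂(μ n)
        - 2 * windowCovIntegral α| ≤ 1 / (q + 1) + 1 / (q + 1)
          + ((if m ∈ Finset.range (r n) then 2 else 0)
            + if m ∈ Finset.Ico (q * r n - r n) (q * r n) then 2 else 0) := by
    intro m hm
    have hm' := Finset.mem_range.1 hm
    have h1 := hn _ hm'.le
    obtain ⟨h2, h3, h4⟩ := hA.sum_windowCov_bounds n q hm'.le
    have h2' := div_nonneg h2 hr.le
    have h3' := div_le_div_of_nonneg_right h3 hr.le
    rw [← hH] at h3'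
    set D := (∑ m' ∈ Finset.range (q * r n),
      windowCov α ((natDist m m' : ℕ) / r n)) / r n with hD
    split_ifs with hm1 hm2 hm2
    · rw [abs_le] at *
      constructor <;> linarith [h1.1, h1.2, hh.1, hh.2]
    · rw [abs_le] at *
      constructor <;> linarith [h1.1, h1.2, hh.1, hh.2]
    · rw [abs_le] at *
      constructor <;> linarith [h1.1, h1.2, hh.1, hh.2]
    · rw [Finset.mem_range] at hm1
      rw [Finset.mem_Ico] at hm2
      have h5 : D = H := by
        rw [hD, hH, h4 (by omega) (by omega)]
      rw [abs_le] at *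
      constructor <;> linarith [h1.1, h1.2, hh.1, hh.2]
  have e : ∀ x, slidingSum (μ n) (r n) q x ^ 2
      = (∑ m ∈ Finset.range (q * r n), win (μ n) (r n) m x * slidingSum (μ n) (r n) q x) / r n :=
    fun x => by rw [← Finset.sum_mul, sq, slidingSum]; ring
  simp_rw [e]
  rw [integral_div, integral_sum_cyl _ fun i => by fun_prop]
  have e2 : (q : ℝ) * (2 * windowCovIntegral α)
      = (∑ m ∈ Finset.range (q * r n), 2 * windowCovIntegral α) / r n := by
    rw [Finset.sum_const, Finset.card_range, nsmul_eq_mul]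
    push_cast
    field_simp
  rw [e2, ← sub_div, ← Finset.sum_sub_distrib, abs_div, abs_of_pos hr, div_le_iff₀ hr]
  refine (Finset.abs_sum_le_sum_abs _ _).trans ((Finset.sum_le_sum hterm).trans ?_)
  rw [Finset.sum_add_distrib, Finset.sum_const, Finset.card_range, nsmul_eq_mul,
    Finset.sum_add_distrib, ← Finset.sum_filter, ← Finset.sum_filter]
  have h6 : ∑ i ∈ Finset.range (q * r n) with i ∈ Finset.range (r n), (2 : ℝ) ≤ 2 * r n := by
    have : (Finset.filter (· ∈ Finset.range (r n)) (Finset.range (q * r n))).card ≤ r n := by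
      refine (Finset.card_le_card (t := Finset.range (r n)) fun i hi => ?_).trans (by simp)
      exact (Finset.mem_filter.1 hi).2
    rw [Finset.sum_const, nsmul_eq_mul, mul_comm]
    have : ((Finset.filter (· ∈ Finset.range (r n)) (Finset.range (q * r n))).card : ℝ) ≤ r n := by
      exact_mod_cast this
    linarith
  have h6' : ∑ i ∈ Finset.range (q * r n) with i ∈ Finset.Ico (q * r n - r n) (q * r n), (2 : ℝ)
      ≤ 2 * r n := by
    have : (Finset.filter (· ∈ Finset.Ico (q * r n - r n) (q * r n))
        (Finset.range (q * r n))).card ≤ r n := by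
      refine (Finset.card_le_card (t := Finset.Ico (q * r n - r n) (q * r n))
        fun i hi => ?_).trans (by simp; omega)
      exact (Finset.mem_filter.1 hi).2
    rw [Finset.sum_const, nsmul_eq_mul, mul_comm]
    have : ((Finset.filter (· ∈ Finset.Ico (q * r n - r n) (q * r n))
        (Finset.range (q * r n))).card : ℝ) ≤ r n := by
      exact_mod_cast this
    linarith
  have h7 : ((q * r n : ℕ) : ℝ) * (1 / (q + 1) + 1 / (q + 1)) ≤ 2 * r n := by
    push_cast
    rw [← add_div, mul_div_assoc', div_le_iff₀ (by positivity)]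
    nlinarith
  linarith

end BlockArray

/-! ### Block arrays with bounded moments -/

/-- The centred number of ones at the places `a ≤ i < b`, for `a ≤ b`. -/
noncomputable def dev (μ : Measure (ℕ → Bool)) (a b : ℕ) (x : ℕ → Bool) : ℝ :=
  cnt a b x - (b - a : ℕ) * rate μ

@[fun_prop]
theorem cylindrical_dev (μ : Measure (ℕ → Bool)) (a b : ℕ) : Cylindrical (dev μ a b) :=
  (cylindrical_cnt a b).sub (.const _)

theorem dependsOn_dev (μ : Measure (ℕ → Bool)) (a b : ℕ) :
    DependsOn (dev μ a b) (Set.Ico a b) := fun x y h => by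
  simp [dev, dependsOn_cnt a b h]

theorem dev_shift (μ : Measure (ℕ → Bool)) (a b h : ℕ) (x : ℕ → Bool) :
    dev μ a b (shift h x) = dev μ (a + h) (b + h) x := by
  simp [dev, cnt_shift, Nat.add_sub_add_right]

theorem dev_add_dev (μ : Measure (ℕ → Bool)) {a b c : ℕ} (hab : a ≤ b) (hbc : b ≤ c)
    (x : ℕ → Bool) : dev μ a b x + dev μ b c x = dev μ a c x := by
  unfold dev
  rw [← cnt_add_cnt hab hbc, ← Nat.sub_add_sub_cancel hbc hab]
  push_cast
  ring

theorem MixingLaw.integral_cnt' {μ : Measure (ℕ → Bool)} [IsProbabilityMeasure μ] {N l : ℕ}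
    {ρ : ℝ} (hμ : MixingLaw μ N l ρ) (a b : ℕ) :
    ∫ x, cnt a b x ∂μ = (b - a : ℕ) * rate μ := by
  rcases le_total a b with h | h
  · conv_lhs => rw [← Nat.add_sub_cancel' h]
    exact hμ.integral_cnt a (b - a)
  · simp [cnt, h, Nat.sub_eq_zero_of_le h]

theorem MixingLaw.integral_dev {μ : Measure (ℕ → Bool)} [IsProbabilityMeasure μ] {N l : ℕ}
    {ρ : ℝ} (hμ : MixingLaw μ N l ρ) (a b : ℕ) : ∫ x, dev μ a b x ∂μ = 0 := by
  unfold dev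
  rw [integral_sub_cyl (by fun_prop) (by fun_prop), hμ.integral_cnt']
  simp

theorem integral_sub_integral_sq {μ : Measure (ℕ → Bool)} [IsProbabilityMeasure μ]
    {f : (ℕ → Bool) → ℝ} (hf : Cylindrical f) {c : ℝ} (hc : ∫ x, f x ∂μ = c) :
    ∫ x, (f x - c) ^ 2 ∂μ = ∫ x, f x ^ 2 ∂μ - c ^ 2 := by
  have e : ∀ x, (f x - c) ^ 2 = f x ^ 2 - 2 * c * f x + c ^ 2 := fun x => by ring
  simp_rw [e]
  rw [integral_add_cyl (by fun_prop) (by fun_prop), integral_sub_cyl (by fun_prop) (by fun_prop),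
    integral_const_mul, hc]
  simp
  ring

theorem MixingLaw.integral_dev_sq {μ : Measure (ℕ → Bool)} [IsProbabilityMeasure μ] {N l : ℕ}
    {ρ : ℝ} (hμ : MixingLaw μ N l ρ) (a b : ℕ) :
    ∫ x, dev μ a b x ^ 2 ∂μ = ∫ x, cnt a b x ^ 2 ∂μ - ((b - a : ℕ) * rate μ) ^ 2 :=
  integral_sub_integral_sq (by fun_prop) (hμ.integral_cnt' a b)

/-- Nonnegative functions with bounded moments of an order above two tend to zero in `L²` if they
do so in `L¹`. -/
theorem tendsto_integral_sq_zero {μ : ℕ → Measure (ℕ → Bool)}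
    (hμ : ∀ n, IsProbabilityMeasure (μ n)) {f : ℕ → (ℕ → Bool) → ℝ} (hf : ∀ n, Cylindrical (f n))
    (h0 : ∀ n x, 0 ≤ f n x) {p M : ℝ} (hp : 1 < p)
    (hM : ∀ᶠ n in atTop, ∫ x, f n x ^ (2 * p) ∂(μ n) ≤ M)
    (hlim : Tendsto (fun n => ∫ x, f n x ∂(μ n)) atTop (𝓝 0)) :
    Tendsto (fun n => ∫ x, f n x ^ 2 ∂(μ n)) atTop (𝓝 0) := by
  -- truncation at a level `K`
  have key : ∀ K : ℝ, 0 < K → ∀ n, ∫ x, f n x ^ 2 ∂(μ n)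
      ≤ K * ∫ x, f n x ∂(μ n) + K ^ (2 - 2 * p) * ∫ x, f n x ^ (2 * p) ∂(μ n) := by
    intro K hK n
    have := hμ n
    have := hf n
    rw [← integral_const_mul, ← integral_const_mul, ← integral_add_cyl (by fun_prop) (by fun_prop)]
    refine integral_mono_cyl (by fun_prop) (by fun_prop) fun x => ?_
    have hx := h0 n x
    have hr1 : 0 ≤ K ^ (2 - 2 * p) * f n x ^ (2 * p) := by positivity
    rcases le_or_gt (f n x) K with h | h
    · nlinarith
    · have hfx : 0 < f n x := hK.trans h
      have e : f n x ^ 2 = f n x ^ (2 - 2 * p) * f n x ^ (2 * p) := by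
        rw [← Real.rpow_add hfx, ← Real.rpow_natCast]
        norm_num
      have h2 : f n x ^ (2 - 2 * p) ≤ K ^ (2 - 2 * p) :=
        Real.rpow_le_rpow_of_nonpos hK h.le (by linarith)
      have h3 := mul_le_mul_of_nonneg_right h2 (Real.rpow_nonneg hx (2 * p))
      rw [e]
      have : 0 ≤ K * f n x := by positivity
      linarith
  rw [Metric.tendsto_nhds]
  intro ε hε
  have hKlim : Tendsto (fun K : ℝ => K ^ (2 - 2 * p) * |M|) atTop (𝓝 0) := by
    have := (tendsto_rpow_neg_atTop (show 0 < 2 * p - 2 by linarith)).mul_const |M|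
    rw [zero_mul] at this
    refine this.congr fun K => ?_
    rw [neg_sub]
  obtain ⟨K, hK1, hK0⟩ := ((hKlim.eventually_lt_const (half_pos hε)).and
    (eventually_gt_atTop 0)).exists
  have hl : Tendsto (fun n => K * ∫ x, f n x ∂(μ n)) atTop (𝓝 0) := by
    simpa using hlim.const_mul K
  filter_upwards [hM, hl.eventually_lt_const (half_pos hε)] with n hn hn'
  have h1 := key K hK0 n
  have h2 : K ^ (2 - 2 * p) * ∫ x, f n x ^ (2 * p) ∂(μ n) ≤ K ^ (2 - 2 * p) * |M| :=
    mul_le_mul_of_nonneg_left (hn.trans (le_abs_self M)) (by positivity)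
  rw [dist_zero_right, Real.norm_eq_abs, abs_of_nonneg (integral_nonneg fun x => sq_nonneg _)]
  linarith

/-- Replacing a factor by one that is close in `L²` changes a covariance by little. -/
theorem abs_cov_le_add {μ : Measure (ℕ → Bool)} [IsProbabilityMeasure μ]
    {f g g' : (ℕ → Bool) → ℝ} (hf : Cylindrical f) (hg : Cylindrical g) (hg' : Cylindrical g') :
    |∫ x, f x * g x ∂μ - (∫ x, f x ∂μ) * ∫ x, g x ∂μ|
      ≤ |∫ x, f x * g' x ∂μ - (∫ x, f x ∂μ) * ∫ x, g' x ∂μ|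
        + 2 * (√(∫ x, f x ^ 2 ∂μ) * √(∫ x, (g' x - g x) ^ 2 ∂μ)) := by
  have h1 := integral_mul_le_sqrt (μ := μ) hf (hg'.sub hg)
  have h2 := mul_le_mul (abs_integral_le_sqrt (μ := μ) hf) (abs_integral_le_sqrt (μ := μ)
    (hg'.sub hg)) (abs_nonneg _) (Real.sqrt_nonneg _)
  rw [← abs_mul] at h2
  simp_rw [mul_sub] at h1
  rw [integral_sub_cyl (by fun_prop) (by fun_prop)] at h1
  rw [integral_sub_cyl (by fun_prop) (by fun_prop), mul_sub] at h2
  rw [abs_le] at h1 h2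
  have h3 := neg_abs_le (∫ x, f x * g' x ∂μ - (∫ x, f x ∂μ) * ∫ x, g' x ∂μ)
  have h4 := le_abs_self (∫ x, f x * g' x ∂μ - (∫ x, f x ∂μ) * ∫ x, g' x ∂μ)
  rw [abs_le]
  constructor <;> linarith [h1.1, h1.2, h2.1, h2.2]

/-- A block array in which the number of ones in a block of length `r` has bounded moments of an
order `2 p > 2`, and in which its second moment over a block of length `s` is about `κ s / r`. The order is at most
three, so that it measures the error of the second-order Taylor expansion of a characteristic
function. -/
structure ClusterArray (μ : ℕ → Measure (ℕ → Bool)) (r l s : ℕ → ℕ) (ρ : ℕ → ℝ)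
    (τ α κ p M : ℝ) : Prop extends BlockArray μ r l s ρ τ α where
  one_lt_p : 1 < p
  p_le : 2 * p ≤ 3
  moment : ∀ᶠ n in atTop, ∫ x, cnt 0 (r n) x ^ (2 * p) ∂(μ n) ≤ M
  tendsto_sq : Tendsto (fun n => (r n : ℝ) / s n * ∫ x, cnt 0 (s n) x ^ 2 ∂(μ n)) atTop (𝓝 κ)

theorem cnt_mul_eq_sum (k q : ℕ) (x : ℕ → Bool) :
    cnt 0 (q * k) x = ∑ i ∈ Finset.range q, cnt (i * k) (i * k + k) x := by
  induction q with
  | zero => simp [cnt]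
  | succ q ih =>
    rw [Finset.sum_range_succ, ← ih, Nat.succ_mul, cnt_add_cnt (Nat.zero_le _)
      (Nat.le_add_right _ _)]

namespace ClusterArray

variable {μ : ℕ → Measure (ℕ → Bool)} {r l s : ℕ → ℕ} {ρ : ℕ → ℝ} {τ α κ p M : ℝ}

/-- By convexity, the moment bound extends from one block to `C` consecutive blocks. -/
theorem eventually_integral_cnt_rpow_le (hA : ClusterArray μ r l s ρ τ α κ p M) (C : ℕ) :
    ∀ᶠ n in atTop, ∫ x, cnt 0 (C * r n) x ^ (2 * p) ∂(μ n) ≤ (C : ℝ) ^ (2 * p - 1) * (C * M) := by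
  filter_upwards [hA.moment] with n hn
  have := hA.prob n
  have hp := hA.one_lt_p
  have h1 : ∀ x, cnt 0 (C * r n) x ^ (2 * p) ≤ (C : ℝ) ^ (2 * p - 1)
      * ∑ i ∈ Finset.range C, cnt (i * r n) (i * r n + r n) x ^ (2 * p) := fun x => by
    rw [cnt_mul_eq_sum]
    have := Real.rpow_sum_le_const_mul_sum_rpow (Finset.range C)
      (fun i => cnt (i * r n) (i * r n + r n) x) (show 1 ≤ 2 * p by linarith)
    simpa [abs_of_nonneg (cnt_nonneg _ _ x)] using this
  refine (integral_mono_cyl (by fun_prop) (by fun_prop) h1).trans ?_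
  rw [integral_const_mul, integral_sum_cyl _ fun i => by fun_prop]
  refine mul_le_mul_of_nonneg_left ?_ (by positivity)
  calc _ ≤ ∑ i ∈ Finset.range C, M := Finset.sum_le_sum fun i _ => by
        have := (hA.law n).integral_shift (f := fun x => cnt 0 (r n) x ^ (2 * p))
          (by fun_prop) (i * r n)
        simp_rw [cnt_shift, Nat.zero_add, Nat.add_comm (r n)] at this
        rw [this]
        exact hn
    _ = C * M := by simp

theorem eventually_integral_cnt_sq_le (hA : ClusterArray μ r l s ρ τ α κ p M) (C : ℕ) :
    ∀ᶠ n in atTop, ∀ a b, a ≤ b → b ≤ C * r n →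
      ∫ x, cnt a b x ^ 2 ∂(μ n) ≤ 1 + (C : ℝ) ^ (2 * p - 1) * (C * M) := by
  filter_upwards [hA.eventually_integral_cnt_rpow_le C] with n hn a b _ hb
  have := hA.prob n
  have hp := hA.one_lt_p
  refine le_trans ?_ (add_le_add_right hn 1)
  have : ∫ x, cnt 0 (C * r n) x ^ (2 * p) ∂(μ n) + 1
      = ∫ x, (cnt 0 (C * r n) x ^ (2 * p) + 1) ∂(μ n) := by
    rw [integral_add_cyl (by fun_prop) (by fun_prop)]
    simp
  rw [add_comm, this]
  refine integral_mono_cyl (by fun_prop) (by fun_prop) fun x => ?_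
  have h1 := cnt_nonneg a b x
  have h2 := cnt_mono (Nat.zero_le a) hb x
  have h3 : 0 ≤ cnt 0 (C * r n) x := h1.trans h2
  have h4 : cnt a b x ^ 2 ≤ cnt 0 (C * r n) x ^ 2 := by gcongr
  have h5 : 0 ≤ cnt 0 (C * r n) x ^ (2 * p) := by positivity
  rcases le_total (cnt 0 (C * r n) x) 1 with h | h
  · nlinarith
  · have : cnt 0 (C * r n) x ^ (2 : ℝ) ≤ cnt 0 (C * r n) x ^ (2 * p) :=
      Real.rpow_le_rpow_of_exponent_le h (by linarith)
    rw [Real.rpow_two] at this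
    linarith

end ClusterArray

/-! ### Covariances with the number of ones -/

theorem emp_sub_emp_bounds {a b c d : ℕ} (hca : c ≤ a) (hab : a ≤ b) (hbd : b ≤ d)
    (x : ℕ → Bool) : 0 ≤ emp a b x - emp c d x ∧
      emp a b x - emp c d x ≤ (1 - emp c a x) + (1 - emp b d x) := by
  have h := emp_anti hca hbd x
  rw [← emp_mul_emp (hca.trans hab) hbd, ← emp_mul_emp hca hab] at *
  refine ⟨by linarith, ?_⟩
  have h1 := emp_nonneg c a x
  have h2 := emp_le_one c a x
  have h3 := emp_nonneg a b x
  have h4 := emp_le_one a b x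
  have h5 := emp_nonneg b d x
  have h6 := emp_le_one b d x
  have h7 : emp a b x * (1 - emp c a x * emp b d x) ≤ 1 * (1 - emp c a x * emp b d x) :=
    mul_le_mul_of_nonneg_right h4 (by nlinarith)
  nlinarith [mul_nonneg (sub_nonneg.2 h2) (sub_nonneg.2 h6)]

/-- Trimming a window by a few places changes the indicator that it contains no ones by little. -/
theorem MixingLaw.integral_emp_sub_emp_sq_le {μ : Measure (ℕ → Bool)} [IsProbabilityMeasure μ]
    {N l : ℕ} {ρ : ℝ} (hμ : MixingLaw μ N l ρ) {a b c d : ℕ} (hca : c ≤ a) (hab : a ≤ b)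
    (hbd : b ≤ d) :
    ∫ x, (emp a b x - emp c d x) ^ 2 ∂μ ≤ ((a - c : ℕ) + (d - b : ℕ)) * rate μ := by
  have h1 := hμ.integral_one_sub_emp_le c (a - c)
  have h2 := hμ.integral_one_sub_emp_le b (d - b)
  rw [Nat.add_sub_cancel' hca] at h1
  rw [Nat.add_sub_cancel' hbd] at h2
  refine (integral_mono_cyl (g := fun x => (1 - emp c a x) + (1 - emp b d x)) (by fun_prop)
    (by fun_prop) fun x => ?_).trans ?_
  · obtain ⟨h3, h4⟩ := emp_sub_emp_bounds hca hab hbd x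
    have h5 : emp a b x - emp c d x ≤ 1 := by
      linarith [emp_le_one a b x, emp_nonneg c d x]
    nlinarith
  · rw [integral_add_cyl (by fun_prop) (by fun_prop)]
    linarith

namespace ClusterArray

variable {μ : ℕ → Measure (ℕ → Bool)} {r l s : ℕ → ℕ} {ρ : ℕ → ℝ} {τ α κ p M : ℝ}

/-- The indicator of a window without ones is asymptotically uncorrelated with the number of ones in
any set of places outside the window. -/
theorem eventually_abs_cov_cnt_emp_le (hA : ClusterArray μ r l s ρ τ α κ p M) (C : ℕ) {ε : ℝ}
    (hε : 0 < ε) : ∀ᶠ n in atTop, ∀ a b m, a ≤ b → b ≤ C * r n → m + r n ≤ C * r n →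
      (b ≤ m ∨ m + r n ≤ a) →
      |∫ x, cnt a b x * emp m (m + r n) x ∂(μ n)
        - (b - a : ℕ) * rate (μ n) * void (μ n) (r n)| ≤ ε := by
  set K := 1 + (C : ℝ) ^ (2 * p - 1) * (C * M)
  have hlim : Tendsto (fun n => ρ n * (√K * √1) + 2 * (√K * √(l n * rate (μ n)))) atTop
      (𝓝 0) := by
    have h1 := hA.tendsto_rho.mul_const (√K * √1)
    have h2 := (((Real.continuous_sqrt.tendsto _).comp hA.tendsto_l_mul_rate).const_mul
      (√K)).const_mul 2
    simpa using h1.add h2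
  filter_upwards [hlim.eventually_le_const hε, hA.eventually_integral_cnt_sq_le C,
    hA.eventually_mul_r_le C, hA.eventually_l_le_r] with n hn hK hC hl a b m hab hb hm hdisj
  have := hA.prob n
  have hμ := hA.law n
  have hcnt := hK a b hab hb
  have hEe : ∫ x, emp m (m + r n) x ∂(μ n) = void (μ n) (r n) := by
    rw [hμ.integral_emp, Nat.add_sub_cancel_left]
  rw [← hμ.integral_cnt' a b, ← hEe]
  refine le_trans ?_ hn
  have emp_sq : ∀ c d, ∫ x, emp c d x ^ 2 ∂(μ n) ≤ 1 := fun c d =>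
    integral_le_const (by fun_prop) fun x => by nlinarith [emp_nonneg c d x, emp_le_one c d x]
  rcases hdisj with h | h
  · refine (abs_cov_le_add (g' := emp (m + l n) (m + r n)) (by fun_prop) (by fun_prop)
      (by fun_prop)).trans ?_
    have h1 := hμ.abs_cov_le_of_sq_le (t := b) (c := m + l n) (f := cnt a b)
      (g := emp (m + l n) (m + r n)) (fun x y h => dependsOn_cnt a b fun i hi => h i hi.2)
      (fun x y h => dependsOn_emp _ _ fun i hi => h i ⟨hi.1, hi.2.trans_le (by omega)⟩)
      (by omega) hcnt (emp_sq _ _)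
    have h2 := hμ.integral_emp_sub_emp_sq_le (a := m + l n) (b := m + r n) (c := m) (d := m + r n)
      (by omega) (by omega) le_rfl
    simp only [Nat.add_sub_cancel_left, Nat.sub_self, Nat.cast_zero, add_zero] at h2
    gcongr
  · refine (abs_cov_le_add (g' := emp m (m + (r n - l n))) (by fun_prop) (by fun_prop)
      (by fun_prop)).trans ?_
    have h1 := hμ.abs_cov_le_of_sq_le (t := m + (r n - l n)) (c := a) (g := cnt a b)
      (f := emp m (m + (r n - l n))) (fun x y h => dependsOn_emp _ _ fun i hi => h i hi.2)
      (fun x y h => dependsOn_cnt _ _ fun i hi => h i ⟨hi.1, hi.2.trans_le (by omega)⟩)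
      (by omega) (emp_sq _ _) hcnt
    simp_rw [mul_comm (emp m (m + (r n - l n)) _)] at h1
    rw [mul_comm (∫ x, emp m (m + (r n - l n)) x ∂(μ n)), mul_comm (√1)] at h1
    have h2 := hμ.integral_emp_sub_emp_sq_le (a := m) (b := m + (r n - l n)) (c := m)
      (d := m + r n) (by omega) (by omega) (by omega)
    rw [show m - m = 0 by omega, show m + r n - (m + (r n - l n)) = l n by omega] at h2
    simp only [Nat.cast_zero, zero_add] at h2
    gcongr

/-- Since a window without ones contributes nothing to the number of ones, its covariance with the
number of ones is asymptotically minus the product of the means over that window. -/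
theorem eventually_abs_integral_win_mul_dev_add_le (hA : ClusterArray μ r l s ρ τ α κ p M) (C : ℕ)
    {ε : ℝ} (hε : 0 < ε) : ∀ᶠ n in atTop, ∀ m, m + r n ≤ C * r n →
      |∫ x, win (μ n) (r n) m x * dev (μ n) 0 (C * r n) x ∂(μ n) + τ * Real.exp (-α)| ≤ ε := by
  have hlim := (tendsto_iff_norm_sub_tendsto_zero.1
    (hA.tendsto_rate.mul hA.tendsto_void)).eventually_le_const (show 0 < ε / 3 by positivity)
  filter_upwards [hA.eventually_abs_cov_cnt_emp_le C (show 0 < ε / 3 by positivity), hlim]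
    with n hn hF m hm
  have := hA.prob n
  have hμ := hA.law n
  rw [Real.norm_eq_abs] at hF
  have h1 := hn 0 m m (Nat.zero_le _) (by omega) hm (Or.inl le_rfl)
  have h2 := hn (m + r n) (C * r n) m hm le_rfl hm (Or.inr le_rfl)
  have e : ∀ x, win (μ n) (r n) m x * dev (μ n) 0 (C * r n) x
      = cnt 0 m x * emp m (m + r n) x + cnt (m + r n) (C * r n) x * emp m (m + r n) x
        - (C * r n : ℕ) * rate (μ n) * emp m (m + r n) x
        - void (μ n) (r n) * dev (μ n) 0 (C * r n) x := fun x => by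
    have h3 := cnt_mul_emp (le_refl m) (le_refl (m + r n)) x
    have h4 : cnt 0 (C * r n) x = cnt 0 m x + cnt m (m + r n) x + cnt (m + r n) (C * r n) x := by
      rw [cnt_add_cnt (Nat.zero_le _) (Nat.le_add_right _ _), cnt_add_cnt (Nat.zero_le _) hm]
    unfold win dev
    rw [h4, Nat.sub_zero]
    linear_combination h3
  simp_rw [e]
  rw [integral_sub_cyl (by fun_prop) (by fun_prop), integral_sub_cyl (by fun_prop) (by fun_prop),
    integral_add_cyl (by fun_prop) (by fun_prop), integral_const_mul, integral_const_mul,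
    hμ.integral_dev, hμ.integral_emp, Nat.add_sub_cancel_left]
  have e2 : ((C * r n : ℕ) : ℝ) = (m - 0 : ℕ) + r n + (C * r n - (m + r n) : ℕ) := by
    rw [Nat.cast_sub hm, Nat.sub_zero]
    push_cast
    ring
  rw [e2]
  rw [abs_le] at *
  constructor <;> linarith [h1.1, h1.2, h2.1, h2.2, hF.1, hF.2]

theorem sum_dev_trimmed {j k t : ℕ} (μ : Measure (ℕ → Bool)) (htk : t ≤ k) (x : ℕ → Bool) :
    ∑ i ∈ Finset.range j, dev μ 0 t (shift (i * k) x)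
      + ∑ i ∈ Finset.range j, dev μ t k (shift (i * k) x) = dev μ 0 (j * k) x := by
  rw [← Finset.sum_add_distrib]
  simp_rw [dev_add_dev μ (Nat.zero_le t) htk]
  induction j with
  | zero => simp [dev, cnt]
  | succ j ih =>
    rw [Finset.sum_range_succ, ih, dev_shift, Nat.succ_mul, Nat.zero_add, Nat.add_comm k,
      dev_add_dev μ (Nat.zero_le _) (Nat.le_add_right _ _)]

/-- Second moments have the same limit if the `L²` distance vanishes. -/
theorem tendsto_of_abs_sqrt_sub_le {f g e : ℕ → ℝ} {a : ℝ} (hf : ∀ᶠ n in atTop, 0 ≤ f n)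
    (hg : ∀ᶠ n in atTop, 0 ≤ g n) (h : ∀ᶠ n in atTop, |√(g n) - √(f n)| ≤ √(e n))
    (he : Tendsto e atTop (𝓝 0)) (hlim : Tendsto f atTop (𝓝 a)) : Tendsto g atTop (𝓝 a) := by
  have h1 : Tendsto (fun n => √(e n)) atTop (𝓝 0) := by
    simpa [Function.comp_def] using (Real.continuous_sqrt.tendsto 0).comp he
  have h2 : Tendsto (fun n => √(f n)) atTop (𝓝 √a) := (Real.continuous_sqrt.tendsto a).comp hlim
  have h3 : Tendsto (fun n => √(g n)) atTop (𝓝 √a) := by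
    refine h2.congr_dist (squeeze_zero' (.of_forall fun _ => dist_nonneg) ?_ h1)
    filter_upwards [h] with n hn
    rwa [dist_comm, Real.dist_eq]
  have ha : 0 ≤ a := ge_of_tendsto hlim hf
  have h4 := h3.pow 2
  rw [Real.sq_sqrt ha] at h4
  refine h4.congr' ?_
  filter_upwards [hg] with n hn using Real.sq_sqrt hn

theorem abs_sqrt_integral_add_sq_sub_le {μ : Measure (ℕ → Bool)} [IsFiniteMeasure μ]
    {f g : (ℕ → Bool) → ℝ} (hf : Cylindrical f) (hg : Cylindrical g) :
    |√(∫ x, (f x + g x) ^ 2 ∂μ) - √(∫ x, f x ^ 2 ∂μ)| ≤ √(∫ x, g x ^ 2 ∂μ) := by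
  have h1 := sqrt_integral_add_sq_le (μ := μ) hf hg
  have h2 := sqrt_integral_add_sq_le (μ := μ) (hf.add hg) hg.neg
  simp only [add_neg_cancel_right, neg_sq] at h2
  rw [abs_le]
  constructor <;> linarith

theorem tendsto_natDiv_div (hA : ClusterArray μ r l s ρ τ α κ p M) (C : ℕ) :
    Tendsto (fun n => ((C * r n / s n : ℕ) : ℝ) / (r n / s n)) atTop (𝓝 C) := by
  have h : Tendsto (fun n => (C : ℝ) - s n / r n) atTop (𝓝 C) := by
    simpa using hA.s_div_r.const_sub (C : ℝ)
  refine tendsto_of_tendsto_of_tendsto_of_le_of_le h tendsto_const_nhds (fun n => ?_) fun n => ?_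
  · have := Nat.lt_div_mul_add (a := C * r n) (hA.s_pos n)
    have h2 : (C : ℝ) * r n < (C * r n / s n : ℕ) * s n + s n := by exact_mod_cast this
    have h3 := hA.s_pos' n
    have h4 := hA.r_pos' n
    rw [le_div_iff₀ (by positivity), sub_mul, ← mul_div_assoc, div_mul_div_cancel₀ h4.ne',
      div_self h3.ne', div_sub_one h3.ne', div_le_iff₀ h3]
    linarith
  · have h3 := hA.s_pos' n
    have h4 := hA.r_pos' n
    rw [div_le_iff₀ (by positivity), ← mul_div_assoc]
    exact Nat.cast_div_le.trans_eq (by push_cast; rfl)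

/-- The variance of the number of ones in `C` blocks of length `r` is asymptotically `C κ`: up to
gaps that are negligible in `L²`, the ones come in nearly uncorrelated blocks of length `s`. -/
theorem tendsto_integral_dev_sq (hA : ClusterArray μ r l s ρ τ α κ p M) (C : ℕ) :
    Tendsto (fun n => ∫ x, dev (μ n) 0 (C * r n) x ^ 2 ∂(μ n)) atTop (𝓝 (C * κ)) := by
  set j : ℕ → ℕ := fun n => C * r n / s n with hj
  set t : ℕ → ℕ := fun n => s n - l n with ht
  have htn : ∀ n, t n = s n - l n := fun _ => rfl
  have hjs : ∀ n, j n * s n ≤ C * r n := fun n => Nat.div_mul_le_self _ _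
  have hjr : ∀ n, (j n : ℝ) ≤ C * (r n / s n) := fun n => by
    rw [← mul_div_assoc]
    exact Nat.cast_div_le.trans_eq (by push_cast; rfl)
  have hr := hA.r_pos'
  have hs := hA.s_pos'
  have hrate : ∀ n, 0 ≤ rate (μ n) := fun n => rate_nonneg
  -- the ones in the gaps of length `l` and in the incomplete last block
  set D : ℕ → (ℕ → Bool) → ℝ := fun n x =>
    ∑ i ∈ Finset.range (j n), cnt (t n + i * s n) (s n + i * s n) x
      + cnt (j n * s n) (C * r n) x with hD
  have hDcyl : ∀ n, Cylindrical (D n) := fun n => by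
    simp only [hD]
    fun_prop
  have hD0 : ∀ n x, 0 ≤ D n x := fun n x =>
    add_nonneg (Finset.sum_nonneg fun i _ => cnt_nonneg _ _ _) (cnt_nonneg _ _ _)
  have hDle : ∀ n x, D n x ≤ cnt 0 (C * r n) x := fun n x => by
    rw [← cnt_add_cnt (Nat.zero_le _) (hjs n), cnt_mul_eq_sum]
    refine add_le_add (Finset.sum_le_sum fun i _ => cnt_mono ?_ ?_ x) le_rfl <;> omega
  have hDint : ∀ n, ∫ x, D n x ∂(μ n)
      = (j n * (s n - t n : ℕ) + (C * r n - j n * s n : ℕ)) * rate (μ n) := fun n => by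
    have := hA.prob n
    simp only [hD]
    rw [integral_add_cyl (by fun_prop) (by fun_prop), integral_sum_cyl _ fun i => by fun_prop]
    simp_rw [(hA.law n).integral_cnt', Nat.add_sub_add_right]
    simp
    ring
  have hDlim1 : Tendsto (fun n => ∫ x, D n x ∂(μ n)) atTop (𝓝 0) := by
    have h1 : Tendsto (fun n => C * (l n / s n * (r n * rate (μ n))) + s n * rate (μ n)) atTop
        (𝓝 0) := by
      simpa using ((hA.l_div_s.mul hA.tendsto_rate).const_mul (C : ℝ)).add hA.tendsto_s_mul_rate
    have := hA.prob
    refine squeeze_zero (fun n => integral_nonneg (hD0 n)) (fun n => ?_) h1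
    rw [hDint]
    have e1 : ((s n - t n : ℕ) : ℝ) ≤ l n := by exact_mod_cast (show s n - t n ≤ l n by have := htn n; omega)
    have e2 : ((C * r n - j n * s n : ℕ) : ℝ) ≤ s n := by
      have := Nat.lt_div_mul_add (a := C * r n) (hA.s_pos n)
      exact_mod_cast (show C * r n - j n * s n ≤ s n by simp only [hj]; omega)
    calc _ ≤ (C * (r n / s n) * l n + s n) * rate (μ n) := by
          have := hjr n
          have := hrate n
          gcongr
      _ = _ := by ring
  have hDlim : Tendsto (fun n => ∫ x, D n x ^ 2 ∂(μ n)) atTop (𝓝 0) := by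
    refine tendsto_integral_sq_zero hA.prob hDcyl hD0 hA.one_lt_p
      (M := (C : ℝ) ^ (2 * p - 1) * (C * M)) ?_ hDlim1
    filter_upwards [hA.eventually_integral_cnt_rpow_le C] with n hn
    have := hA.prob n
    have := hDcyl n
    refine le_trans (integral_mono_cyl (by fun_prop) (by fun_prop) fun x => ?_) hn
    have := hA.one_lt_p
    exact Real.rpow_le_rpow (hD0 n x) (hDle n x) (by linarith)
  -- second moments over blocks of length `s` before trimming
  have h1 : Tendsto (fun n => j n * ∫ x, cnt 0 (s n) x ^ 2 ∂(μ n)) atTop (𝓝 (C * κ)) := by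
    refine ((hA.tendsto_natDiv_div C).mul hA.tendsto_sq).congr fun n => ?_
    have := (hr n).ne'
    have := (hs n).ne'
    simp only [hj]
    field_simp
  -- and after trimming
  have h2 : Tendsto (fun n => j n * ∫ x, cnt 0 (t n) x ^ 2 ∂(μ n)) atTop (𝓝 (C * κ)) := by
    refine tendsto_of_abs_sqrt_sub_le (.of_forall fun n => ?_) (.of_forall fun n => ?_) ?_
      hDlim h1
    · exact mul_nonneg (Nat.cast_nonneg _) (integral_nonneg fun x => sq_nonneg _)
    · exact mul_nonneg (Nat.cast_nonneg _) (integral_nonneg fun x => sq_nonneg _)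
    · refine .of_forall fun n => ?_
      have := hA.prob n
      have hts : t n ≤ s n := Nat.sub_le _ _
      have e1 := abs_sqrt_integral_add_sq_sub_le (μ := μ n) (cylindrical_cnt 0 (t n))
        (cylindrical_cnt (t n) (s n))
      simp_rw [cnt_add_cnt (Nat.zero_le _) hts] at e1
      rw [Real.sqrt_mul (Nat.cast_nonneg _), Real.sqrt_mul (Nat.cast_nonneg _), ← mul_sub, abs_mul,
        abs_of_nonneg (Real.sqrt_nonneg _), abs_sub_comm]
      refine (mul_le_mul_of_nonneg_left e1 (Real.sqrt_nonneg _)).trans ?_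
      rw [← Real.sqrt_mul (Nat.cast_nonneg _)]
      refine Real.sqrt_le_sqrt ?_
      have e2 : (j n : ℝ) * ∫ x, cnt (t n) (s n) x ^ 2 ∂(μ n)
          = ∫ x, ∑ i ∈ Finset.range (j n), cnt (t n + i * s n) (s n + i * s n) x ^ 2 ∂(μ n) := by
        rw [integral_sum_cyl _ fun i => by fun_prop]
        simp_rw [← cnt_shift]
        rw [Finset.sum_congr rfl fun i _ => (hA.law n).integral_shift
          (f := fun x => cnt (t n) (s n) x ^ 2) (by fun_prop) (i * s n)]
        simp
      rw [e2]
      have := hDcyl n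
      refine integral_mono_cyl (by fun_prop) (by fun_prop) fun x => ?_
      refine (Finset.sum_sq_le_sq_sum_of_nonneg fun i _ => cnt_nonneg _ _ x).trans ?_
      have := cnt_nonneg (j n * s n) (C * r n) x
      have h0 : 0 ≤ ∑ i ∈ Finset.range (j n), cnt (t n + i * s n) (s n + i * s n) x :=
        Finset.sum_nonneg fun i _ => cnt_nonneg _ _ _
      simp only [hD]
      gcongr
      linarith
  -- centring costs nothing
  have h3 : Tendsto (fun n => j n * ∫ x, dev (μ n) 0 (t n) x ^ 2 ∂(μ n)) atTop (𝓝 (C * κ)) := by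
    have h4 : Tendsto (fun n => (j n : ℝ) * (((t n - 0 : ℕ) : ℝ) * rate (μ n)) ^ 2) atTop
        (𝓝 0) := by
      have h5 : Tendsto (fun n => C * ((r n * rate (μ n)) * (s n * rate (μ n)))) atTop (𝓝 0) := by
        simpa using (hA.tendsto_rate.mul hA.tendsto_s_mul_rate).const_mul (C : ℝ)
      refine squeeze_zero (fun n => by positivity) (fun n => ?_) h5
      have e1 : ((t n - 0 : ℕ) : ℝ) ≤ s n := by exact_mod_cast (show t n - 0 ≤ s n by have := htn n; omega)
      calc (j n : ℝ) * (((t n - 0 : ℕ) : ℝ) * rate (μ n)) ^ 2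
          ≤ C * (r n / s n) * (s n * rate (μ n)) ^ 2 := by
            have := hjr n
            have := hrate n
            gcongr
        _ = _ := by
            have := (hs n).ne'
            field_simp
    have h5 := h2.sub h4
    rw [sub_zero] at h5
    refine h5.congr fun n => ?_
    have := hA.prob n
    rw [(hA.law n).integral_dev_sq]
    ring
  -- the trimmed blocks are nearly uncorrelated
  have h6 : Tendsto (fun n => ∫ x, (∑ i ∈ Finset.range (j n),
      dev (μ n) 0 (t n) (shift (i * s n) x)) ^ 2 ∂(μ n)) atTop (𝓝 (C * κ)) := by
    have herr : Tendsto (fun n => C * (r n / s n * ρ n)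
        * (j n * ∫ x, dev (μ n) 0 (t n) x ^ 2 ∂(μ n))) atTop (𝓝 0) := by
      simpa using (hA.tendsto_div_mul_rho.const_mul (C : ℝ)).mul h3
    refine h3.congr_dist (squeeze_zero' (.of_forall fun _ => dist_nonneg) ?_ herr)
    filter_upwards [hA.eventually_l_le_s, hA.eventually_mul_r_le C] with n hls hC
    have := hA.prob n
    rw [dist_comm, Real.dist_eq]
    have hj' := hjs n
    have ht' := htn n
    refine ((hA.law n).abs_integral_sum_shift_sq_sub_le (j n) (dependsOn_dev (μ n) 0 (t n))
      (by omega) (by omega) ((hA.law n).integral_dev _ _)).trans ?_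
    have hv : 0 ≤ ∫ x, dev (μ n) 0 (t n) x ^ 2 ∂(μ n) := integral_nonneg fun x => sq_nonneg _
    have hρ := hA.rho_nonneg n
    calc (j n : ℝ) ^ 2 * (ρ n * ∫ x, dev (μ n) 0 (t n) x ^ 2 ∂(μ n))
        = j n * ρ n * (j n * ∫ x, dev (μ n) 0 (t n) x ^ 2 ∂(μ n)) := by ring
      _ ≤ C * (r n / s n) * ρ n * (j n * ∫ x, dev (μ n) 0 (t n) x ^ 2 ∂(μ n)) := by
          have := hjr n
          gcongr
      _ = _ := by ring
  refine tendsto_of_abs_sqrt_sub_le (.of_forall fun n => integral_nonneg fun x => sq_nonneg _)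
    (.of_forall fun n => integral_nonneg fun x => sq_nonneg _) (.of_forall fun n => ?_) hDlim h6
  have := hA.prob n
  have := hDcyl n
  have hts : t n ≤ s n := Nat.sub_le _ _
  have e1 : ∀ x, dev (μ n) 0 (C * r n) x
      = ∑ i ∈ Finset.range (j n), dev (μ n) 0 (t n) (shift (i * s n) x)
        + (D n x - ∫ y, D n y ∂(μ n)) := fun x => by
    rw [← dev_add_dev (μ n) (Nat.zero_le _) (hjs n), ← sum_dev_trimmed (μ n) hts, hDint]
    simp_rw [dev_shift]
    simp only [hD, dev, Finset.sum_sub_distrib, Nat.add_sub_add_right]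
    simp
    ring
  simp_rw [e1]
  have e2 : Cylindrical fun x => ∑ i ∈ Finset.range (j n),
      dev (μ n) 0 (t n) (shift (i * s n) x) := by
    simp_rw [dev_shift]
    fun_prop
  refine (abs_sqrt_integral_add_sq_sub_le e2 (by fun_prop)).trans (Real.sqrt_le_sqrt ?_)
  rw [integral_sub_integral_sq (hDcyl n) rfl]
  linarith [sq_nonneg (∫ y, D n y ∂(μ n))]

end ClusterArray

/-! ### Big and small blocks, and Taylor expansion of characteristic functions -/

theorem sum_range_shift_win (μ : Measure (ℕ → Bool)) (k h K : ℕ) (x : ℕ → Bool) :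
    ∑ m ∈ Finset.range K, win μ k m (shift h x) = ∑ m ∈ Finset.Ico h (h + K), win μ k m x := by
  rw [Finset.sum_Ico_eq_sum_range, Nat.add_sub_cancel_left]
  exact Finset.sum_congr rfl fun m _ => by rw [win_shift, add_comm]

theorem abs_sum_win_le (μ : Measure (ℕ → Bool)) [IsProbabilityMeasure μ] (k : ℕ) (t : Finset ℕ)
    (g : ℕ → ℕ) (x : ℕ → Bool) : |∑ m ∈ t, win μ k (g m) x| ≤ t.card := by
  refine (Finset.abs_sum_le_sum_abs _ _).trans ?_
  refine (Finset.sum_le_sum fun m _ => abs_win_le_one μ k (g m) x).trans ?_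
  simp

namespace BlockArray

theorem disjointSum_add (μ : Measure (ℕ → Bool)) (k q q' : ℕ) (x : ℕ → Bool) :
    disjointSum μ k (q + q') x = disjointSum μ k q x + disjointSum μ k q' (shift (q * k) x) := by
  unfold disjointSum
  rw [Finset.sum_range_add]
  congr 1
  refine Finset.sum_congr rfl fun i _ => ?_
  rw [win_shift, add_mul, add_comm]

theorem slidingSum_add (μ : Measure (ℕ → Bool)) (k q q' : ℕ) (x : ℕ → Bool) :
    slidingSum μ k (q + q') x = slidingSum μ k q x + slidingSum μ k q' (shift (q * k) x) := by
  unfold slidingSum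
  rw [← add_div, sum_range_shift_win, add_mul, ← Finset.sum_range_add_sum_Ico _
    (Nat.le_add_right (q * k) (q' * k))]

theorem abs_disjointSum_le (μ : Measure (ℕ → Bool)) [IsProbabilityMeasure μ] (k q : ℕ)
    (x : ℕ → Bool) : |disjointSum μ k q x| ≤ q := by
  simpa [disjointSum] using abs_sum_win_le μ k (Finset.range q) (fun i => i * k) x

theorem abs_slidingSum_le (μ : Measure (ℕ → Bool)) [IsProbabilityMeasure μ] {k : ℕ} (hk : 0 < k)
    (q : ℕ) (x : ℕ → Bool) : |slidingSum μ k q x| ≤ q := by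
  have hk' : (0 : ℝ) < k := Nat.cast_pos.2 hk
  have := abs_sum_win_le μ k (Finset.range (q * k)) id x
  rw [slidingSum, abs_div, abs_of_pos hk', div_le_iff₀ hk']
  simpa using this

theorem dependsOn_disjointSum (μ : Measure (ℕ → Bool)) (k q : ℕ) :
    DependsOn (disjointSum μ k q) (Set.Ico 0 (q * k)) := fun x y h =>
  Finset.sum_congr rfl fun i hi => dependsOn_win μ k (i * k) fun m hm => h m ⟨Nat.zero_le _, by
    have := Nat.mul_le_mul_right k (Finset.mem_range.1 hi)
    rw [Nat.succ_mul] at this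
    exact lt_of_lt_of_le hm.2 this⟩

theorem dependsOn_slidingSum (μ : Measure (ℕ → Bool)) (k q : ℕ) :
    DependsOn (slidingSum μ k q) (Set.Ico 0 ((q + 1) * k)) := fun x y h => by
  unfold slidingSum
  congr 1
  refine Finset.sum_congr rfl fun i hi => dependsOn_win μ k i fun m hm => h m ⟨Nat.zero_le _, ?_⟩
  have := Finset.mem_range.1 hi
  have := hm.2
  rw [add_mul, one_mul]
  omega

end BlockArray

open BlockArray

/-- A linear combination of the three statistics over `q` consecutive blocks: the number of blocks
without ones, the proportion of windows without ones, and the number of ones, all centred. -/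
noncomputable def blockSum (μ : Measure (ℕ → Bool)) (a b c : ℝ) (k q : ℕ) (x : ℕ → Bool) : ℝ :=
  a * disjointSum μ k q x + b * slidingSum μ k q x + c * dev μ 0 (q * k) x

/-- The part of `blockSum` over `q + 2` blocks that is kept in the blocking argument. It depends on
the first `q + 1` blocks only. -/
noncomputable def bigBlock (μ : Measure (ℕ → Bool)) (a b c : ℝ) (k q : ℕ) (x : ℕ → Bool) : ℝ :=
  a * disjointSum μ k q x + b * slidingSum μ k q x + c * dev μ 0 ((q + 1) * k) x

/-- The part of `blockSum` over `q + 2` blocks that is discarded in the blocking argument, moved to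
the left by `q` blocks. -/
noncomputable def smallBlock (μ : Measure (ℕ → Bool)) (a b c : ℝ) (k : ℕ) (x : ℕ → Bool) : ℝ :=
  a * disjointSum μ k 2 x + b * slidingSum μ k 2 x + c * dev μ k (2 * k) x

section OneLevel

variable (μ : Measure (ℕ → Bool)) (a b c : ℝ) (k : ℕ)

@[fun_prop]
theorem cylindrical_blockSum (q : ℕ) : Cylindrical (blockSum μ a b c k q) := by
  unfold blockSum
  fun_prop

@[fun_prop]
theorem cylindrical_bigBlock (q : ℕ) : Cylindrical (bigBlock μ a b c k q) := by
  unfold bigBlock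
  fun_prop

@[fun_prop]
theorem cylindrical_smallBlock : Cylindrical (smallBlock μ a b c k) := by
  unfold smallBlock
  fun_prop

theorem dependsOn_bigBlock (q : ℕ) :
    DependsOn (bigBlock μ a b c k q) (Set.Ico 0 ((q + 1) * k)) := fun x y h => by
  have e := add_mul q 1 k
  unfold bigBlock
  rw [dependsOn_disjointSum μ k q fun i hi => h i ⟨hi.1, hi.2.trans_le (by omega)⟩,
    dependsOn_slidingSum μ k q h, dependsOn_dev μ _ _ h]

theorem dependsOn_smallBlock :
    DependsOn (smallBlock μ a b c k) (Set.Ico 0 (3 * k)) := fun x y h => by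
  unfold smallBlock
  rw [dependsOn_disjointSum μ k 2 fun i hi => h i ⟨hi.1, hi.2.trans_le (by omega)⟩,
    dependsOn_slidingSum μ k 2 h,
    dependsOn_dev μ _ _ fun i hi => h i ⟨Nat.zero_le _, hi.2.trans_le (by omega)⟩]

theorem blockSum_add (q q' : ℕ) (x : ℕ → Bool) : blockSum μ a b c k (q + q') x
    = blockSum μ a b c k q x + blockSum μ a b c k q' (shift (q * k) x) := by
  unfold blockSum
  rw [disjointSum_add, slidingSum_add, dev_shift, ← dev_add_dev μ (Nat.zero_le (q * k))
    (Nat.mul_le_mul_right k (Nat.le_add_right q q')), Nat.zero_add, add_mul, add_comm (q' * k)]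
  ring

theorem blockSum_add_two (q : ℕ) (x : ℕ → Bool) : blockSum μ a b c k (q + 2) x
    = bigBlock μ a b c k q x + smallBlock μ a b c k (shift (q * k) x) := by
  unfold blockSum bigBlock smallBlock
  rw [disjointSum_add, slidingSum_add, dev_shift, ← dev_add_dev μ (Nat.zero_le ((q + 1) * k))
    (Nat.mul_le_mul_right k (show q + 1 ≤ q + 2 by omega))]
  rw [show k + q * k = (q + 1) * k by ring, show 2 * k + q * k = (q + 2) * k by ring]
  ring

theorem blockSum_mul (q m : ℕ) (x : ℕ → Bool) : blockSum μ a b c k (m * (q + 2)) x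
    = ∑ j ∈ Finset.range m, bigBlock μ a b c k q (shift (j * ((q + 2) * k)) x)
      + ∑ j ∈ Finset.range m, smallBlock μ a b c k (shift (q * k + j * ((q + 2) * k)) x) := by
  induction m with
  | zero => simp [blockSum, disjointSum, slidingSum, dev, cnt]
  | succ m ih =>
    rw [Nat.succ_mul, blockSum_add, ih, blockSum_add_two, shift_shift, Finset.sum_range_succ,
      Finset.sum_range_succ, mul_assoc]
    ring

/-- The three statistics of a sample of size `n`. -/
noncomputable def sampleSum (n : ℕ) (x : ℕ → Bool) : ℝ :=
  a * disjointSum μ k (n / k) x + b * ((∑ m ∈ Finset.range (n - k + 1), win μ k m x) / k)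
    + c * dev μ 0 ((n / k) * k) x

@[fun_prop]
theorem cylindrical_sampleSum (n : ℕ) : Cylindrical (sampleSum μ a b c k n) := by
  unfold sampleSum
  fun_prop

variable {k} {μ}

theorem abs_blockCombination_le [IsProbabilityMeasure μ] (hk : 0 < k) (q d e : ℕ) (x : ℕ → Bool) :
    |a * disjointSum μ k q x + b * slidingSum μ k q x + c * dev μ d e x|
      ≤ (|a| + |b|) * q + |c| * |dev μ d e x| := by
  refine (abs_add_three _ _ _).trans ?_
  rw [abs_mul, abs_mul, abs_mul, add_mul]
  gcongr
  · exact abs_disjointSum_le μ k q x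
  · exact abs_slidingSum_le μ hk q x

/-- What is left of the sample after groups of blocks. -/
theorem abs_sampleSum_sub_blockSum_le [IsProbabilityMeasure μ] (hk : 0 < k) {n q L : ℕ}
    (hq : q < n / k) (hL : n / k ≤ q + L) (x : ℕ → Bool) :
    |sampleSum μ a b c k n x - blockSum μ a b c k q x|
      ≤ (|a| + |b|) * L + |c| * |dev μ (q * k) ((n / k) * k) x| := by
  have hk' : (0 : ℝ) < k := Nat.cast_pos.2 hk
  obtain ⟨d, hd⟩ := Nat.exists_eq_add_of_le hq.le
  have hdL : d ≤ L := by omega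
  have hnk := Nat.div_mul_le_self n k
  have hnk' := Nat.lt_div_mul_add (a := n) hk
  have hqk : (q + 1) * k ≤ n / k * k := Nat.mul_le_mul_right k hq
  have hqL : n / k * k ≤ (q + L) * k := Nat.mul_le_mul_right k hL
  rw [add_mul] at hqk hqL
  have e : sampleSum μ a b c k n x - blockSum μ a b c k q x
      = a * disjointSum μ k d (shift (q * k) x)
        + b * ((∑ m ∈ Finset.Ico (q * k) (n - k + 1), win μ k m x) / k)
        + c * dev μ (q * k) ((n / k) * k) x := by
    unfold sampleSum blockSum slidingSum
    rw [← dev_add_dev μ (Nat.zero_le (q * k)) (Nat.mul_le_mul_right k hq.le),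
      ← Finset.sum_range_add_sum_Ico _ (show q * k ≤ n - k + 1 by omega),
      show disjointSum μ k (n / k) x = disjointSum μ k (q + d) x by rw [hd], disjointSum_add]
    ring
  rw [e]
  refine (abs_add_three _ _ _).trans ?_
  rw [abs_mul, abs_mul, abs_mul, add_mul]
  gcongr
  · exact (abs_disjointSum_le μ k d _).trans (by exact_mod_cast hdL)
  · rw [abs_div, abs_of_pos hk', div_le_iff₀ hk']
    refine (abs_sum_win_le μ k _ id x).trans ?_
    rw [Nat.card_Ico]
    exact_mod_cast (show n - k + 1 - q * k ≤ L * k by omega)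

end OneLevel

section Taylor

/-- The error of the second-order Taylor expansion of `exp (i y)` is of order `|y| ^ 3` near zero and
`|y| ^ 2` far away, hence of any order in between. -/
theorem norm_exp_mul_I_sub_le {q : ℝ} (hq : 2 ≤ q) (hq' : q ≤ 3) (y : ℝ) :
    ‖Complex.exp (y * Complex.I) - (1 + y * Complex.I - y ^ 2 / 2)‖ ≤ 4 * |y| ^ q := by
  have e : (y * Complex.I) ^ 2 = -(y : ℂ) ^ 2 := by rw [mul_pow, Complex.I_sq]; ring
  rcases le_or_gt |y| 1 with h | h
  · have h1 := Complex.exp_bound (x := y * Complex.I) (n := 3) (by simpa using h) (by norm_num)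
    have e2 : ∑ m ∈ Finset.range 3, (y * Complex.I) ^ m / (m.factorial : ℂ)
        = 1 + y * Complex.I - y ^ 2 / 2 := by
      simp [Finset.sum_range_succ, e, Nat.factorial]
      ring
    rw [e2] at h1
    refine h1.trans ?_
    have h2 : |y| ^ 3 ≤ |y| ^ q := by
      rcases (abs_nonneg y).eq_or_lt with h0 | h0
      · rw [← h0]; simp; positivity
      · rw [← Real.rpow_natCast]
        exact Real.rpow_le_rpow_of_exponent_ge h0 h (by norm_num; exact hq')
    have h3 : 0 ≤ |y| ^ q := by positivity
    simp only [norm_mul, Complex.norm_real, Complex.norm_I, mul_one, Real.norm_eq_abs]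
    norm_num [Nat.factorial] at *
    linarith
  · have h1 : |y| ^ (2 : ℝ) ≤ |y| ^ q := Real.rpow_le_rpow_of_exponent_le h.le hq
    rw [Real.rpow_two] at h1
    have h2 : ‖Complex.exp (y * Complex.I) - (1 + y * Complex.I - y ^ 2 / 2)‖
        ≤ 1 + (1 + |y| + |y| ^ 2 / 2) := by
      refine (norm_sub_le _ _).trans (add_le_add (Complex.norm_exp_ofReal_mul_I y).le ?_)
      refine (norm_sub_le _ _).trans (add_le_add ((norm_add_le _ _).trans ?_) ?_)
      · simp
      · simp
    nlinarith

theorem norm_pow_sub_pow_le {z w : ℂ} (hz : ‖z‖ ≤ 1) (hw : ‖w‖ ≤ 1) (m : ℕ) :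
    ‖z ^ m - w ^ m‖ ≤ m * ‖z - w‖ := by
  induction m with
  | zero => simp
  | succ m ih =>
    have e : z ^ (m + 1) - w ^ (m + 1) = z ^ m * (z - w) + (z ^ m - w ^ m) * w := by ring
    rw [e]
    refine (norm_add_le _ _).trans ?_
    rw [norm_mul, norm_mul, norm_pow]
    have h1 : ‖z‖ ^ m ≤ 1 := pow_le_one₀ (norm_nonneg _) hz
    push_cast
    nlinarith [norm_nonneg (z - w), norm_nonneg (z ^ m - w ^ m)]

theorem abs_exp_neg_sub_one_sub_le {x : ℝ} (hx : 0 ≤ x) : |Real.exp (-x) - (1 - x)| ≤ x ^ 2 := by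
  have h1 := Real.add_one_le_exp (-x)
  have h2 := Real.add_one_le_exp x
  have h3 : Real.exp (-x) * Real.exp x = 1 := by rw [← Real.exp_add]; simp
  have h4 := Real.exp_pos (-x)
  rw [abs_of_nonneg (by linarith)]
  have h5 : Real.exp (-x) * (1 + x) ≤ 1 := by nlinarith
  nlinarith [sq_nonneg x, mul_nonneg hx (sub_nonneg.2 h1)]

/-- The characteristic function of a sum of independent copies of a centred random variable is
close to that of the normal distribution with the same variance. -/
theorem norm_integral_exp_pow_sub_le {μ : Measure (ℕ → Bool)} [IsProbabilityMeasure μ]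
    {f : (ℕ → Bool) → ℝ} (hf : Cylindrical f) (h0 : ∫ x, f x ∂μ = 0) {q : ℝ} (hq : 2 ≤ q)
    (hq' : q ≤ 3) (m : ℕ) :
    ‖(∫ x, Complex.exp (f x * Complex.I) ∂μ) ^ m - Real.exp (-(m * ((∫ x, f x ^ 2 ∂μ) / 2)))‖
      ≤ m * (4 * ∫ x, |f x| ^ q ∂μ + ((∫ x, f x ^ 2 ∂μ) / 2) ^ 2) := by
  set v := (∫ x, f x ^ 2 ∂μ) / 2 with hv
  have hv0 : 0 ≤ v := div_nonneg (integral_nonneg fun x => sq_nonneg _) zero_le_two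
  have e1 : ((Real.exp (-(m * v)) : ℝ) : ℂ) = ((Real.exp (-v) : ℝ) : ℂ) ^ m := by
    rw [← Complex.ofReal_pow, ← Real.exp_nat_mul]
    congr 2
    ring
  have hint : Integrable (fun x => Complex.exp (f x * Complex.I)) μ :=
    Cylindrical.integrable (.comp (fun y : ℝ => Complex.exp (y * Complex.I)) hf)
  have hint2 : Integrable (fun x => (1 + f x * Complex.I - (f x : ℂ) ^ 2 / 2)) μ :=
    Cylindrical.integrable (.comp (fun y : ℝ => 1 + y * Complex.I - (y : ℂ) ^ 2 / 2) hf)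
  have e2 : ∫ x, (1 + f x * Complex.I - (f x : ℂ) ^ 2 / 2) ∂μ = ((1 - v : ℝ) : ℂ) := by
    have i1 : Integrable (fun x => (f x : ℂ) * Complex.I) μ :=
      Cylindrical.integrable (.comp (fun y : ℝ => (y : ℂ) * Complex.I) hf)
    have i2 : Integrable (fun x => (f x : ℂ) ^ 2 / 2) μ :=
      Cylindrical.integrable (.comp (fun y : ℝ => (y : ℂ) ^ 2 / 2) hf)
    have i3 : Integrable (fun x => 1 + (f x : ℂ) * Complex.I) μ :=
      Cylindrical.integrable (.comp (fun y : ℝ => 1 + (y : ℂ) * Complex.I) hf)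
    rw [integral_sub i3 i2, integral_add (integrable_const _) i1,
      integral_mul_const, integral_div]
    simp_rw [← Complex.ofReal_pow]
    rw [integral_complex_ofReal, integral_complex_ofReal, h0]
    simp [hv]
  have h1 : ‖∫ x, Complex.exp (f x * Complex.I) ∂μ - ((1 - v : ℝ) : ℂ)‖
      ≤ 4 * ∫ x, |f x| ^ q ∂μ := by
    rw [← e2, ← integral_sub hint hint2, ← integral_const_mul]
    refine norm_integral_le_of_norm_le ?_ (ae_of_all _ fun x => norm_exp_mul_I_sub_le hq hq' (f x))
    exact Cylindrical.integrable (by fun_prop)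
  have h2 : ‖((1 - v : ℝ) : ℂ) - ((Real.exp (-v) : ℝ) : ℂ)‖ ≤ v ^ 2 := by
    rw [← Complex.ofReal_sub, Complex.norm_real, Real.norm_eq_abs, abs_sub_comm]
    exact abs_exp_neg_sub_one_sub_le hv0
  rw [e1]
  refine (norm_pow_sub_pow_le ?_ ?_ m).trans ?_
  · simpa using norm_integral_le_of_norm_le_const (μ := μ) (C := 1)
      (ae_of_all _ fun x => (Complex.norm_exp_ofReal_mul_I (f x)).le)
  · rw [Complex.norm_real, Real.norm_eq_abs, abs_of_pos (Real.exp_pos _)]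
    exact Real.exp_le_one_iff.2 (by linarith)
  · refine mul_le_mul_of_nonneg_left ?_ (Nat.cast_nonneg _)
    exact (norm_sub_le_norm_sub_add_norm_sub _ ((1 - v : ℝ) : ℂ) _).trans (add_le_add h1 h2)

theorem norm_integral_exp_sub_integral_exp_le {μ : Measure (ℕ → Bool)} [IsProbabilityMeasure μ]
    {f g : (ℕ → Bool) → ℝ} (hf : Cylindrical f) (hg : Cylindrical g) :
    ‖∫ x, Complex.exp (f x * Complex.I) ∂μ - ∫ x, Complex.exp (g x * Complex.I) ∂μ‖
      ≤ √(∫ x, (f x - g x) ^ 2 ∂μ) := by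
  have i : ∀ f : (ℕ → Bool) → ℝ, Cylindrical f →
      Integrable (fun x => Complex.exp (f x * Complex.I)) μ := fun f hf =>
    Cylindrical.integrable (.comp (fun y : ℝ => Complex.exp (y * Complex.I)) hf)
  rw [← integral_sub (i f hf) (i g hg)]
  have h1 : ∀ x, ‖Complex.exp (f x * Complex.I) - Complex.exp (g x * Complex.I)‖
      ≤ |f x - g x| := fun x => by
    have e : Complex.exp (f x * Complex.I) - Complex.exp (g x * Complex.I)
        = Complex.exp (g x * Complex.I) * (Complex.exp (Complex.I * (f x - g x : ℝ)) - 1) := by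
      rw [mul_sub, ← Complex.exp_add, mul_one]
      congr 2
      push_cast
      ring
    rw [e, norm_mul, Complex.norm_exp_ofReal_mul_I, one_mul]
    exact Real.norm_exp_I_mul_ofReal_sub_one_le
  refine (norm_integral_le_of_norm_le (Cylindrical.integrable (by fun_prop))
    (ae_of_all _ h1)).trans ?_
  have := (le_abs_self _).trans (abs_integral_le_sqrt (μ := μ) (hf.sub hg).abs)
  simpa [sq_abs] using this

end Taylor

/-! ### Variances of big and small blocks -/

theorem integral_add_sq_le {μ : Measure (ℕ → Bool)} [IsFiniteMeasure μ]
    {f g : (ℕ → Bool) → ℝ} (hf : Cylindrical f) (hg : Cylindrical g) :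
    ∫ x, (f x + g x) ^ 2 ∂μ ≤ 2 * ∫ x, f x ^ 2 ∂μ + 2 * ∫ x, g x ^ 2 ∂μ := by
  rw [← integral_const_mul, ← integral_const_mul, ← integral_add_cyl (by fun_prop) (by fun_prop)]
  exact integral_mono_cyl (by fun_prop) (by fun_prop) fun x => by nlinarith [sq_nonneg (f x - g x)]

/-- Second moments of functions bounded in terms of a centred number of ones. -/
theorem integral_sq_le_of_abs_le {μ : Measure (ℕ → Bool)} [IsProbabilityMeasure μ]
    {f g : (ℕ → Bool) → ℝ} (hf : Cylindrical f) (hg : Cylindrical g) {A B : ℝ}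
    (h : ∀ x, |f x| ≤ A + |B| * |g x|) :
    ∫ x, f x ^ 2 ∂μ ≤ 2 * A ^ 2 + 2 * B ^ 2 * ∫ x, g x ^ 2 ∂μ := by
  have e : ∫ x, (2 * A ^ 2 + 2 * B ^ 2 * g x ^ 2) ∂μ = 2 * A ^ 2 + 2 * B ^ 2 * ∫ x, g x ^ 2 ∂μ := by
    rw [integral_add_cyl (by fun_prop) (by fun_prop), integral_const_mul (2 * B ^ 2)]
    simp
  rw [← e]
  refine integral_mono_cyl (by fun_prop) (by fun_prop) fun x => ?_
  have h1 : f x ^ 2 ≤ (A + |B| * |g x|) ^ 2 := sq_le_sq' (by linarith [neg_abs_le (f x), h x])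
    ((le_abs_self _).trans (h x))
  have h2 : (|B| * |g x|) ^ 2 = B ^ 2 * g x ^ 2 := by rw [mul_pow, sq_abs, sq_abs]
  nlinarith [sq_nonneg (A - |B| * |g x|)]

/-- The asymptotic variance, per block, of a linear combination of the three statistics. -/
noncomputable def limitVariance (τ α κ a b c : ℝ) : ℝ :=
  a ^ 2 * windowCov α 0 + (2 * a * b + b ^ 2) * (2 * windowCovIntegral α)
    - 2 * (a + b) * c * (τ * Real.exp (-α)) + c ^ 2 * κ

namespace ClusterArray

variable {μ : ℕ → Measure (ℕ → Bool)} {r l s : ℕ → ℕ} {ρ : ℕ → ℝ} {τ α κ p M : ℝ}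

theorem tendsto_blocks (hA : ClusterArray μ r l s ρ τ α κ p M) :
    Tendsto (fun n => ((n / r n : ℕ) : ℝ)) atTop atTop := by
  rw [tendsto_natCast_atTop_iff]
  refine tendsto_atTop.2 fun C => ?_
  filter_upwards [hA.eventually_mul_r_le C] with n hn
  exact (Nat.le_div_iff_mul_le (hA.r_pos n)).2 hn

theorem tendsto_blocks_mul_rho (hA : ClusterArray μ r l s ρ τ α κ p M) :
    Tendsto (fun n => ((n / r n : ℕ) : ℝ) * ρ n) atTop (𝓝 0) := by
  refine squeeze_zero (fun n => mul_nonneg (Nat.cast_nonneg _) (hA.rho_nonneg n)) (fun n => ?_)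
    hA.tendsto_mul_rho_div_r
  exact mul_le_mul_of_nonneg_right Nat.cast_div_le (hA.rho_nonneg n)

theorem eventually_integral_dev_sq_le (hA : ClusterArray μ r l s ρ τ α κ p M) (C : ℕ) :
    ∀ᶠ n in atTop, ∀ a b, a ≤ b → b ≤ a + C * r n →
      ∫ x, dev (μ n) a b x ^ 2 ∂(μ n) ≤ 1 + (C : ℝ) ^ (2 * p - 1) * (C * M) := by
  filter_upwards [hA.eventually_integral_cnt_sq_le C] with n hn a b hab hb
  have := hA.prob n
  have h1 := (hA.law n).integral_shift (f := fun x => dev (μ n) 0 (b - a) x ^ 2) (by fun_prop) a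
  simp_rw [dev_shift, Nat.zero_add, Nat.sub_add_cancel hab] at h1
  rw [h1, (hA.law n).integral_dev_sq]
  have h2 := hn 0 (b - a) (Nat.zero_le _) (by omega)
  linarith [sq_nonneg (((b - a - 0 : ℕ) : ℝ) * rate (μ n))]

theorem eventually_abs_integral_disjointSum_mul_dev_add_le
    (hA : ClusterArray μ r l s ρ τ α κ p M) (q : ℕ) : ∀ᶠ n in atTop,
      |∫ x, disjointSum (μ n) (r n) q x * dev (μ n) 0 ((q + 1) * r n) x ∂(μ n)
        + q * (τ * Real.exp (-α))| ≤ 1 := by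
  filter_upwards [hA.eventually_abs_integral_win_mul_dev_add_le (q + 1)
    (show (0 : ℝ) < 1 / (q + 1) by positivity)] with n hn
  have := hA.prob n
  simp_rw [disjointSum, Finset.sum_mul]
  rw [integral_sum_cyl _ fun i => by fun_prop]
  have e : (q : ℝ) * (τ * Real.exp (-α)) = ∑ i ∈ Finset.range q, τ * Real.exp (-α) := by simp
  rw [e, ← Finset.sum_add_distrib]
  calc _ ≤ ∑ i ∈ Finset.range q, (1 : ℝ) / (q + 1) :=
        (Finset.abs_sum_le_sum_abs _ _).trans (Finset.sum_le_sum fun i hi => hn _ (by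
          rw [← Nat.succ_mul]
          exact Nat.mul_le_mul_right _ (Nat.succ_le_succ (Finset.mem_range.1 hi).le)))
    _ = q * (1 / (q + 1)) := by simp
    _ ≤ 1 := by
        rw [mul_one_div, div_le_one (by positivity)]
        linarith

theorem eventually_abs_integral_slidingSum_mul_dev_add_le
    (hA : ClusterArray μ r l s ρ τ α κ p M) (q : ℕ) : ∀ᶠ n in atTop,
      |∫ x, slidingSum (μ n) (r n) q x * dev (μ n) 0 ((q + 1) * r n) x ∂(μ n)
        + q * (τ * Real.exp (-α))| ≤ 1 := by
  filter_upwards [hA.eventually_abs_integral_win_mul_dev_add_le (q + 1)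
    (show (0 : ℝ) < 1 / (q + 1) by positivity)] with n hn
  have := hA.prob n
  have hr := hA.r_pos' n
  simp_rw [slidingSum, div_mul_eq_mul_div, Finset.sum_mul]
  rw [integral_div, integral_sum_cyl _ fun i => by fun_prop]
  have e : (q : ℝ) * (τ * Real.exp (-α))
      = (∑ i ∈ Finset.range (q * r n), τ * Real.exp (-α)) / r n := by
    rw [Finset.sum_const, Finset.card_range, nsmul_eq_mul]
    push_cast
    field_simp
  rw [e, ← add_div, ← Finset.sum_add_distrib, abs_div, abs_of_pos hr, div_le_iff₀ hr, one_mul]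
  calc _ ≤ ∑ i ∈ Finset.range (q * r n), (1 : ℝ) / (q + 1) :=
        (Finset.abs_sum_le_sum_abs _ _).trans (Finset.sum_le_sum fun i hi => hn _ (by
          have := Finset.mem_range.1 hi
          rw [add_mul, one_mul]
          omega))
    _ = q * r n * (1 / (q + 1)) := by simp
    _ ≤ r n := by
        rw [mul_one_div, div_le_iff₀ (by positivity)]
        nlinarith

theorem integral_bigBlock (hA : ClusterArray μ r l s ρ τ α κ p M) (a b c : ℝ) (n q : ℕ) :
    ∫ x, bigBlock (μ n) a b c (r n) q x ∂(μ n) = 0 := by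
  have := hA.prob n
  have h1 : ∫ x, disjointSum (μ n) (r n) q x ∂(μ n) = 0 := by
    unfold disjointSum
    rw [integral_sum_cyl _ fun i => by fun_prop]
    simp [(hA.law n).integral_win]
  have h2 : ∫ x, slidingSum (μ n) (r n) q x ∂(μ n) = 0 := by
    unfold slidingSum
    rw [integral_div, integral_sum_cyl _ fun i => by fun_prop]
    simp [(hA.law n).integral_win]
  unfold bigBlock
  rw [integral_add_cyl (by fun_prop) (by fun_prop), integral_add_cyl (by fun_prop) (by fun_prop),
    integral_const_mul, integral_const_mul, integral_const_mul, h1, h2, (hA.law n).integral_dev]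
  simp

theorem integral_smallBlock (hA : ClusterArray μ r l s ρ τ α κ p M) (a b c : ℝ) (n : ℕ) :
    ∫ x, smallBlock (μ n) a b c (r n) x ∂(μ n) = 0 := by
  have := hA.prob n
  have h := (hA.law n).integral_dev 0 (r n)
  have h' := hA.integral_bigBlock a b c n 2
  have e : ∀ x, bigBlock (μ n) a b c (r n) 2 x = smallBlock (μ n) a b c (r n) x
      + (c * dev (μ n) 0 (r n) x + c * dev (μ n) (2 * r n) (3 * r n) x) := fun x => by
    unfold bigBlock smallBlock
    rw [← dev_add_dev (μ n) (Nat.zero_le (2 * r n)) (show 2 * r n ≤ (2 + 1) * r n by omega),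
      ← dev_add_dev (μ n) (Nat.zero_le (r n)) (show r n ≤ 2 * r n by omega)]
    ring
  simp_rw [e] at h'
  rw [integral_add_cyl (by fun_prop) (by fun_prop), integral_add_cyl (by fun_prop) (by fun_prop),
    integral_const_mul, integral_const_mul, h, (hA.law n).integral_dev] at h'
  simpa using h'

/-- The variance of a big block is `q` times the limit variance up to boundary effects. -/
theorem eventually_abs_integral_bigBlock_sq_sub_le (hA : ClusterArray μ r l s ρ τ α κ p M)
    (a b c : ℝ) : ∃ C, 0 ≤ C ∧ ∀ q : ℕ, ∀ᶠ n in atTop,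
      |∫ x, bigBlock (μ n) a b c (r n) q x ^ 2 ∂(μ n) - q * limitVariance τ α κ a b c| ≤ C := by
  refine ⟨a ^ 2 * 1 + b ^ 2 * 6 + c ^ 2 * (1 + |κ|) + |2 * a * b| * 6 + |2 * a * c| * 1
    + |2 * b * c| * 1, by positivity, fun q => ?_⟩
  have hN := (tendsto_iff_norm_sub_tendsto_zero.1
    (hA.tendsto_integral_dev_sq (q + 1))).eventually_le_const one_pos
  filter_upwards [hA.eventually_abs_integral_disjointSum_sq_sub_le q one_pos,
    hA.eventually_abs_integral_slidingSum_sq_sub_le q, hN,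
    hA.eventually_abs_integral_disjointSum_mul_slidingSum_sub_le q,
    hA.eventually_abs_integral_disjointSum_mul_dev_add_le q,
    hA.eventually_abs_integral_slidingSum_mul_dev_add_le q] with n h1 h2 h3 h4 h5 h6
  have := hA.prob n
  rw [Real.norm_eq_abs] at h3
  have e : ∀ x, bigBlock (μ n) a b c (r n) q x ^ 2
      = a ^ 2 * disjointSum (μ n) (r n) q x ^ 2 + b ^ 2 * slidingSum (μ n) (r n) q x ^ 2
        + c ^ 2 * dev (μ n) 0 ((q + 1) * r n) x ^ 2
        + 2 * a * b * (disjointSum (μ n) (r n) q x * slidingSum (μ n) (r n) q x)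
        + 2 * a * c * (disjointSum (μ n) (r n) q x * dev (μ n) 0 ((q + 1) * r n) x)
        + 2 * b * c * (slidingSum (μ n) (r n) q x * dev (μ n) 0 ((q + 1) * r n) x) := fun x => by
    unfold bigBlock
    ring
  simp_rw [e]
  rw [integral_add_cyl (by fun_prop) (by fun_prop), integral_add_cyl (by fun_prop) (by fun_prop),
    integral_add_cyl (by fun_prop) (by fun_prop), integral_add_cyl (by fun_prop) (by fun_prop),
    integral_add_cyl (by fun_prop) (by fun_prop)]
  simp only [integral_const_mul]
  set I1 := ∫ x, disjointSum (μ n) (r n) q x ^ 2 ∂(μ n)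
  set I2 := ∫ x, slidingSum (μ n) (r n) q x ^ 2 ∂(μ n)
  set I3 := ∫ x, dev (μ n) 0 ((q + 1) * r n) x ^ 2 ∂(μ n)
  set I4 := ∫ x, disjointSum (μ n) (r n) q x * slidingSum (μ n) (r n) q x ∂(μ n)
  set I5 := ∫ x, disjointSum (μ n) (r n) q x * dev (μ n) 0 ((q + 1) * r n) x ∂(μ n)
  set I6 := ∫ x, slidingSum (μ n) (r n) q x * dev (μ n) 0 ((q + 1) * r n) x ∂(μ n)
  have h3' : |I3 - q * κ| ≤ 1 + |κ| := by
    have : I3 - q * κ = (I3 - (q + 1 : ℕ) * κ) + κ := by push_cast; ring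
    rw [this]
    exact (abs_add_le _ _).trans (add_le_add_left h3 _)
  have e2 : a ^ 2 * I1 + b ^ 2 * I2 + c ^ 2 * I3 + 2 * a * b * I4 + 2 * a * c * I5 + 2 * b * c * I6
      - q * limitVariance τ α κ a b c
      = a ^ 2 * (I1 - q * windowCov α 0) + b ^ 2 * (I2 - q * (2 * windowCovIntegral α))
        + c ^ 2 * (I3 - q * κ) + 2 * a * b * (I4 - q * (2 * windowCovIntegral α))
        + 2 * a * c * (I5 + q * (τ * Real.exp (-α)))
        + 2 * b * c * (I6 + q * (τ * Real.exp (-α))) := by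
    unfold limitVariance
    ring
  rw [e2]
  have hmul : ∀ {u v w : ℝ}, |v| ≤ w → |u * v| ≤ |u| * w := fun h => by
    rw [abs_mul]
    exact mul_le_mul_of_nonneg_left h (abs_nonneg _)
  have hsq : ∀ {u v w : ℝ}, |v| ≤ w → |u ^ 2 * v| ≤ u ^ 2 * w := fun {u} {v} {w} h => by
    rw [abs_mul, abs_of_nonneg (sq_nonneg u)]
    exact mul_le_mul_of_nonneg_left h (sq_nonneg u)
  refine (abs_add_le _ _).trans (add_le_add ((abs_add_le _ _).trans (add_le_add
    ((abs_add_le _ _).trans (add_le_add ((abs_add_le _ _).trans (add_le_add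
    ((abs_add_le _ _).trans (add_le_add (hsq h1) (hsq h2))) (hsq h3'))) (hmul h4)))
    (hmul h5))) (hmul h6))

/-- Up to a bounded error, `q` times the limit variance is a second moment, for every `q`. -/
theorem limitVariance_nonneg (hA : ClusterArray μ r l s ρ τ α κ p M) (a b c : ℝ) :
    0 ≤ limitVariance τ α κ a b c := by
  obtain ⟨C, hC, h⟩ := hA.eventually_abs_integral_bigBlock_sq_sub_le a b c
  by_contra! hneg
  obtain ⟨q, hq⟩ := exists_nat_gt (C / -limitVariance τ α κ a b c)
  obtain ⟨n, hn⟩ := (h q).exists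
  rw [div_lt_iff₀ (by linarith)] at hq
  have h1 := (abs_le.1 hn).2
  have h2 : 0 ≤ ∫ x, bigBlock (μ n) a b c (r n) q x ^ 2 ∂(μ n) := integral_nonneg fun x => sq_nonneg _
  linarith

theorem eventually_integral_smallBlock_sq_le (hA : ClusterArray μ r l s ρ τ α κ p M)
    (a b c : ℝ) : ∃ C, 0 ≤ C ∧ ∀ᶠ n in atTop,
      ∫ x, smallBlock (μ n) a b c (r n) x ^ 2 ∂(μ n) ≤ C := by
  set K := 1 + ((1 : ℕ) : ℝ) ^ (2 * p - 1) * ((1 : ℕ) * M)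
  refine ⟨2 * ((|a| + |b|) * (2 : ℕ)) ^ 2 + 2 * c ^ 2 * |K|, by positivity, ?_⟩
  filter_upwards [hA.eventually_integral_dev_sq_le 1] with n hn
  have := hA.prob n
  refine (integral_sq_le_of_abs_le (by fun_prop) (cylindrical_dev (μ n) (r n) (2 * r n)) fun x =>
    abs_blockCombination_le a b c (hA.r_pos n) 2 (r n) (2 * r n) x).trans ?_
  have := hn (r n) (2 * r n) (by omega) (by omega)
  gcongr
  exact this.trans (le_abs_self _)

/-- A remainder of at most `L` blocks has a bounded second moment. -/
theorem eventually_integral_remainder_sq_le (hA : ClusterArray μ r l s ρ τ α κ p M)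
    (a b c : ℝ) (L : ℕ) : ∃ C, 0 ≤ C ∧ ∀ᶠ n in atTop, ∀ q, q < n / r n → n / r n ≤ q + L →
      ∫ x, (sampleSum (μ n) a b c (r n) n x - blockSum (μ n) a b c (r n) q x) ^ 2 ∂(μ n) ≤ C := by
  set K := 1 + (L : ℝ) ^ (2 * p - 1) * (L * M)
  refine ⟨2 * ((|a| + |b|) * L) ^ 2 + 2 * c ^ 2 * |K|, by positivity, ?_⟩
  filter_upwards [hA.eventually_integral_dev_sq_le L] with n hn q hq hL
  have := hA.prob n
  refine (integral_sq_le_of_abs_le (by fun_prop)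
    (cylindrical_dev (μ n) (q * r n) (n / r n * r n)) fun x =>
    abs_sampleSum_sub_blockSum_le a b c (hA.r_pos n) hq hL x).trans ?_
  have := hn (q * r n) (n / r n * r n) (Nat.mul_le_mul_right _ hq.le) (by
    rw [← add_mul]
    exact Nat.mul_le_mul_right _ hL)
  gcongr
  exact this.trans (le_abs_self _)

theorem add_rpow_le_of_nonneg {x y q : ℝ} (hx : 0 ≤ x) (hy : 0 ≤ y) (hq : 0 ≤ q) :
    (x + y) ^ q ≤ 2 ^ q * (x ^ q + y ^ q) := by
  have h1 : (x + y) ^ q ≤ (2 * max x y) ^ q :=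
    Real.rpow_le_rpow (by positivity) (by linarith [le_max_left x y, le_max_right x y]) hq
  rw [Real.mul_rpow zero_le_two (le_max_of_le_left hx)] at h1
  refine h1.trans (mul_le_mul_of_nonneg_left ?_ (by positivity))
  have h2 : 0 ≤ x ^ q := by positivity
  have h3 : 0 ≤ y ^ q := by positivity
  rcases max_cases x y with ⟨h, _⟩ | ⟨h, _⟩ <;> rw [h] <;> linarith

theorem eventually_integral_bigBlock_rpow_le (hA : ClusterArray μ r l s ρ τ α κ p M)
    (a b c : ℝ) (q : ℕ) : ∃ C, 0 ≤ C ∧ ∀ᶠ n in atTop,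
      ∫ x, |bigBlock (μ n) a b c (r n) q x| ^ (2 * p) ∂(μ n) ≤ C := by
  have hp := hA.one_lt_p
  set A := (|a| + |b|) * q + |c| * ((q + 1) * (|τ| + 1)) with hAdef
  set B := ((q + 1 : ℕ) : ℝ) ^ (2 * p - 1) * ((q + 1 : ℕ) * M)
  have hA0 : 0 ≤ A := by positivity
  refine ⟨2 ^ (2 * p) * (A ^ (2 * p) + |c| ^ (2 * p) * |B|), by positivity, ?_⟩
  have hrate := hA.tendsto_rate.eventually_le_const (show τ < |τ| + 1 by linarith [le_abs_self τ])
  filter_upwards [hA.eventually_integral_cnt_rpow_le (q + 1), hrate] with n hn hr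
  have := hA.prob n
  have hpt : ∀ x, |bigBlock (μ n) a b c (r n) q x| ^ (2 * p)
      ≤ 2 ^ (2 * p) * (A ^ (2 * p) + |c| ^ (2 * p) * cnt 0 ((q + 1) * r n) x ^ (2 * p)) := by
    intro x
    have hc := cnt_nonneg 0 ((q + 1) * r n) x
    have h1 : |bigBlock (μ n) a b c (r n) q x| ≤ A + |c| * cnt 0 ((q + 1) * r n) x := by
      refine (abs_blockCombination_le a b c (hA.r_pos n) q 0 ((q + 1) * r n) x).trans ?_
      have h2 : |dev (μ n) 0 ((q + 1) * r n) x|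
          ≤ (q + 1) * (|τ| + 1) + cnt 0 ((q + 1) * r n) x := by
        have h3 : 0 ≤ ((q + 1) * r n - 0 : ℕ) * rate (μ n) :=
          mul_nonneg (Nat.cast_nonneg _) rate_nonneg
        have h4 : ((q + 1) * r n - 0 : ℕ) * rate (μ n) ≤ (q + 1) * (|τ| + 1) := by
          rw [Nat.sub_zero]
          push_cast
          rw [mul_assoc]
          gcongr
        unfold dev
        rw [abs_le]
        constructor <;> linarith
      rw [hAdef, add_assoc, ← mul_add]
      gcongr
    rw [← Real.mul_rpow (abs_nonneg c) hc]
    exact (Real.rpow_le_rpow (abs_nonneg _) h1 (by linarith)).trans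
      (add_rpow_le_of_nonneg hA0 (by positivity) (by linarith))
  refine (integral_mono_cyl (by fun_prop) (by fun_prop) hpt).trans ?_
  rw [integral_const_mul, integral_add_cyl (by fun_prop) (by fun_prop), integral_const_mul]
  simp only [integral_const, probReal_univ, one_smul]
  gcongr
  exact hn.trans (le_abs_self _)

end ClusterArray

/-! ### The central limit theorem for the three statistics -/

namespace ClusterArray

variable {μ : ℕ → Measure (ℕ → Bool)} {r l s : ℕ → ℕ} {ρ : ℕ → ℝ} {τ α κ p M : ℝ}

/-- The number of groups of `q + 2` blocks, leaving at least one block to the right of them. -/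
theorem groups_bounds {K q : ℕ} (hK : 0 < K) :
    (K - 1) / (q + 2) * (q + 2) < K ∧ K ≤ (K - 1) / (q + 2) * (q + 2) + (q + 2) := by
  have h1 := Nat.div_mul_le_self (K - 1) (q + 2)
  have h2 := Nat.lt_div_mul_add (a := K - 1) (show 0 < q + 2 by omega)
  omega

section Groups

variable (a b c : ℝ) (q : ℕ)

@[fun_prop]
theorem cylindrical_sum_bigBlock (μ : Measure (ℕ → Bool)) (k m : ℕ) :
    Cylindrical fun x => ∑ j ∈ Finset.range m, bigBlock μ a b c k q (shift (j * ((q + 2) * k)) x) :=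
  Cylindrical.sum _ fun _ => (cylindrical_bigBlock μ a b c k q).shift _

@[fun_prop]
theorem cylindrical_sum_smallBlock (μ : Measure (ℕ → Bool)) (k m : ℕ) :
    Cylindrical fun x => ∑ j ∈ Finset.range m,
      smallBlock μ a b c k (shift (q * k + j * ((q + 2) * k)) x) :=
  Cylindrical.sum _ fun _ => (cylindrical_smallBlock μ a b c k).shift _

/-- Consecutive small blocks are at least `r ≥ l` places apart, so that they are nearly
uncorrelated. -/
theorem eventually_integral_sum_smallBlock_sq_le (hA : ClusterArray μ r l s ρ τ α κ p M)
    (hq : 2 ≤ q) : ∀ᶠ n in atTop, ∀ m, m * (q + 2) < n / r n →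
      ∫ x, (∑ j ∈ Finset.range m,
        smallBlock (μ n) a b c (r n) (shift (q * r n + j * ((q + 2) * r n)) x)) ^ 2 ∂(μ n)
      ≤ (m + (m : ℝ) ^ 2 * ρ n) * ∫ x, smallBlock (μ n) a b c (r n) x ^ 2 ∂(μ n) := by
  filter_upwards [hA.eventually_l_le_r] with n hl m hm
  have := hA.prob n
  have hμ := hA.law n
  have hK : (m * (q + 2) + 1) * r n ≤ n :=
    (Nat.mul_le_mul_right _ hm).trans (Nat.div_mul_le_self n (r n))
  have hq' : 2 * r n ≤ q * r n := Nat.mul_le_mul_right _ hq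
  rw [add_mul, one_mul, mul_assoc] at hK
  have e1 : (q + 2) * r n = q * r n + 2 * r n := add_mul _ _ _
  have h := hμ.integral_sum_shift_sq_le (D := (q + 2) * r n) m
    (dependsOn_shift (dependsOn_smallBlock (μ n) a b c (r n)) (q * r n)) (by omega) (by omega)
    (by rw [hμ.integral_shift (by fun_prop)]; exact hA.integral_smallBlock a b c n)
  simp_rw [shift_shift] at h
  rwa [hμ.integral_shift (f := fun x => smallBlock (μ n) a b c (r n) x ^ 2) (by fun_prop)] at h

theorem eventually_integral_sum_bigBlock_sq_le (hA : ClusterArray μ r l s ρ τ α κ p M) :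
    ∀ᶠ n in atTop, ∀ m, m * (q + 2) < n / r n →
      ∫ x, (∑ j ∈ Finset.range m,
        bigBlock (μ n) a b c (r n) q (shift (j * ((q + 2) * r n)) x)) ^ 2 ∂(μ n)
      ≤ (m + (m : ℝ) ^ 2 * ρ n) * ∫ x, bigBlock (μ n) a b c (r n) q x ^ 2 ∂(μ n) := by
  filter_upwards [hA.eventually_l_le_r] with n hl m hm
  have := hA.prob n
  have hK : (m * (q + 2) + 1) * r n ≤ n :=
    (Nat.mul_le_mul_right _ hm).trans (Nat.div_mul_le_self n (r n))
  rw [add_mul, one_mul, mul_assoc] at hK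
  have e1 : (q + 2) * r n = q * r n + 2 * r n := add_mul _ _ _
  have e2 : (q + 1) * r n = q * r n + r n := by rw [add_mul, one_mul]
  exact (hA.law n).integral_sum_shift_sq_le m (dependsOn_bigBlock (μ n) a b c (r n) q) (by omega)
    (by omega) (hA.integral_bigBlock a b c n q)

/-- The part of the sample outside the big blocks is negligible when `q` is large. -/
theorem eventually_integral_sampleSum_sub_sq_le (hA : ClusterArray μ r l s ρ τ α κ p M) :
    ∃ C, 0 ≤ C ∧ ∀ q : ℕ, 2 ≤ q → ∀ᶠ n in atTop,
      ∫ x, (sampleSum (μ n) a b c (r n) n x - ∑ j ∈ Finset.range ((n / r n - 1) / (q + 2)),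
        bigBlock (μ n) a b c (r n) q (shift (j * ((q + 2) * r n)) x)) ^ 2 ∂(μ n)
      ≤ C / (q + 2) * (n / r n : ℕ) := by
  obtain ⟨C₁, hC₁, h₁⟩ := hA.eventually_integral_smallBlock_sq_le a b c
  refine ⟨4 * C₁ + 1, by positivity, fun q hq => ?_⟩
  obtain ⟨C₂, hC₂, h₂⟩ := hA.eventually_integral_remainder_sq_le a b c (q + 2)
  filter_upwards [h₁, h₂, hA.eventually_integral_sum_smallBlock_sq_le a b c q hq,
    hA.tendsto_blocks.eventually_ge_atTop (2 * C₂ * (q + 2)),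
    hA.tendsto_blocks.eventually_gt_atTop 0,
    hA.tendsto_blocks_mul_rho.eventually_le_const one_pos] with n h1 h2 h3 hK hK0 hρ
  have := hA.prob n
  set K := n / r n
  obtain ⟨hm, hm'⟩ := groups_bounds (q := q) (Nat.cast_pos.1 hK0)
  set m := (K - 1) / (q + 2)
  have e : ∀ x, sampleSum (μ n) a b c (r n) n x - ∑ j ∈ Finset.range m,
        bigBlock (μ n) a b c (r n) q (shift (j * ((q + 2) * r n)) x)
      = ∑ j ∈ Finset.range m,
          smallBlock (μ n) a b c (r n) (shift (q * r n + j * ((q + 2) * r n)) x)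
        + (sampleSum (μ n) a b c (r n) n x - blockSum (μ n) a b c (r n) (m * (q + 2)) x) :=
    fun x => by rw [blockSum_mul]; ring
  simp_rw [e]
  refine (integral_add_sq_le (by fun_prop) (by fun_prop)).trans ?_
  have h4 := h2 _ hm hm'
  have h5 := h3 m hm
  have hmK : (m : ℝ) * (q + 2) ≤ K := by exact_mod_cast hm.le
  have hρ0 := hA.rho_nonneg n
  have hmρ : (m : ℝ) * ρ n ≤ 1 := by
    refine le_trans ?_ hρ
    gcongr
    nlinarith [Nat.cast_nonneg (α := ℝ) m, Nat.cast_nonneg (α := ℝ) q]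
  have h6 : (m + (m : ℝ) ^ 2 * ρ n) * ∫ x, smallBlock (μ n) a b c (r n) x ^ 2 ∂(μ n)
      ≤ 2 * m * C₁ := by
    have : (m : ℝ) ^ 2 * ρ n ≤ m := by nlinarith [Nat.cast_nonneg (α := ℝ) m]
    have hv : 0 ≤ ∫ x, smallBlock (μ n) a b c (r n) x ^ 2 ∂(μ n) :=
      integral_nonneg fun x => sq_nonneg _
    have : (m : ℝ) + (m : ℝ) ^ 2 * ρ n ≤ 2 * m := by linarith
    gcongr
  rw [div_mul_eq_mul_div, le_div_iff₀ (by positivity)]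
  nlinarith [mul_le_mul_of_nonneg_right hmK hC₁]

/-- The second moment of the sample statistic is of the order of the number of blocks. -/
theorem eventually_integral_sampleSum_sq_le (hA : ClusterArray μ r l s ρ τ α κ p M) :
    ∃ C, ∀ᶠ n in atTop,
      ∫ x, sampleSum (μ n) a b c (r n) n x ^ 2 ∂(μ n) ≤ C * (n / r n : ℕ) := by
  obtain ⟨C₁, hC₁, h₁⟩ := hA.eventually_integral_sampleSum_sub_sq_le a b c
  obtain ⟨C₂, hC₂, h₂⟩ := hA.eventually_abs_integral_bigBlock_sq_sub_le a b c
  have hσ := hA.limitVariance_nonneg a b c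
  set σ := limitVariance τ α κ a b c
  -- any fixed group size will do
  obtain ⟨q, hq⟩ : ∃ q : ℕ, 2 ≤ q := ⟨2, le_rfl⟩
  refine ⟨4 * (C₂ + q * σ) + 2 * C₁, ?_⟩
  filter_upwards [h₁ q hq, h₂ q, hA.eventually_integral_sum_bigBlock_sq_le a b c q,
    hA.tendsto_blocks.eventually_gt_atTop 0,
    hA.tendsto_blocks_mul_rho.eventually_le_const one_pos] with n h1 h2 h3 hK0 hρ
  have := hA.prob n
  set K := n / r n
  obtain ⟨hm, hm'⟩ := groups_bounds (q := q) (Nat.cast_pos.1 hK0)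
  set m := (K - 1) / (q + 2)
  have key := integral_add_sq_le (μ := μ n) (cylindrical_sum_bigBlock a b c q (μ n) (r n) m)
    ((cylindrical_sampleSum (μ n) a b c (r n) n).sub
      (cylindrical_sum_bigBlock a b c q (μ n) (r n) m))
  simp only [add_sub_cancel] at key
  refine key.trans ?_
  have h5 := h3 m hm
  have hmK : (m : ℝ) ≤ K := by exact_mod_cast (show m ≤ K from (Nat.le_mul_of_pos_right m (by omega)).trans hm.le)
  have hρ0 := hA.rho_nonneg n
  have hmρ : (m : ℝ) * ρ n ≤ 1 := le_trans (by gcongr) hρ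
  have h6 : (m + (m : ℝ) ^ 2 * ρ n) * ∫ x, bigBlock (μ n) a b c (r n) q x ^ 2 ∂(μ n)
      ≤ 2 * K * (C₂ + q * σ) := by
    have : (m : ℝ) ^ 2 * ρ n ≤ m := by nlinarith [Nat.cast_nonneg (α := ℝ) m]
    have hv : 0 ≤ ∫ x, bigBlock (μ n) a b c (r n) q x ^ 2 ∂(μ n) :=
      integral_nonneg fun x => sq_nonneg _
    have h7 : ∫ x, bigBlock (μ n) a b c (r n) q x ^ 2 ∂(μ n) ≤ C₂ + q * σ := by
      linarith [(abs_le.1 h2).2]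
    have : (m : ℝ) + (m : ℝ) ^ 2 * ρ n ≤ 2 * K := by linarith
    gcongr
  have h8 : C₁ / ((q : ℝ) + 2) * K ≤ C₁ * K := by
    gcongr
    exact div_le_self hC₁ (by linarith [Nat.cast_nonneg (α := ℝ) q])
  linarith

end Groups

/-- If a group of `q + 2` out of `K` blocks has variance about `q σ`, then the `m` groups that fit
have total variance about `K σ`. -/
theorem abs_groups_mul_sub_le {m K : ℕ} {q : ℕ} {v σ C : ℝ} (hK0 : (0 : ℝ) < K) (hσ : 0 ≤ σ)
    (hC : 0 ≤ C) (hv : |v - q * σ| ≤ C) (hm1 : (m : ℝ) * (q + 2) ≤ K)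
    (hm2 : (K : ℝ) ≤ m * (q + 2) + (q + 2)) (hK : ((q : ℝ) + 2) * (q + 2) ≤ K) :
    |m * (v / K) - σ| ≤ (C + 3 * σ) / (q + 2) := by
  have e : (m : ℝ) * (v / K) - σ
      = (m * (v - q * σ) + (m * (q + 2) - K) * σ - 2 * m * σ) / K := by
    field_simp
    ring
  have hm0 : (0 : ℝ) ≤ m := Nat.cast_nonneg _
  have hb : |m * (v - q * σ) + (m * (q + 2) - K) * σ - 2 * m * σ|
      ≤ m * C + (q + 2) * σ + 2 * m * σ := by
    have h4 : |(m : ℝ) * (v - q * σ)| ≤ m * C := by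
      rw [abs_mul, abs_of_nonneg hm0]
      gcongr
    have h5 := abs_le.1 h4
    have h6 : 0 ≤ (m : ℝ) * σ := mul_nonneg hm0 hσ
    have h7 : -((q + 2) * σ) ≤ (m * (q + 2) - K) * σ := by
      rw [← neg_mul]
      exact mul_le_mul_of_nonneg_right (by linarith) hσ
    have h8 : (m * (q + 2) - K) * σ ≤ 0 := mul_nonpos_of_nonpos_of_nonneg (by linarith) hσ
    have h9 : 0 ≤ ((q : ℝ) + 2) * σ := by positivity
    rw [abs_le]
    constructor <;> linarith
  rw [e, abs_div, abs_of_pos hK0, div_le_div_iff₀ hK0 (by positivity)]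
  calc _ ≤ (m * C + (q + 2) * σ + 2 * m * σ) * (q + 2) := by gcongr
    _ = m * (q + 2) * (C + 2 * σ) + (q + 2) * (q + 2) * σ := by ring
    _ ≤ K * (C + 2 * σ) + K * σ := by gcongr
    _ = (C + 3 * σ) * K := by ring

theorem tendsto_norm_zero_of_forall_bound {f : ℕ → ℝ} (h0 : ∀ n, 0 ≤ f n) {g : ℕ → ℝ}
    (hg : Tendsto g atTop (𝓝 0)) (h : ∀ q : ℕ, 2 ≤ q → ∀ᶠ n in atTop, f n ≤ g q) :
    Tendsto f atTop (𝓝 0) := by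
  rw [Metric.tendsto_nhds]
  intro ε hε
  obtain ⟨q, hq, hq2⟩ := ((hg.eventually_lt_const hε).and (eventually_ge_atTop 2)).exists
  filter_upwards [h q hq2] with n hn
  rw [dist_zero_right, Real.norm_eq_abs, abs_of_nonneg (h0 n)]
  exact hn.trans_lt hq

/-- The central limit theorem for linear combinations of the three statistics, in terms of
characteristic functions. -/
theorem tendsto_integral_exp_sampleSum (hA : ClusterArray μ r l s ρ τ α κ p M) (a b c : ℝ) :
    Tendsto (fun n => ∫ x, Complex.exp
        ((sampleSum (μ n) a b c (r n) n x / √(n / r n : ℕ) : ℝ) * Complex.I) ∂(μ n)) atTop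
      (𝓝 (Real.exp (-(limitVariance τ α κ a b c / 2)) : ℝ)) := by
  obtain ⟨C₁, hC₁, h₁⟩ := hA.eventually_integral_sampleSum_sub_sq_le a b c
  obtain ⟨C₂, hC₂, h₂⟩ := hA.eventually_abs_integral_bigBlock_sq_sub_le a b c
  have hσ := hA.limitVariance_nonneg a b c
  set σ := limitVariance τ α κ a b c
  rw [tendsto_iff_norm_sub_tendsto_zero]
  have hlim : Tendsto (fun q : ℕ => √(C₁ / (q + 2)) + (1 / (q + 2) + (C₂ + 3 * σ) / (q + 2) / 2))
      atTop (𝓝 0) := by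
    have hq : Tendsto (fun q : ℕ => (q : ℝ) + 2) atTop atTop :=
      tendsto_atTop_add_const_right _ _ tendsto_natCast_atTop_atTop
    have hd : ∀ y : ℝ, Tendsto (fun q : ℕ => y / ((q : ℝ) + 2)) atTop (𝓝 0) := fun y =>
      tendsto_const_nhds.div_atTop hq
    have h1 := (Real.continuous_sqrt.tendsto 0).comp (hd C₁)
    simpa [Function.comp_def] using h1.add ((hd 1).add ((hd (C₂ + 3 * σ)).div_const 2))
  refine tendsto_norm_zero_of_forall_bound (fun n => norm_nonneg _) hlim fun q hq => ?_
  obtain ⟨C₃, hC₃, h₃⟩ := hA.eventually_integral_bigBlock_rpow_le a b c q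
  have hp := hA.one_lt_p
  -- the errors of the factorization and of the Taylor expansion vanish
  have herr : Tendsto (fun n => 4 * ((n / r n : ℕ) * ρ n)
      + (4 * C₃ * ((n / r n : ℕ) : ℝ) ^ (-(p - 1))
        + ((C₂ + q * σ) / 2) ^ 2 / (n / r n : ℕ))) atTop (𝓝 0) := by
    have h1 := hA.tendsto_blocks_mul_rho.const_mul 4
    have h2 := ((tendsto_rpow_neg_atTop (sub_pos.2 hp)).comp hA.tendsto_blocks).const_mul (4 * C₃)
    have h3 := (tendsto_const_nhds (x := ((C₂ + q * σ) / 2) ^ 2)).div_atTop hA.tendsto_blocks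
    simpa [Function.comp_def] using h1.add (h2.add h3)
  filter_upwards [h₁ q hq, h₂ q, h₃, hA.tendsto_blocks.eventually_gt_atTop 0,
    hA.tendsto_blocks.eventually_ge_atTop (((q : ℝ) + 2) * (q + 2)),
    herr.eventually_le_const (show (0 : ℝ) < 1 / (q + 2) by positivity), hA.eventually_l_le_r]
    with n h1 h2 h3 hK0 hKL herr' hl
  have := hA.prob n
  have hμ := hA.law n
  have hρ := hA.rho_nonneg n
  set K := n / r n
  obtain ⟨hm, hm'⟩ := groups_bounds (q := q) (Nat.cast_pos.1 hK0)
  set m := (K - 1) / (q + 2)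
  have hKn : (m * (q + 2) + 1) * r n ≤ n :=
    (Nat.mul_le_mul_right _ hm).trans (Nat.div_mul_le_self n (r n))
  have hmK : (m : ℝ) ≤ K := by
    exact_mod_cast (show m ≤ K from (Nat.le_mul_of_pos_right m (by omega)).trans hm.le)
  have hsK : 0 < √(K : ℝ) := Real.sqrt_pos.2 hK0
  have hsK2 : √(K : ℝ) ^ 2 = K := Real.sq_sqrt hK0.le
  set f : (ℕ → Bool) → ℝ := fun x => bigBlock (μ n) a b c (r n) q x / √K with hf
  have hfc : Cylindrical f := by
    simp only [hf]
    fun_prop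
  set v := ∫ x, bigBlock (μ n) a b c (r n) q x ^ 2 ∂(μ n) with hv
  have hv0 : 0 ≤ v := integral_nonneg fun x => sq_nonneg _
  have hvle : v ≤ C₂ + q * σ := by linarith [(abs_le.1 h2).2]
  have hf0 : ∫ x, f x ∂(μ n) = 0 := by
    simp only [hf]
    rw [integral_div, hA.integral_bigBlock, zero_div]
  have hf2 : ∫ x, f x ^ 2 ∂(μ n) = v / K := by
    simp only [hf, div_pow, hsK2]
    rw [integral_div]
  have hfp : ∫ x, |f x| ^ (2 * p) ∂(μ n) ≤ C₃ / (K : ℝ) ^ p := by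
    have e : ∀ x, |f x| ^ (2 * p) = |bigBlock (μ n) a b c (r n) q x| ^ (2 * p) / (K : ℝ) ^ p :=
      fun x => by
        simp only [hf]
        rw [abs_div, abs_of_pos hsK, Real.div_rpow (abs_nonneg _) hsK.le, Real.rpow_mul hsK.le,
          Real.rpow_two, hsK2]
    simp_rw [e]
    rw [integral_div]
    gcongr
  -- replacing the sample by the sum of the big blocks
  have hstep1 : ‖∫ x, Complex.exp ((sampleSum (μ n) a b c (r n) n x / √K : ℝ) * Complex.I) ∂(μ n)
      - ∫ x, Complex.exp ((∑ j ∈ Finset.range m, f (shift (j * ((q + 2) * r n)) x) : ℝ)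
        * Complex.I) ∂(μ n)‖ ≤ √(C₁ / (q + 2)) := by
    have hfs : Cylindrical fun x => ∑ j ∈ Finset.range m, f (shift (j * ((q + 2) * r n)) x) :=
      Cylindrical.sum _ fun j => hfc.shift _
    refine (norm_integral_exp_sub_integral_exp_le (by fun_prop) hfs).trans
      (Real.sqrt_le_sqrt ?_)
    have e : ∀ x, (sampleSum (μ n) a b c (r n) n x / √K
        - ∑ j ∈ Finset.range m, f (shift (j * ((q + 2) * r n)) x)) ^ 2
        = (sampleSum (μ n) a b c (r n) n x - ∑ j ∈ Finset.range m,
          bigBlock (μ n) a b c (r n) q (shift (j * ((q + 2) * r n)) x)) ^ 2 / K := fun x => by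
      simp only [hf]
      rw [← Finset.sum_div, ← sub_div, div_pow, hsK2]
    simp_rw [e]
    rw [integral_div, div_le_iff₀ hK0]
    exact h1
  -- the big blocks are nearly independent
  have hstep2 : ‖∫ x, Complex.exp ((∑ j ∈ Finset.range m, f (shift (j * ((q + 2) * r n)) x) : ℝ)
        * Complex.I) ∂(μ n) - (∫ x, Complex.exp (f x * Complex.I) ∂(μ n)) ^ m‖ ≤ m * (4 * ρ n) := by
    have e : ∀ x, Complex.exp ((∑ j ∈ Finset.range m, f (shift (j * ((q + 2) * r n)) x) : ℝ)
        * Complex.I) = ∏ j ∈ Finset.range m,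
          (fun x => Complex.exp (f x * Complex.I)) (shift (j * ((q + 2) * r n)) x) := fun x => by
      rw [← Complex.exp_sum, ← Finset.sum_mul, Complex.ofReal_sum]
    simp_rw [e]
    have e1 : (q + 2) * r n = q * r n + 2 * r n := add_mul _ _ _
    have e2 : (q + 1) * r n = q * r n + r n := by rw [add_mul, one_mul]
    rw [add_mul, one_mul, mul_assoc] at hKn
    refine hμ.norm_integral_prod_shift_sub_le (b := (q + 1) * r n) m (fun x y h => ?_) (by omega)
      (by omega) fun x => (Complex.norm_exp_ofReal_mul_I (f x)).le
    simp only [hf]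
    rw [dependsOn_bigBlock (μ n) a b c (r n) q h]
  -- the central limit theorem for independent blocks
  have hstep3 := norm_integral_exp_pow_sub_le hfc hf0 (q := 2 * p) (by linarith) hA.p_le m
  rw [hf2] at hstep3
  have hstep3' : (m : ℝ) * (4 * ∫ x, |f x| ^ (2 * p) ∂(μ n) + (v / K / 2) ^ 2)
      ≤ 4 * C₃ * (K : ℝ) ^ (-(p - 1)) + ((C₂ + q * σ) / 2) ^ 2 / K := by
    have e1 : 4 * C₃ * (K : ℝ) ^ (-(p - 1)) = K * (4 * (C₃ / (K : ℝ) ^ p)) := by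
      rw [neg_sub, Real.rpow_sub hK0, Real.rpow_one]
      ring
    have e2 : ((C₂ + q * σ) / 2) ^ 2 / K = K * ((C₂ + q * σ) / K / 2) ^ 2 := by
      field_simp
    rw [e1, e2, ← mul_add]
    gcongr
  have hstep4 : ‖((Real.exp (-(m * (v / K / 2))) : ℝ) : ℂ) - (Real.exp (-(σ / 2)) : ℝ)‖
      ≤ (C₂ + 3 * σ) / (q + 2) / 2 := by
    rw [← Complex.ofReal_sub, Complex.norm_real, Real.norm_eq_abs]
    refine (abs_exp_neg_sub_exp_neg_le (by positivity) (by positivity)).trans ?_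
    rw [mul_div_assoc', ← sub_div, abs_div, abs_two]
    refine div_le_div_of_nonneg_right ?_ zero_le_two
    exact abs_groups_mul_sub_le hK0 hσ hC₂ h2 (by exact_mod_cast hm.le) (by exact_mod_cast hm') hKL
  have hmρ : (m : ℝ) * (4 * ρ n) ≤ 4 * (K * ρ n) := by
    rw [mul_left_comm]
    gcongr
  refine (norm_sub_le_norm_sub_add_norm_sub _ (∫ x, Complex.exp ((∑ j ∈ Finset.range m,
    f (shift (j * ((q + 2) * r n)) x) : ℝ) * Complex.I) ∂(μ n)) _).trans (add_le_add hstep1 ?_)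
  refine (norm_sub_le_norm_sub_add_norm_sub _
    ((∫ x, Complex.exp (f x * Complex.I) ∂(μ n)) ^ m) _).trans ?_
  have h9 := (norm_sub_le_norm_sub_add_norm_sub ((∫ x, Complex.exp (f x * Complex.I) ∂(μ n)) ^ m)
    ((Real.exp (-(m * (v / K / 2))) : ℝ) : ℂ) ((Real.exp (-(σ / 2)) : ℝ) : ℂ))
  linarith

end ClusterArray

/-! ### The law of the exceedances of a threshold -/

section Correlation

theorem maxCorr_nonneg {Ω : Type*} [MeasurableSpace Ω] {P : Measure Ω} (X : ℕ → Ω → ℝ)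
    (n l : ℕ) (u : ℝ) : 0 ≤ maxCorr X P n l u := by
  refine Real.sSup_nonneg ?_
  rintro c ⟨t, _, _, ξ, η, _, _, _, _, _, _, rfl⟩
  exact abs_nonneg _

variable {Ω : Type*} [MeasurableSpace Ω] {P : Measure Ω} [IsProbabilityMeasure P]

/-- The Cauchy–Schwarz inequality for the covariance. -/
theorem abs_covariance_le_sqrt {ξ η : Ω → ℝ} (hξ : MemLp ξ 2 P) (hη : MemLp η 2 P) :
    |cov[ξ, η; P]| ≤ √Var[ξ; P] * √Var[η; P] := by
  rw [← Real.sqrt_mul (variance_nonneg _ _)]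
  refine Real.abs_le_sqrt ?_
  have key : ∀ t : ℝ, 0 ≤ Var[η; P] * (t * t) + 2 * cov[ξ, η; P] * t + Var[ξ; P] := fun t => by
    have h := variance_add hξ (hη.const_smul t)
    rw [variance_smul, covariance_smul_right] at h
    have := variance_nonneg (ξ + t • η) P
    rw [h] at this
    linarith
  have := discrim_le_zero key
  unfold discrim at this
  linarith

variable (X : ℕ → Ω → ℝ)

theorem abs_corr_le_one {ξ η : Ω → ℝ} (hξ : MemLp ξ 2 P) (hη : MemLp η 2 P) :
    |corr ξ η P| ≤ 1 := by
  rw [corr, abs_div, abs_of_nonneg (mul_nonneg (Real.sqrt_nonneg Var[ξ; P])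
    (Real.sqrt_nonneg Var[η; P]))]
  exact div_le_one_of_le₀ (abs_covariance_le_sqrt hξ hη) (by positivity)

/-- The defining inequality of the maximal correlation coefficient, including variables without
variance. -/
theorem abs_covariance_le_maxCorr {n l t : ℕ} {u : ℝ} (ht : 1 ≤ t) (htl : t + l ≤ n)
    {ξ η : Ω → ℝ} (hξm : Measurable[exceedanceField X 1 t u] ξ) (hξ : MemLp ξ 2 P)
    (hηm : Measurable[exceedanceField X (t + l) n u] η) (hη : MemLp η 2 P) :
    |cov[ξ, η; P]| ≤ maxCorr X P n l u * (√Var[ξ; P] * √Var[η; P]) := by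
  have hcs := abs_covariance_le_sqrt hξ hη
  rcases (variance_nonneg ξ P).eq_or_lt with h1 | h1
  · simpa [← h1] using hcs
  rcases (variance_nonneg η P).eq_or_lt with h2 | h2
  · simpa [← h2] using hcs
  have h3 : |corr ξ η P| ≤ maxCorr X P n l u := by
    refine le_csSup ⟨1, ?_⟩ ⟨t, ht, htl, ξ, η, hξm, hξ, h1, hηm, hη, h2, rfl⟩
    rintro c ⟨t, _, _, ξ, η, _, hξ, _, _, hη, _, rfl⟩
    exact abs_corr_le_one hξ hη
  have hpos : 0 < √Var[ξ; P] * √Var[η; P] := by positivity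
  rwa [corr, abs_div, abs_of_pos hpos, div_le_iff₀ hpos] at h3

end Correlation

section Exceedances

variable {Ω : Type*} {X : ℕ → Ω → ℝ}

/-- The binary sequence of exceedances of the level `u`. -/
noncomputable def exceed (X : ℕ → Ω → ℝ) (u : ℝ) (ω : Ω) : ℕ → Bool := fun i => decide (u < X i ω)

theorem ind_exceed (u : ℝ) (i : ℕ) (ω : Ω) :
    ind i (exceed X u ω) = Set.indicator {ω | u < X i ω} (fun _ => 1) ω := by
  simp [ind, exceed, Set.indicator_apply]

theorem cnt_exceed (m : ℕ) (u : ℝ) (ω : Ω) :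
    cnt 0 m (exceed X u ω) = exceedances X m u ω := by
  rw [cnt, exceedances, Nat.cast_sum, ← Finset.range_eq_Ico]
  refine Finset.sum_congr rfl fun i _ => ?_
  rw [ind_exceed]
  simp [Set.indicator_apply]

theorem blockMax_le_iff (a b : ℕ) (u : ℝ) (ω : Ω) :
    blockMax X a b ω ≤ (u : EReal) ↔ ∀ i ∈ Finset.Ico a b, X i ω ≤ u := by
  simp [blockMax]

theorem emp_exceed (a b : ℕ) (u : ℝ) (ω : Ω) : emp a b (exceed X u ω)
    = Set.indicator {ω | blockMax X a b ω ≤ (u : EReal)} (fun _ => 1) ω := by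
  classical
  rw [emp_eq_ite, Set.indicator_apply]
  refine if_congr ?_ rfl rfl
  rw [Set.mem_ofPred_eq, blockMax_le_iff]
  simp [exceed]

/-- A function of the exceedances at certain places is measurable with respect to the σ-field that
they generate. -/
theorem measurable_exceedanceField {a b a' b' : ℕ} {u : ℝ} (ha : a ≤ a' + 1) (hb : b' ≤ b)
    {f : (ℕ → Bool) → ℝ} (hf : DependsOn f (Set.Ico a' b')) :
    Measurable[exceedanceField X a b u] fun ω => f (exceed X u ω) := by
  have hfm : Measurable f := (Cylindrical.of_dependsOn hf fun i hi =>
    hi.2).measurable_and_bounded.1.measurable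
  have e : (fun ω => f (exceed X u ω))
      = fun ω => f fun i => if i ∈ Set.Ico a' b' then exceed X u ω i else false := by
    funext ω
    refine hf fun i hi => ?_
    rw [if_pos hi]
  rw [e]
  refine hfm.comp (@measurable_pi_lambda Ω ℕ (fun _ => Bool) (exceedanceField X a b u) _ _ ?_)
  intro i
  by_cases hi : i ∈ Set.Ico a' b'
  · simp only [hi, if_true]
    refine @measurable_to_bool Ω (exceedanceField X a b u) _ ?_
    have : (fun ω => exceed X u ω i) ⁻¹' {true} = {ω | X i ω ≤ u}ᶜ := by
      ext ω
      simp [exceed]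
    rw [this]
    refine MeasurableSet.compl (MeasurableSpace.measurableSet_generateFrom
      ⟨i, by have := hi.1; omega, by have := hi.2; omega, rfl⟩)
  · simp only [hi, if_false]
    exact @measurable_const _ _ _ (exceedanceField X a b u) _

variable [MeasurableSpace Ω] {P : Measure Ω}

theorem measurable_exceed (hX : ∀ i, Measurable (X i)) (u : ℝ) : Measurable (exceed X u) :=
  measurable_pi_lambda _ fun i =>
    measurable_to_bool (by
      have : (fun ω => exceed X u ω i) ⁻¹' {true} = {ω | u < X i ω} := by
        ext ω
        simp [exceed]
      rw [this]
      exact measurableSet_lt measurable_const (hX i))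

theorem measurableSet_blockMax_le (hX : ∀ i, Measurable (X i)) (a b : ℕ) (u : ℝ) :
    MeasurableSet {ω | blockMax X a b ω ≤ (u : EReal)} := by
  have : {ω | blockMax X a b ω ≤ (u : EReal)} = ⋂ i ∈ Finset.Ico a b, {ω | X i ω ≤ u} := by
    ext ω
    simp [blockMax_le_iff]
  rw [this]
  exact Finset.measurableSet_biInter _ fun i _ => measurableSet_le (hX i) measurable_const

theorem integral_map_exceed {E : Type*} [NormedAddCommGroup E] [NormedSpace ℝ E]
    (hX : ∀ i, Measurable (X i)) (u : ℝ) {f : (ℕ → Bool) → E} (hf : Cylindrical f) :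
    ∫ x, f x ∂(P.map (exceed X u)) = ∫ ω, f (exceed X u ω) ∂P :=
  integral_map (measurable_exceed hX u).aemeasurable
    hf.measurable_and_bounded.1.aestronglyMeasurable

theorem void_map_exceed (hX : ∀ i, Measurable (X i)) (u : ℝ) (m : ℕ) :
    void (P.map (exceed X u)) m = maxCdf X P m u := by
  rw [void, integral_map_exceed hX u (by fun_prop), maxCdf]
  simp_rw [emp_exceed]
  rw [integral_indicator_const _ (measurableSet_blockMax_le hX 0 m u)]
  simp

theorem rate_map_exceed [IsProbabilityMeasure P] (hX : ∀ i, Measurable (X i)) (u : ℝ) :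
    rate (P.map (exceed X u)) = tail X P u := by
  rw [rate, integral_map_exceed hX u (by fun_prop), tail]
  simp_rw [ind_exceed]
  rw [integral_indicator_const _ (measurableSet_lt measurable_const (hX 0)),
    ← probReal_compl_eq_one_sub (measurableSet_le (hX 0) measurable_const)]
  simp [Set.compl_ofPred]

theorem map_shift_map_exceed (hX : ∀ i, Measurable (X i)) (hstat : StrictlyStationary X P) (u : ℝ)
    (h : ℕ) : (P.map (exceed X u)).map (shift h) = P.map (exceed X u) := by
  rw [Measure.map_map (measurable_shift h) (measurable_exceed hX u)]
  have hg : Measurable fun (x : ℕ → ℝ) (i : ℕ) => (decide (u < x i) : Bool) :=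
    measurable_exceed (X := fun i (x : ℕ → ℝ) => x i) (fun i => measurable_pi_apply i) u
  exact ((hstat h).comp hg).map_eq

/-- The exceedances of a level by a stationary sequence satisfy the mixing condition. -/
theorem mixingLaw_exceed [IsProbabilityMeasure P] (hX : ∀ i, Measurable (X i))
    (hstat : StrictlyStationary X P) (u : ℝ) (n l : ℕ) :
    MixingLaw (P.map (exceed X u)) n l (maxCorr X P n l u) where
  map_shift := map_shift_map_exceed hX hstat u
  nonneg := maxCorr_nonneg X n l u
  mixing t f g hf hg := by
    have : IsProbabilityMeasure (P.map (exceed X u)) :=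
      Measure.isProbabilityMeasure_map (measurable_exceed hX u).aemeasurable
    have hρ := maxCorr_nonneg (P := P) X n l u
    have hR : 0 ≤ maxCorr X P n l u * (√(∫ x, f x ^ 2 ∂(P.map (exceed X u)))
        * √(∫ x, g x ^ 2 ∂(P.map (exceed X u)))) := by positivity
    rcases Nat.eq_zero_or_pos t with ht | ht
    · -- `f` is constant
      have hc : ∀ x, f x = f (fun _ => false) := fun x => hf fun i hi => by
        simp [ht] at hi
      rw [show f = fun _ => f (fun _ => false) from funext hc] at hR ⊢
      simpa [integral_const_mul] using hR
    rcases lt_or_ge n (t + l) with hn | hn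
    · -- `g` is constant
      have hc : ∀ x, g x = g (fun _ => false) := fun x => hg fun i hi => by
        have := hi.1.trans_lt hi.2
        omega
      rw [show g = fun _ => g (fun _ => false) from funext hc] at hR ⊢
      simpa [integral_mul_const] using hR
    have hfc : Cylindrical f := ⟨t, hf⟩
    have hgc : Cylindrical g := .of_dependsOn hg fun i hi => hi.2
    have hmem : ∀ F : (ℕ → Bool) → ℝ, Cylindrical F →
        MemLp (fun ω => F (exceed X u ω)) 2 P := fun F hF => by
      obtain ⟨hm, C, hC⟩ := hF.measurable_and_bounded
      exact MemLp.of_bound (hm.comp_measurable (measurable_exceed hX u)).aestronglyMeasurable C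
        (ae_of_all _ fun ω => hC _)
    have hf' : DependsOn f (Set.Ico 0 t) := fun x y h => hf fun i hi => h i ⟨Nat.zero_le i, hi⟩
    have key := abs_covariance_le_maxCorr X ht hn
      (measurable_exceedanceField (X := X) (a := 1) (b := t) (u := u) (by omega) le_rfl hf')
      (hmem f hfc) (measurable_exceedanceField (X := X) (a := t + l) (b := n) (u := u)
        (by omega) le_rfl hg) (hmem g hgc)
    rw [covariance_eq_sub (hmem f hfc) (hmem g hgc)] at key
    rw [integral_map_exceed hX u (by fun_prop), integral_map_exceed hX u hfc,
      integral_map_exceed hX u hgc, integral_map_exceed hX u (hfc.pow 2),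
      integral_map_exceed hX u (hgc.pow 2)]
    refine key.trans (mul_le_mul_of_nonneg_left ?_ hρ)
    have hv : ∀ F : (ℕ → Bool) → ℝ, Cylindrical F →
        √Var[fun ω => F (exceed X u ω); P] ≤ √(∫ ω, F (exceed X u ω) ^ 2 ∂P) := fun F hF =>
      Real.sqrt_le_sqrt (variance_le_expectation_sq (hmem F hF).aestronglyMeasurable)
    exact mul_le_mul (hv f hfc) (hv g hgc) (Real.sqrt_nonneg _) (Real.sqrt_nonneg _)

end Exceedances

/-! ### Cluster sizes and void probabilities of the exceedances -/

section Cluster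

variable {Ω : Type*} {X : ℕ → Ω → ℝ}

theorem exceedances_le (m : ℕ) (u : ℝ) (ω : Ω) : exceedances X m u ω ≤ m := by
  refine (Finset.sum_le_card_nsmul _ _ 1 fun i _ => ?_).trans (by simp)
  exact Set.indicator_le_self' (fun _ _ => Nat.zero_le _) ω |>.trans (by simp)

theorem exceedances_eq_zero {m : ℕ} {u : ℝ} {ω : Ω} (h : ¬ (u : EReal) < blockMax X 0 m ω) :
    exceedances X m u ω = 0 := by
  rw [not_lt, blockMax_le_iff] at h
  refine Finset.sum_eq_zero fun i hi => Set.indicator_of_notMem ?_ _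
  simpa using h i (by simpa using hi)

variable [MeasurableSpace Ω] {P : Measure Ω}

/-- This also holds when `P A = 0`, where the conditional measure is zero. -/
theorem integral_eq_measureReal_mul_integral_cond [IsFiniteMeasure P] {A : Set Ω}
    {f : Ω → ℝ} (hf : ∀ ω ∉ A, f ω = 0) :
    ∫ ω, f ω ∂P = P.real A * ∫ ω, f ω ∂(ProbabilityTheory.cond P A) := by
  rw [ProbabilityTheory.cond, integral_smul_measure,
    setIntegral_eq_integral_of_forall_compl_eq_zero hf, ENNReal.toReal_inv, smul_eq_mul,
    ← Measure.real, ← mul_assoc]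
  by_cases h : P.real A = 0
  · rw [h, zero_mul, zero_mul, ← setIntegral_eq_integral_of_forall_compl_eq_zero hf,
      Measure.restrict_eq_zero.2 ((measureReal_eq_zero_iff).1 h), integral_zero_measure]
  · rw [mul_inv_cancel₀ h, one_mul]

/-- The first moments converge together with the masses, by uniform integrability, when the second
moments are bounded. -/
theorem tendsto_integral_natCast_of_tendsto_mass {Q : ℕ → Measure Ω} [∀ n, IsFiniteMeasure (Q n)]
    {N : ℕ → Ω → ℕ} (hN : ∀ n, Measurable (N n)) (hb : ∀ n, ∃ C : ℕ, ∀ ω, N n ω ≤ C)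
    {π : ℕ+ → ℝ} (hπ0 : ∀ j, 0 ≤ π j)
    (hπ : ∀ j : ℕ+, Tendsto (fun n => (Q n).real {ω | N n ω = (j : ℕ)}) atTop (𝓝 (π j)))
    (hsum : Summable fun j : ℕ+ => (j : ℝ) ^ 2 * π j) {m e : ℝ}
    (hm : Tendsto (fun n => ∫ ω, (N n ω : ℝ) ^ 2 ∂(Q n)) atTop (𝓝 m))
    (he : Tendsto (fun n => ∫ ω, (N n ω : ℝ) ∂(Q n)) atTop (𝓝 e)) :
    ∑' j : ℕ+, (j : ℝ) * π j = e := by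
  classical
  have hsum1 : Summable fun j : ℕ+ => (j : ℝ) * π j := by
    refine Summable.of_nonneg_of_le (fun j => mul_nonneg (by positivity) (hπ0 j)) (fun j => ?_) hsum
    have : (1 : ℝ) ≤ j := by exact_mod_cast Nat.one_le_iff_ne_zero.2 j.ne_zero
    exact mul_le_mul_of_nonneg_right (by nlinarith) (hπ0 j)
  have hint : ∀ n (q : ℕ), Integrable (fun ω => (N n ω : ℝ) ^ q) (Q n) := fun n q => by
    obtain ⟨C, hC⟩ := hb n
    refine Integrable.of_bound
      ((measurable_from_nat (f := fun j : ℕ => (j : ℝ) ^ q)).comp (hN n)).aestronglyMeasurable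
      ((C : ℝ) ^ q) (ae_of_all _ fun ω => ?_)
    rw [Real.norm_of_nonneg (by positivity)]
    have := hC ω
    gcongr
  have hset : ∀ n (j : ℕ), MeasurableSet {ω | N n ω = j} := fun n j =>
    hN n (measurableSet_singleton j)
  -- the truncated first moment
  set T : ℕ+ → ℕ → Ω → ℝ := fun J n ω =>
    ∑ j ∈ Finset.Iic J, Set.indicator {ω | N n ω = (j : ℕ)} (fun _ => (j : ℝ)) ω with hT
  have hTval : ∀ J n ω, T J n ω = if 0 < N n ω ∧ N n ω ≤ J then (N n ω : ℝ) else 0 := by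
    intro J n ω
    simp only [hT, Set.indicator_apply, Set.mem_ofPred_eq]
    split_ifs with h
    · obtain ⟨i, hi⟩ : ∃ i : ℕ+, (i : ℕ) = N n ω := ⟨⟨N n ω, h.1⟩, rfl⟩
      refine (Finset.sum_eq_single i (fun j _ hj => ?_) fun hj => ?_).trans (by simp [hi])
      · rw [if_neg]
        intro h'
        exact hj (PNat.eq (by rw [hi, h']))
      · refine absurd (Finset.mem_Iic.2 ?_) hj
        exact_mod_cast hi.trans_le h.2
    · refine Finset.sum_eq_zero fun j hj => ?_
      rw [if_neg]
      intro h'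
      refine h ⟨by rw [h']; exact j.pos, ?_⟩
      rw [h']
      exact_mod_cast Finset.mem_Iic.1 hj
  have hTint : ∀ J n, Integrable (T J n) (Q n) := fun J n =>
    integrable_finsetSum _ fun j _ => (integrable_const _).indicator (hset n j)
  have hTeq : ∀ J n, ∫ ω, T J n ω ∂(Q n)
      = ∑ j ∈ Finset.Iic J, (j : ℝ) * (Q n).real {ω | N n ω = (j : ℕ)} := by
    intro J n
    refine (integral_finsetSum _ fun j _ => ?_).trans ?_
    · exact (integrable_const _).indicator (hset n j)
    refine Finset.sum_congr rfl fun j _ => ?_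
    rw [integral_indicator_const _ (hset n j), smul_eq_mul, mul_comm]
  have hTlim : ∀ J, Tendsto (fun n => ∫ ω, T J n ω ∂(Q n)) atTop
      (𝓝 (∑ j ∈ Finset.Iic J, (j : ℝ) * π j)) := by
    intro J
    simp_rw [hTeq]
    exact tendsto_finsetSum _ fun j _ => (hπ j).const_mul _
  have hlow : ∀ J : ℕ+, ∑ j ∈ Finset.Iic J, (j : ℝ) * π j ≤ e := fun J =>
    le_of_tendsto_of_tendsto' (hTlim J) he fun n => by
      refine integral_mono (hTint J n) (by simpa using hint n 1) fun ω => ?_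
      simp only [hTval]
      split_ifs <;> simp
  have hupp : ∀ J : ℕ+, e ≤ ∑ j ∈ Finset.Iic J, (j : ℝ) * π j + m / J := fun J =>
    le_of_tendsto_of_tendsto' he ((hTlim J).add (hm.div_const (J : ℝ))) fun n => by
      rw [← integral_div, ← integral_add (hTint J n) ((hint n 2).div_const _)]
      refine integral_mono (by simpa using hint n 1)
        ((hTint J n).add ((hint n 2).div_const _)) fun ω => ?_
      have hJ : (0 : ℝ) < J := by exact_mod_cast J.pos
      simp only [hTval]
      split_ifs with h
      · have : 0 ≤ (N n ω : ℝ) ^ 2 / J := by positivity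
        linarith
      · rw [zero_add, le_div_iff₀ hJ]
        rcases Nat.eq_zero_or_pos (N n ω) with h0 | h0
        · simp [h0]
        · have : ((J : ℕ) : ℝ) ≤ N n ω := by
            exact_mod_cast (not_le.1 fun h' => h ⟨h0, h'⟩).le
          nlinarith
  have hS : Tendsto (fun J : ℕ+ => ∑ j ∈ Finset.Iic J, (j : ℝ) * π j) atTop
      (𝓝 (∑' j : ℕ+, (j : ℝ) * π j)) := hsum1.hasSum.comp tendsto_finset_Iic_atTop_atTop
  have hJ : Tendsto (fun J : ℕ+ => m / (J : ℝ)) atTop (𝓝 0) :=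
    tendsto_const_nhds.div_atTop (tendsto_natCast_atTop_atTop.comp
      (tendsto_atTop_atTop.2 fun b => ⟨b.succPNat, fun a ha =>
        (Nat.le_succ b).trans (by exact_mod_cast ha)⟩))
  have hSJ := hS.add hJ
  rw [add_zero] at hSJ
  exact le_antisymm (le_of_tendsto' hS hlow) (ge_of_tendsto' hSJ hupp)

theorem measurable_exceedances (hX : ∀ i, Measurable (X i)) (m : ℕ) (u : ℝ) :
    Measurable (exceedances X m u) :=
  Finset.measurable_sum _ fun i _ => measurable_const.indicator
    (measurableSet_lt measurable_const (hX i))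

theorem measureReal_lt_blockMax [IsProbabilityMeasure P] (hX : ∀ i, Measurable (X i)) (m : ℕ)
    (u : ℝ) : P.real {ω | (u : EReal) < blockMax X 0 m ω} = 1 - maxCdf X P m u := by
  rw [maxCdf, ← probReal_compl_eq_one_sub (measurableSet_blockMax_le hX 0 m u)]
  simp [Set.compl_ofPred]

/-- Convergence of `-log F / T` determines the limit of `F`. -/
theorem tendsto_exp_neg_of_tendsto_neg_log_div {F T : ℕ → ℝ} {θ τ : ℝ} (hF : ∀ n, 0 ≤ F n)
    (hτ : 0 < τ) (hθ : 0 < θ) (hT : Tendsto T atTop (𝓝 τ))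
    (h : Tendsto (fun n => -Real.log (F n) / T n) atTop (𝓝 θ)) :
    Tendsto F atTop (𝓝 (Real.exp (-(θ * τ)))) := by
  have h1 : Tendsto (fun n => Real.exp (-(-Real.log (F n) / T n * T n))) atTop
      (𝓝 (Real.exp (-(θ * τ)))) := (Real.continuous_exp.tendsto _).comp (h.mul hT).neg
  refine h1.congr' ?_
  filter_upwards [h.eventually (lt_mem_nhds hθ), hT.eventually (lt_mem_nhds hτ)] with n hn hTn
  -- as `log 0 = 0`, a vanishing `F n` is excluded by the positive limit of the ratio
  have hne : F n ≠ 0 := fun h0 => by simp [h0] at hn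
  rw [div_mul_cancel₀ _ hTn.ne', neg_neg, Real.exp_log (lt_of_le_of_ne (hF n) hne.symm)]

/-- The exceedances of the thresholds by a stationary sequence form a block array. -/
theorem blockArray_exceed [IsProbabilityMeasure P] (hX : ∀ i, Measurable (X i))
    (hstat : StrictlyStationary X P) {θ : ℝ} (hθ : 0 < θ) {u : ℕ → ℝ} {τ : ℝ} (hτ : 0 < τ)
    (hu : Tendsto (fun r : ℕ => (r : ℝ) * tail X P (u r)) atTop (𝓝 τ)) {r l s : ℕ → ℕ}
    (hr : ∀ n, 0 < r n) (hl : ∀ n, 0 < l n) (hs : ∀ n, 0 < s n)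
    (hlr : (fun n => (l n : ℝ)) =o[atTop] fun n => (r n : ℝ))
    (hrn : (fun n => (r n : ℝ)) =o[atTop] fun n : ℕ => (n : ℝ))
    (hls : (fun n => (l n : ℝ)) =o[atTop] fun n => (s n : ℝ))
    (hsr : (fun n => (s n : ℝ)) =o[atTop] fun n => (r n : ℝ))
    (hmixs : (fun n => maxCorr X P n (l n) (u (r n))) =o[atTop] fun n => (s n : ℝ) / (n : ℝ))
    (hbias : (fun n => thetaR X P (r n) (u (r n)) - θ)
      =o[atTop] fun n => 1 / Real.sqrt ((n / r n : ℕ) : ℝ)) :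
    BlockArray (fun n => P.map (exceed X (u (r n)))) r l s
      (fun n => maxCorr X P n (l n) (u (r n))) τ (θ * τ) := by
  have hr' : Tendsto r atTop atTop := by
    have h1 : (fun _ : ℕ => (1 : ℝ)) =o[atTop] fun n => (r n : ℝ) := by
      refine IsBigO.trans_isLittleO (IsBigO.of_bound 1 (Eventually.of_forall fun n => ?_)) hlr
      simpa using Nat.one_le_iff_ne_zero.2 (hl n).ne'
    simpa [isLittleO_one_left_iff, tendsto_natCast_atTop_iff] using h1
  have hT := hu.comp hr'
  refine ⟨fun n => Measure.isProbabilityMeasure_map (measurable_exceed hX _).aemeasurable,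
    fun n => mixingLaw_exceed hX hstat _ n (l n), hr, hl, hs, hls.tendsto_div_nhds_zero,
    hsr.tendsto_div_nhds_zero, hrn.tendsto_div_nhds_zero, ?_, ?_, ?_, by positivity⟩
  · refine hmixs.tendsto_div_nhds_zero.congr fun n => ?_
    rw [div_div_eq_mul_div, mul_comm]
  · refine hT.congr fun n => ?_
    rw [rate_map_exceed hX]
    rfl
  · simp_rw [void_map_exceed hX]
    refine tendsto_exp_neg_of_tendsto_neg_log_div (fun n => measureReal_nonneg) hτ hθ hT ?_
    have h1 : (fun n => thetaR X P (r n) (u (r n)) - θ) =o[atTop] fun _ => (1 : ℝ) := by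
      refine hbias.trans_isBigO (IsBigO.of_bound 1 (Eventually.of_forall fun n => ?_))
      rw [Real.norm_of_nonneg (by positivity), norm_one, one_mul]
      rcases Nat.eq_zero_or_pos (n / r n) with h | h
      · simp [h]
      · exact div_le_one_of_le₀ (Real.one_le_sqrt.2 (by exact_mod_cast h)) (Real.sqrt_nonneg _)
    have h2 := ((isLittleO_one_iff ℝ).1 h1).add_const θ
    simpa [thetaR, tauR, Function.comp_def] using h2

end Cluster

/-! ### Moments of the cluster sizes and the limit covariance -/

section ClusterArray

variable {Ω : Type*} [MeasurableSpace Ω] {P : Measure Ω} {X : ℕ → Ω → ℝ}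

theorem tendsto_div_mul_measureReal_lt_blockMax [IsProbabilityMeasure P]
    (hX : ∀ i, Measurable (X i)) {v : ℕ → ℝ} {r l s : ℕ → ℕ} {ρ : ℕ → ℝ} {τ α : ℝ}
    (hA : BlockArray (fun n => P.map (exceed X (v n))) r l s ρ τ α) :
    Tendsto (fun n => (r n : ℝ) / s n * P.real {ω | (v n : EReal) < blockMax X 0 (s n) ω})
      atTop (𝓝 α) := by
  refine hA.tendsto_div_mul_one_sub_void.congr fun n => ?_
  rw [void_map_exceed hX, measureReal_lt_blockMax hX]

theorem integral_exceedances [IsProbabilityMeasure P] (hX : ∀ i, Measurable (X i))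
    {v : ℕ → ℝ} {r l s : ℕ → ℕ} {ρ : ℕ → ℝ} {τ α : ℝ}
    (hA : BlockArray (fun n => P.map (exceed X (v n))) r l s ρ τ α) (n m : ℕ) :
    ∫ ω, (exceedances X m (v n) ω : ℝ) ∂P = m * rate (P.map (exceed X (v n))) := by
  have := hA.prob n
  have h := (hA.law n).integral_cnt' 0 m
  rw [integral_map_exceed hX _ (by fun_prop)] at h
  simp_rw [cnt_exceed] at h
  rw [h, Nat.sub_zero]

/-- The mean of the limiting cluster size distribution is the reciprocal of the extremal index. -/
theorem clusterMoment_one_eq [IsProbabilityMeasure P] (hX : ∀ i, Measurable (X i))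
    {v : ℕ → ℝ} {r l s : ℕ → ℕ} {ρ : ℕ → ℝ} {τ α : ℝ}
    (hA : BlockArray (fun n => P.map (exceed X (v n))) r l s ρ τ α) {π : PMF ℕ+}
    (hπ : ∀ j : ℕ+, Tendsto
      (fun n => (ProbabilityTheory.cond P {ω | (v n : EReal) < blockMax X 0 (s n) ω}).real
          {ω | exceedances X (s n) (v n) ω = (j : ℕ)})
      atTop (𝓝 (π j).toReal))
    (hπ_sum : Summable fun j : ℕ+ => (j : ℝ) ^ 2 * (π j).toReal)
    (hπ_mom : Tendsto
      (fun n => ∫ ω, (exceedances X (s n) (v n) ω : ℝ) ^ 2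
        ∂(ProbabilityTheory.cond P {ω | (v n : EReal) < blockMax X 0 (s n) ω}))
      atTop (𝓝 (clusterMoment π 2))) :
    clusterMoment π 1 = τ / α := by
  have hPA := tendsto_div_mul_measureReal_lt_blockMax hX hA
  have he : Tendsto (fun n => ∫ ω, (exceedances X (s n) (v n) ω : ℝ)
      ∂(ProbabilityTheory.cond P {ω | (v n : EReal) < blockMax X 0 (s n) ω})) atTop
      (𝓝 (τ / α)) := by
    refine (hA.tendsto_rate.div hPA hA.alpha_pos.ne').congr' ?_
    filter_upwards [hPA.eventually (lt_mem_nhds hA.alpha_pos)] with n hn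
    have h := integral_exceedances hX hA n (s n)
    rw [integral_eq_measureReal_mul_integral_cond
      (A := {ω | (v n : EReal) < blockMax X 0 (s n) ω})
      fun ω hω => by rw [exceedances_eq_zero hω, Nat.cast_zero]] at h
    have hs := (hA.s_pos' n).ne'
    rw [Pi.div_apply, div_eq_iff hn.ne']
    generalize P.real {ω | (v n : EReal) < blockMax X 0 (s n) ω} = a at *
    rw [eq_comm, mul_comm, mul_assoc, h]
    field_simp
  have := tendsto_integral_natCast_of_tendsto_mass
    (fun n => measurable_exceedances hX (s n) (v n)) (fun n => ⟨s n, exceedances_le _ _⟩)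
    (fun j => ENNReal.toReal_nonneg) hπ hπ_sum hπ_mom he
  simpa [clusterMoment] using this

/-- The exceedances of the thresholds form a cluster array. The order of the bounded moments is
reduced to at most three, which the central limit theorem can use. -/
theorem exists_clusterArray_exceed [IsProbabilityMeasure P] (hX : ∀ i, Measurable (X i))
    {v : ℕ → ℝ} {r l s : ℕ → ℕ} {ρ : ℕ → ℝ} {τ α m₂ : ℝ}
    (hA : BlockArray (fun n => P.map (exceed X (v n))) r l s ρ τ α)
    (hm₂ : Tendsto
      (fun n => ∫ ω, (exceedances X (s n) (v n) ω : ℝ) ^ 2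
        ∂(ProbabilityTheory.cond P {ω | (v n : EReal) < blockMax X 0 (s n) ω}))
      atTop (𝓝 m₂)) {p : ℝ} (hp : 1 < p)
    (hmom : (fun n => ∫ ω, (exceedances X (r n) (v n) ω : ℝ) ^ (2 * p) ∂P)
      =O[atTop] fun _ => (1 : ℝ)) :
    ∃ p' M : ℝ, ClusterArray (fun n => P.map (exceed X (v n))) r l s ρ τ α (α * m₂) p' M := by
  obtain ⟨M, hM⟩ := hmom.bound
  refine ⟨min p (3 / 2), M, hA, lt_min hp (by norm_num), ?_, ?_, ?_⟩
  · linarith [min_le_right p (3 / 2)]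
  · filter_upwards [hM] with n hn
    have hint : ∀ q : ℝ, 0 ≤ q →
        Integrable (fun ω => (exceedances X (r n) (v n) ω : ℝ) ^ q) P := fun q hq => by
      refine Integrable.of_bound ((measurable_from_nat (f := fun j : ℕ => (j : ℝ) ^ q)).comp
        (measurable_exceedances hX _ _)).aestronglyMeasurable ((r n : ℝ) ^ q)
        (ae_of_all _ fun ω => ?_)
      rw [Real.norm_of_nonneg (by positivity)]
      have := exceedances_le (X := X) (r n) (v n) ω
      gcongr
    rw [integral_map_exceed hX _
      ((by fun_prop : Cylindrical (cnt 0 (r n))).comp fun z => z ^ (2 * min p (3 / 2)))]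
    simp_rw [cnt_exceed]
    rw [norm_one, mul_one] at hn
    refine le_trans ?_ ((le_abs_self _).trans hn)
    refine integral_mono (hint _ (by positivity)) (hint _ (by positivity)) fun ω => ?_
    have hpos : 0 < min p (3 / 2) := lt_min (by linarith) (by norm_num)
    dsimp only
    rcases Nat.eq_zero_or_pos (exceedances X (r n) (v n) ω) with h | h
    · rw [h, Nat.cast_zero, Real.zero_rpow (by positivity), Real.zero_rpow (by positivity)]
    · exact Real.rpow_le_rpow_of_exponent_le (by exact_mod_cast h)
        (by linarith [min_le_left p (3 / 2)])
  · refine ((tendsto_div_mul_measureReal_lt_blockMax hX hA).mul hm₂).congr fun n => ?_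
    have : ∫ x, cnt 0 (s n) x ^ 2 ∂(P.map (exceed X (v n)))
        = ∫ ω, (exceedances X (s n) (v n) ω : ℝ) ^ 2 ∂P := by
      rw [integral_map_exceed hX _ (by fun_prop)]
      simp_rw [cnt_exceed]
    have hc := integral_eq_measureReal_mul_integral_cond (P := P)
      (A := {ω | (v n : EReal) < blockMax X 0 (s n) ω})
      (f := fun ω => (exceedances X (s n) (v n) ω : ℝ) ^ 2)
      fun ω hω => by rw [exceedances_eq_zero hω]; norm_num
    rw [this, hc, mul_assoc]

end ClusterArray

section Covariance

/-- The variance of a linear combination with coefficients `x 0`, `x 1` of the linearized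
estimators. -/
theorem limitVariance_eq_asympCov {θ τ m₁ m₂ : ℝ} (hθ : 0 < θ) (hτ : 0 < τ) (hm : m₁ = 1 / θ)
    (x : Fin 2 → ℝ) :
    limitVariance τ (θ * τ) (θ * τ * m₂) (-(x 0 * (Real.exp (θ * τ) / τ)))
        (-(x 1 * (Real.exp (θ * τ) / τ))) (-((x 0 + x 1) * (θ / τ)))
      = x ⬝ᵥ (asympCov θ (θ * τ) ((m₂ - m₁ ^ 2) / m₁ ^ 2)).mulVec x := by
  have hE : Real.exp (θ * τ) ≠ 0 := (Real.exp_pos _).ne'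
  rw [limitVariance, windowCov_zero, windowCovIntegral, asympCov, hm]
  simp only [Real.exp_neg, two_mul (θ * τ), Real.exp_add, dotProduct, Matrix.mulVec,
    Fin.sum_univ_two, Matrix.of_apply, Matrix.cons_val', Matrix.cons_val_zero,
    Matrix.cons_val_one, varDisjoint, varSliding, Matrix.cons_val_fin_one]
  field_simp
  ring

/-- The sliding blocks estimator is asymptotically no worse than the disjoint blocks estimator. -/
theorem varSliding_le_varDisjoint {α : ℝ} (hα : 0 < α) (θ c2 : ℝ) :
    varSliding θ α c2 ≤ varDisjoint θ α c2 := by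
  have key : 0 ≤ (α - 2) * Real.exp α + α + 2 := by
    have hd : ∀ x : ℝ, HasDerivAt (fun x : ℝ => (x - 2) * Real.exp x + x + 2)
        (1 * Real.exp x + (x - 2) * Real.exp x + 1) x := fun x =>
      ((((hasDerivAt_id x).sub_const 2).mul (Real.hasDerivAt_exp x)).add
        (hasDerivAt_id x)).add_const 2
    have hmono : Monotone fun x : ℝ => (x - 2) * Real.exp x + x + 2 := by
      refine monotone_of_deriv_nonneg (fun x => (hd x).differentiableAt) fun x => ?_
      rw [(hd x).deriv]
      -- the derivative is nonnegative because `1 - x ≤ e^(-x)`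
      have h1 := mul_le_mul_of_nonneg_right (Real.one_sub_le_exp_neg x) (Real.exp_pos x).le
      rw [← Real.exp_add, neg_add_cancel, Real.exp_zero] at h1
      linarith
    simpa using hmono hα.le
  have e : varDisjoint θ α c2 - varSliding θ α c2
      = θ ^ 2 / α ^ 3 * ((α - 2) * Real.exp α + α + 2) := by
    rw [varDisjoint, varSliding]
    field_simp
    ring
  have : 0 ≤ θ ^ 2 / α ^ 3 * ((α - 2) * Real.exp α + α + 2) := by positivity
  linarith

end Covariance

/-! ### The delta method -/

section Linearization

/-- The delta method for `(F, t) ↦ -log F / t`, along an arbitrary filter: the perturbations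
`w x / σ` of `F` and `y / σ` of `t` are of order `1 / σ`. -/
theorem tendsto_delta_of_isBigO {ι : Type*} {L : Filter ι} {σ F t w x y : ι → ℝ} {φ τ θ : ℝ}
    (hφ : 0 < φ) (hτ : 0 < τ) (hσ : Tendsto σ L atTop) (hF : Tendsto F L (𝓝 φ))
    (ht : Tendsto t L (𝓝 τ)) (hw : Tendsto w L (𝓝 1))
    (hbias : Tendsto (fun i => σ i * (-Real.log (F i) / t i - θ)) L (𝓝 0))
    (hx : x =O[L] fun _ => (1 : ℝ)) (hy : y =O[L] fun _ => (1 : ℝ)) :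
    Tendsto (fun i => σ i * (-Real.log (F i + w i * x i / σ i) / (t i + y i / σ i) - θ)
      + (x i / φ + θ * y i) / τ) L (𝓝 0) := by
  have hσ0 : (fun i => (σ i)⁻¹) =o[L] fun _ => (1 : ℝ) :=
    (isLittleO_one_iff ℝ).2 (tendsto_inv_atTop_zero.comp hσ)
  have hbdd : ∀ {f : ι → ℝ} {a : ℝ}, Tendsto f L (𝓝 a) → f =O[L] fun _ => (1 : ℝ) :=
    fun h => h.isBigO_one ℝ
  have hone : ∀ {f g : ι → ℝ}, f =O[L] (fun _ => (1 : ℝ)) → g =o[L] (fun _ => (1 : ℝ)) →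
      (fun i => f i * g i) =o[L] fun _ => (1 : ℝ) := fun hf hg => by
    simpa using hf.mul_isLittleO hg
  -- the relative perturbation of `F`
  set z : ι → ℝ := fun i => w i / F i * x i with hz
  have hzO : z =O[L] fun _ => (1 : ℝ) :=
    ((hbdd (hw.div hF hφ.ne')).mul hx).congr (fun _ => rfl) fun _ => mul_one _
  set h : ι → ℝ := fun i => z i * (σ i)⁻¹ with hh
  have hh0 : Tendsto h L (𝓝 0) := (isLittleO_one_iff ℝ).1 (hone hzO hσ0)
  have hlog : (fun i => σ i * (Real.log (1 + h i) - h i)) =o[L] fun _ => (1 : ℝ) := by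
    have h1 := (hasDerivAt_iff_isLittleO_nhds_zero.1 (Real.hasDerivAt_log one_ne_zero)).comp_tendsto
      hh0
    have h2 : (fun i => σ i * (Real.log (1 + h i) - h i)) =o[L] fun i => σ i * h i := by
      refine (isBigO_refl σ L).mul_isLittleO (h1.congr (fun i => ?_) fun i => rfl)
      simp
    refine h2.trans_isBigO (hzO.congr' ?_ EventuallyEq.rfl)
    filter_upwards [hσ.eventually_gt_atTop 0] with i hi
    simp only [hh]
    field_simp
  have hz0 : (fun i => z i - x i / φ) =o[L] fun _ => (1 : ℝ) := by
    have h1 : (fun i => w i / F i - 1 / φ) =o[L] fun _ => (1 : ℝ) :=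
      (isLittleO_one_iff ℝ).2 (by simpa using (hw.div hF hφ.ne').sub_const (1 / φ))
    refine (hone hx h1).congr_left fun i => ?_
    simp only [hz]
    ring
  have hb : (fun i => x i / φ + θ * y i) =O[L] fun _ => (1 : ℝ) :=
    ((hx.const_mul_left φ⁻¹).congr_left fun i => by rw [div_eq_inv_mul]).add (hy.const_mul_left θ)
  have hD : Tendsto (fun i => t i + y i / σ i) L (𝓝 τ) := by
    simpa [div_eq_mul_inv] using ht.add ((isLittleO_one_iff ℝ).1 (hone hy hσ0))
  have hDinv : Tendsto (fun i => (t i + y i / σ i)⁻¹) L (𝓝 τ⁻¹) := hD.inv₀ hτ.ne'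
  have hDinv0 : (fun i => τ⁻¹ - (t i + y i / σ i)⁻¹) =o[L] fun _ => (1 : ℝ) :=
    (isLittleO_one_iff ℝ).2 (by simpa using hDinv.const_sub τ⁻¹)
  have hbt : (fun i => t i * (σ i * (-Real.log (F i) / t i - θ))) =o[L] fun _ => (1 : ℝ) :=
    hone (hbdd ht) ((isLittleO_one_iff ℝ).2 hbias)
  have key := (hone (hbdd hDinv) ((hbt.sub hlog).sub hz0)).add (hone hb hDinv0)
  refine (isLittleO_one_iff ℝ).1 (key.congr' ?_ EventuallyEq.rfl)
  filter_upwards [hσ.eventually_gt_atTop 0, hF.eventually (lt_mem_nhds hφ),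
    ht.eventually (lt_mem_nhds hτ), hD.eventually (lt_mem_nhds hτ),
    hh0.eventually (lt_mem_nhds (show (-1 : ℝ) < 0 by norm_num))] with i hi hFi hti hDi hhi
  have e1 : F i + w i * x i / σ i = F i * (1 + h i) := by
    simp only [hh, hz]
    field_simp
  have e2 : σ i * h i = z i := by
    simp only [hh]
    field_simp
  rw [e1, Real.log_mul hFi.ne' (by linarith), mul_sub (σ i) (Real.log _), e2]
  have e3 : θ * y i = θ * σ i * (t i + y i / σ i) - θ * σ i * t i := by
    field_simp
    ring
  rw [e3]
  generalize t i + y i / σ i = D at *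
  field_simp
  ring

/-- The delta method for `(F, t) ↦ -log F / t`, uniformly over bounded perturbations. -/
theorem eventually_delta {σ F t w : ℕ → ℝ} {φ τ θ : ℝ}
    (hφ : 0 < φ) (hτ : 0 < τ) (hσ : Tendsto σ atTop atTop) (hF : Tendsto F atTop (𝓝 φ))
    (ht : Tendsto t atTop (𝓝 τ)) (hw : Tendsto w atTop (𝓝 1))
    (hbias : Tendsto (fun n => σ n * (-Real.log (F n) / t n - θ)) atTop (𝓝 0))
    (K : ℝ) {ε : ℝ} (hε : 0 < ε) :
    ∀ᶠ n in atTop, ∀ x y : ℝ, |x| ≤ K → |y| ≤ K →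
      |σ n * (-Real.log (F n + w n * x / σ n) / (t n + y / σ n) - θ)
        + (x / φ + θ * y) / τ| < ε := by
  set L : Filter (ℕ × ℝ × ℝ) := atTop ×ˢ 𝓟 {q : ℝ × ℝ | |q.1| ≤ K ∧ |q.2| ≤ K} with hL
  have hfst : Tendsto (fun q : ℕ × ℝ × ℝ => q.1) L atTop := tendsto_fst
  have hball : ∀ᶠ q in L, |q.2.1| ≤ K ∧ |q.2.2| ≤ K :=
    (tendsto_snd (f := (atTop : Filter ℕ))).eventually (mem_principal_self _)
  have h := tendsto_delta_of_isBigO (x := fun q : ℕ × ℝ × ℝ => q.2.1) (y := fun q => q.2.2) hφ hτ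
    (hσ.comp hfst) (hF.comp hfst) (ht.comp hfst) (hw.comp hfst) (hbias.comp hfst)
    (IsBigO.of_bound K (hball.mono fun q hq => by simpa using hq.1))
    (IsBigO.of_bound K (hball.mono fun q hq => by simpa using hq.2))
  have h1 := h.eventually (Metric.ball_mem_nhds 0 hε)
  rw [hL, eventually_prod_principal_iff] at h1
  filter_upwards [h1] with n hn x y hx hy
  simpa [Real.dist_eq] using hn (x, y) ⟨hx, hy⟩

/-- Remainders that are uniformly small where finitely many statistics are bounded vanish in
probability when the second moments of the statistics are bounded. -/
theorem tendstoInMeasure_zero_of_forall_bounded {Ω E κ : Type*} [MeasurableSpace Ω] {P : Measure Ω}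
    [IsProbabilityMeasure P] [SeminormedAddCommGroup E] [Fintype κ] {D : ℕ → Ω → E}
    {S : κ → ℕ → Ω → ℝ} (hint : ∀ i n, Integrable (fun ω => S i n ω ^ 2) P)
    (hS : ∀ i, ∃ C, ∀ᶠ n in atTop, ∫ ω, S i n ω ^ 2 ∂P ≤ C)
    (h : ∀ K ε : ℝ, 0 < ε → ∀ᶠ n in atTop, ∀ ω, (∀ i, |S i n ω| ≤ K) → ‖D n ω‖ < ε) :
    TendstoInMeasure P D atTop 0 := by
  rw [tendstoInMeasure_iff_measureReal_norm]
  intro ε hε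
  choose C hC using hS
  set B := ∑ i, |C i| with hB
  have hbound : ∀ K : ℝ, 0 < K →
      ∀ᶠ n in atTop, P.real {ω | ε ≤ ‖D n ω - (0 : Ω → E) ω‖} ≤ B / K ^ 2 := by
    intro K hK
    filter_upwards [h K ε hε, eventually_all.2 hC] with n hn hCn
    have hsub : {ω | ε ≤ ‖D n ω - (0 : Ω → E) ω‖} ⊆ ⋃ i, {ω | K ^ 2 ≤ S i n ω ^ 2} := by
      intro ω hω
      by_contra hcon
      simp only [Set.mem_iUnion, Set.mem_ofPred_eq, not_exists, not_le] at hcon hω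
      have := hn ω fun i => (abs_lt_of_sq_lt_sq (hcon i) hK.le).le
      simp only [Pi.zero_apply, sub_zero] at hω
      linarith
    refine (measureReal_mono hsub).trans ((measureReal_iUnion_fintype_le _).trans ?_)
    rw [hB, Finset.sum_div]
    refine Finset.sum_le_sum fun i _ => ?_
    rw [le_div_iff₀ (by positivity), mul_comm]
    exact (mul_meas_ge_le_integral_of_nonneg (ae_of_all _ fun ω => sq_nonneg _) (hint i n)
      _).trans ((hCn i).trans (le_abs_self _))
  refine tendsto_order.2 ⟨fun a ha => Eventually.of_forall fun n =>
    ha.trans_le measureReal_nonneg, fun a ha => ?_⟩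
  have hlim : Tendsto (fun K : ℝ => B / K ^ 2) atTop (𝓝 0) :=
    tendsto_const_nhds.div_atTop (tendsto_pow_atTop two_ne_zero)
  obtain ⟨K, hK, hK0⟩ := ((hlim.eventually (gt_mem_nhds ha)).and (eventually_gt_atTop 0)).exists
  exact (hbound K hK0).mono fun n hn => hn.trans_lt hK

end Linearization

section Estimators

variable {Ω : Type*} {X : ℕ → Ω → ℝ}

/-- The disjoint blocks estimator is the void probability plus a fluctuation of order `1 / √k`. -/
theorem cdfDisjoint_eq (ν : Measure (ℕ → Bool)) {n r : ℕ} (h : 0 < n / r) (u : ℝ) (ω : Ω) :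
    cdfDisjoint X n r u ω = void ν r
      + 1 * (sampleSum ν 1 0 0 r n (exceed X u ω) / √(n / r : ℕ)) / √(n / r : ℕ) := by
  have hk : (0 : ℝ) < (n / r : ℕ) := Nat.cast_pos.2 h
  rw [cdfDisjoint, sampleSum, BlockArray.disjointSum, zero_mul, zero_mul, add_zero, add_zero, one_mul, one_mul,
    div_div, Real.mul_self_sqrt hk.le]
  simp_rw [win, emp_exceed, Finset.sum_sub_distrib, add_one_mul]
  rw [Finset.sum_const, Finset.card_range, nsmul_eq_mul]
  field_simp
  ring

/-- The sliding blocks estimator is the void probability plus a fluctuation of order `1 / √k`, with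
weight `k r / (n - r + 1)`, as the statistic is normalized by `k r` in place of the number of
windows. -/
theorem cdfSliding_eq (ν : Measure (ℕ → Bool)) {n r : ℕ} (hr : 0 < r) (h : 0 < n / r) (u : ℝ)
    (ω : Ω) :
    cdfSliding X n r u ω = void ν r + ((n / r : ℕ) * r / (n - r + 1 : ℕ) : ℝ)
      * (sampleSum ν 0 1 0 r n (exceed X u ω) / √(n / r : ℕ)) / √(n / r : ℕ) := by
  have hk : (0 : ℝ) < (n / r : ℕ) := Nat.cast_pos.2 h
  have hr' : (0 : ℝ) < r := Nat.cast_pos.2 hr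
  have hm : (0 : ℝ) < (n - r + 1 : ℕ) := Nat.cast_pos.2 (Nat.succ_pos _)
  rw [cdfSliding, sampleSum, zero_mul, zero_mul, add_zero, zero_add, one_mul,
    mul_div_assoc, div_div _ (√_), Real.mul_self_sqrt hk.le]
  simp_rw [win, emp_exceed, Finset.sum_sub_distrib]
  rw [Finset.sum_const, Finset.card_range, nsmul_eq_mul]
  field_simp
  ring

theorem tauHat_eq (ν : Measure (ℕ → Bool)) {n r : ℕ} (h : 0 < n / r) (u : ℝ) (ω : Ω) :
    tauHat X n r u ω = r * rate ν
      + sampleSum ν 0 0 1 r n (exceed X u ω) / √(n / r : ℕ) / √(n / r : ℕ) := by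
  have hk : (0 : ℝ) < (n / r : ℕ) := Nat.cast_pos.2 h
  rw [tauHat, sampleSum, zero_mul, zero_mul, zero_add, zero_add, one_mul, div_div,
    Real.mul_self_sqrt hk.le, dev, cnt_exceed, Nat.sub_zero, Nat.mul_comm r, Nat.cast_mul]
  field_simp
  ring

/-- Up to one incomplete block, `k r` is the number of windows. -/
theorem tendsto_slidingWeight {r : ℕ → ℕ} (hr : ∀ n, 0 < r n)
    (h : Tendsto (fun n => (r n : ℝ) / n) atTop (𝓝 0)) :
    Tendsto (fun n => ((n / r n : ℕ) * r n / (n - r n + 1 : ℕ) : ℝ)) atTop (𝓝 1) := by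
  have h1 : Tendsto (fun n => 1 - (r n : ℝ) / n) atTop (𝓝 1) := by
    simpa using h.const_sub 1
  have h2 : Tendsto (fun n => (1 - (r n : ℝ) / n)⁻¹) atTop (𝓝 1) := by
    simpa using h1.inv₀ one_ne_zero
  refine tendsto_of_tendsto_of_tendsto_of_le_of_le' h1 h2 ?_ ?_
  all_goals
    filter_upwards [h.eventually (gt_mem_nhds one_pos), eventually_gt_atTop 0] with n hn hn0
    have hn0' : (0 : ℝ) < n := Nat.cast_pos.2 hn0
    have hrn : r n < n := by
      rw [div_lt_one hn0'] at hn
      exact_mod_cast hn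
    have hm : ((n - r n + 1 : ℕ) : ℝ) = n - r n + 1 := by
      push_cast [hrn.le]
      ring
    have hq : ((n / r n : ℕ) : ℝ) * r n ≤ n := by exact_mod_cast Nat.div_mul_le_self n (r n)
    have hq' : (n : ℝ) + 1 ≤ (n / r n : ℕ) * r n + r n := by
      have := Nat.lt_div_mul_add (a := n) (hr n)
      exact_mod_cast this
    have hrn' : (r n : ℝ) < n := Nat.cast_lt.2 hrn
    have hr1 : (1 : ℝ) ≤ r n := Nat.one_le_cast.2 (hr n)
    rw [hm]
  · rw [le_div_iff₀ (by linarith), one_sub_div hn0'.ne', div_mul_eq_mul_div, div_le_iff₀ hn0']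
    nlinarith
  · rw [one_sub_div hn0'.ne', inv_div]
    exact div_le_div₀ hn0'.le hq (by linarith) (by linarith)

end Estimators

/-! ### Convergence of the estimators -/

section Plane

theorem norm_pair_le (a b : ℝ) : ‖(!₂[a, b] : EuclideanSpace ℝ (Fin 2))‖ ≤ |a| + |b| := by
  rw [EuclideanSpace.norm_eq, Fin.sum_univ_two]
  refine Real.sqrt_le_iff.2 ⟨by positivity, ?_⟩
  simp only [Real.norm_eq_abs, Matrix.cons_val_zero, Matrix.cons_val_one]
  nlinarith [abs_nonneg a, abs_nonneg b]

theorem measurable_pair {Ω : Type*} [MeasurableSpace Ω] {f g : Ω → ℝ} (hf : Measurable f)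
    (hg : Measurable g) :
    Measurable fun ω => (!₂[f ω, g ω] : EuclideanSpace ℝ (Fin 2)) := by
  refine (WithLp.measurable_toLp 2 (Fin 2 → ℝ)).comp (measurable_pi_lambda _ fun i => ?_)
  fin_cases i
  · exact hf
  · exact hg

end Plane

section Convergence

variable {Ω : Type*} [MeasurableSpace Ω] {P : Measure Ω} {X : ℕ → Ω → ℝ}

theorem measurable_tauHat (hX : ∀ i, Measurable (X i)) (n r : ℕ) (u : ℝ) :
    Measurable (tauHat X n r u) :=
  ((measurable_from_nat (f := fun j : ℕ => (j : ℝ))).comp (measurable_exceedances hX _ u)).const_mul _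

theorem measurable_thetaDisjoint (hX : ∀ i, Measurable (X i)) (n r : ℕ) (u : ℝ) :
    Measurable (thetaDisjoint X n r u) := by
  refine Measurable.div (Measurable.neg (Measurable.log ?_)) (measurable_tauHat hX n r u)
  exact (Finset.measurable_sum _ fun i _ => measurable_const.indicator
    (measurableSet_blockMax_le hX _ _ u)).const_mul _

theorem measurable_thetaSliding (hX : ∀ i, Measurable (X i)) (n r : ℕ) (u : ℝ) :
    Measurable (thetaSliding X n r u) := by
  refine Measurable.div (Measurable.neg (Measurable.log ?_)) (measurable_tauHat hX n r u)
  exact (Finset.measurable_sum _ fun i _ => measurable_const.indicator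
    (measurableSet_blockMax_le hX _ _ u)).const_mul _

/-- The linear combination of the statistics of a sample, normalized by the square root of the
number of blocks. -/
noncomputable def normSum (P : Measure Ω) (X : ℕ → Ω → ℝ) (a b c : ℝ) (n r : ℕ) (u : ℝ) (ω : Ω) :
    ℝ :=
  sampleSum (P.map (exceed X u)) a b c r n (exceed X u ω) / √(n / r : ℕ)

theorem measurable_normSum (hX : ∀ i, Measurable (X i)) (a b c : ℝ) (n r : ℕ) (u : ℝ) :
    Measurable (normSum P X a b c n r u) :=
  ((by fun_prop : Cylindrical (sampleSum (P.map (exceed X u)) a b c r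
    n)).measurable_and_bounded.1.measurable.comp (measurable_exceed hX u)).div_const _

theorem normSum_eq (a b c : ℝ) (n r : ℕ) (u : ℝ) (ω : Ω) :
    normSum P X a b c n r u ω = a * normSum P X 1 0 0 n r u ω + b * normSum P X 0 1 0 n r u ω
      + c * normSum P X 0 0 1 n r u ω := by
  simp only [normSum, sampleSum]
  ring

theorem integrable_normSum_sq [IsProbabilityMeasure P] (hX : ∀ i, Measurable (X i)) (a b c : ℝ)
    (n r : ℕ) (u : ℝ) : Integrable (fun ω => normSum P X a b c n r u ω ^ 2) P := by
  obtain ⟨-, C, hC⟩ := (by fun_prop :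
    Cylindrical fun x => (sampleSum (P.map (exceed X u)) a b c r n x
      / √(n / r : ℕ)) ^ 2).measurable_and_bounded
  exact Integrable.of_bound ((measurable_normSum hX a b c n r u).pow_const 2).aestronglyMeasurable C
    (ae_of_all _ fun ω => hC _)

/-- The linear approximation to the normalized errors of the disjoint and sliding blocks
estimators. -/
noncomputable def linearError (P : Measure Ω) (X : ℕ → Ω → ℝ) (θ τ : ℝ) (n r : ℕ) (u : ℝ) (ω : Ω) :
    EuclideanSpace ℝ (Fin 2) :=
  !₂[-((normSum P X 1 0 0 n r u ω / Real.exp (-(θ * τ)) + θ * normSum P X 0 0 1 n r u ω) / τ),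
    -((normSum P X 0 1 0 n r u ω / Real.exp (-(θ * τ)) + θ * normSum P X 0 0 1 n r u ω) / τ)]

theorem measurable_linearError (hX : ∀ i, Measurable (X i)) (θ τ : ℝ) (n r : ℕ) (u : ℝ) :
    Measurable (linearError P X θ τ n r u) := by
  have h := fun a b c => measurable_normSum (P := P) hX a b c n r u
  exact measurable_pair
    ((((h 1 0 0).div_const _).add ((h 0 0 1).const_mul θ)).div_const τ).neg
    ((((h 0 1 0).div_const _).add ((h 0 0 1).const_mul θ)).div_const τ).neg

theorem inner_linearError (θ τ : ℝ) (n r : ℕ) (u : ℝ) (ω : Ω) (x : EuclideanSpace ℝ (Fin 2)) :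
    inner ℝ (linearError P X θ τ n r u ω) x
      = normSum P X (-(x 0 * (Real.exp (θ * τ) / τ))) (-(x 1 * (Real.exp (θ * τ) / τ)))
          (-((x 0 + x 1) * (θ / τ))) n r u ω := by
  rw [normSum_eq]
  simp only [linearError, PiLp.inner_apply, Fin.sum_univ_two, Real.exp_neg,
    div_inv_eq_mul, Matrix.cons_val_zero, Matrix.cons_val_one, RCLike.inner_apply, conj_trivial]
  ring

variable {v : ℕ → ℝ} {r l s : ℕ → ℕ} {ρ : ℕ → ℝ} {θ τ κ p M : ℝ}

theorem eventually_integral_normSum_sq_le [IsProbabilityMeasure P] (hX : ∀ i, Measurable (X i))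
    {α : ℝ} (hA : ClusterArray (fun n => P.map (exceed X (v n))) r l s ρ τ α κ p M) (a b c : ℝ) :
    ∃ C, ∀ᶠ n in atTop, ∫ ω, normSum P X a b c n (r n) (v n) ω ^ 2 ∂P ≤ C := by
  obtain ⟨C, hC⟩ := hA.eventually_integral_sampleSum_sq_le a b c
  refine ⟨C, ?_⟩
  filter_upwards [hC, hA.tendsto_blocks.eventually_gt_atTop 0] with n hn hk
  rw [integral_map_exceed hX _ (by fun_prop)] at hn
  simp_rw [normSum, div_pow, Real.sq_sqrt hk.le]
  rwa [integral_div, div_le_iff₀ hk]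

/-- The quadratic form of `asympCov` is a limit variance. -/
theorem posSemidef_asympCov {μ : ℕ → Measure (ℕ → Bool)} {m₁ m₂ : ℝ} (hθ : 0 < θ) (hτ : 0 < τ)
    (hm : m₁ = 1 / θ) (hA : ClusterArray μ r l s ρ τ (θ * τ) (θ * τ * m₂) p M) :
    (asympCov θ (θ * τ) ((m₂ - m₁ ^ 2) / m₁ ^ 2)).PosSemidef := by
  refine Matrix.PosSemidef.of_dotProduct_mulVec_nonneg ?_ fun x => ?_
  · ext i j
    fin_cases i <;> fin_cases j <;> simp [asympCov]
  · rw [star_trivial, ← limitVariance_eq_asympCov hθ hτ hm]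
    exact hA.limitVariance_nonneg _ _ _

/-- The central limit theorem for the linear approximations, by the Cramér–Wold device. -/
theorem tendstoInDistribution_linearError [IsProbabilityMeasure P] (hX : ∀ i, Measurable (X i))
    {m₁ m₂ : ℝ} (hθ : 0 < θ) (hτ : 0 < τ) (hm : m₁ = 1 / θ)
    (hA : ClusterArray (fun n => P.map (exceed X (v n))) r l s ρ τ (θ * τ) (θ * τ * m₂) p M) :
    TendstoInDistribution (fun n => linearError P X θ τ n (r n) (v n)) atTop
      (id : EuclideanSpace ℝ (Fin 2) → EuclideanSpace ℝ (Fin 2)) (fun _ => P)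
      (multivariateGaussian 0 (asympCov θ (θ * τ) ((m₂ - m₁ ^ 2) / m₁ ^ 2))) where
  forall_aemeasurable n := (measurable_linearError hX θ τ n (r n) (v n)).aemeasurable
  aemeasurable_limit := aemeasurable_id
  tendsto := by
    refine ProbabilityMeasure.tendsto_iff_tendsto_charFun.2 fun x => ?_
    simp only [ProbabilityMeasure.coe_mk, Measure.map_id]
    rw [charFun_multivariateGaussian (posSemidef_asympCov hθ hτ hm hA),
      ← limitVariance_eq_asympCov hθ hτ hm]
    have h := hA.tendsto_integral_exp_sampleSum (-(x 0 * (Real.exp (θ * τ) / τ)))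
        (-(x 1 * (Real.exp (θ * τ) / τ))) (-((x 0 + x 1) * (θ / τ)))
    convert h using 2 with n
    · rw [charFun_apply, integral_map (measurable_linearError hX θ τ n (r n) (v n)).aemeasurable
        (by fun_prop)]
      rw [integral_map_exceed hX _ (Cylindrical.comp (fun z : ℝ => Complex.exp (z * Complex.I))
        (by fun_prop : Cylindrical fun y => sampleSum (P.map (exceed X (v n)))
          (-(x 0 * (Real.exp (θ * τ) / τ))) (-(x 1 * (Real.exp (θ * τ) / τ)))
          (-((x 0 + x 1) * (θ / τ))) (r n) n y / √(n / r n : ℕ)))]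
      simp_rw [inner_linearError]
      rfl
    · simp

/-- The normalized errors of the estimators are asymptotically equivalent to their linear
approximations. -/
theorem tendstoInMeasure_sub_linearError [IsProbabilityMeasure P] (hX : ∀ i, Measurable (X i))
    (hτ : 0 < τ)
    (hA : ClusterArray (fun n => P.map (exceed X (v n))) r l s ρ τ (θ * τ) κ p M)
    (hbias : (fun n => thetaR X P (r n) (v n) - θ)
      =o[atTop] fun n => 1 / Real.sqrt ((n / r n : ℕ) : ℝ)) :
    TendstoInMeasure P ((fun n ω => (!₂[
        Real.sqrt ((n / r n : ℕ) : ℝ) * (thetaDisjoint X n (r n) (v n) ω - θ),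
        Real.sqrt ((n / r n : ℕ) : ℝ) * (thetaSliding X n (r n) (v n) ω - θ)] :
          EuclideanSpace ℝ (Fin 2))) - fun n => linearError P X θ τ n (r n) (v n)) atTop 0 := by
  set S : Fin 3 → ℕ → Ω → ℝ := fun i n => normSum P X (if i = 0 then 1 else 0)
    (if i = 1 then 1 else 0) (if i = 2 then 1 else 0) n (r n) (v n) with hS
  refine tendstoInMeasure_zero_of_forall_bounded (S := S)
    (fun i n => integrable_normSum_sq hX _ _ _ _ _ _)
    (fun i => eventually_integral_normSum_sq_le hX hA _ _ _) fun K ε hε => ?_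
  have hσ : Tendsto (fun n => √(n / r n : ℕ)) atTop atTop :=
    Real.tendsto_sqrt_atTop.comp hA.tendsto_blocks
  have hb : Tendsto (fun n => √(n / r n : ℕ) * (-Real.log (void (P.map (exceed X (v n))) (r n))
      / (r n * rate (P.map (exceed X (v n)))) - θ)) atTop (𝓝 0) := by
    refine hbias.tendsto_div_nhds_zero.congr fun n => ?_
    rw [void_map_exceed hX, rate_map_exceed hX, div_div_eq_mul_div, div_one, mul_comm]
    rfl
  filter_upwards [hA.tendsto_blocks.eventually_gt_atTop 0,
    eventually_delta (Real.exp_pos _) hτ hσ hA.tendsto_void hA.tendsto_rate tendsto_const_nhds hb K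
      (half_pos hε),
    eventually_delta (Real.exp_pos _) hτ hσ hA.tendsto_void hA.tendsto_rate
      (tendsto_slidingWeight hA.r_pos hA.r_div_n) hb K (half_pos hε)] with n hk hdj hsl ω hω
  have hk' : 0 < n / r n := Nat.cast_pos.1 hk
  have h0 := hω 0
  have h1 := hω 1
  have h2 := hω 2
  simp only [hS, Fin.isValue, if_true, Fin.reduceEq, if_false] at h0 h1 h2
  have hd := hdj _ _ h0 h2
  have hs := hsl _ _ h1 h2
  have e : ((fun n ω => (!₂[
        Real.sqrt ((n / r n : ℕ) : ℝ) * (thetaDisjoint X n (r n) (v n) ω - θ),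
        Real.sqrt ((n / r n : ℕ) : ℝ) * (thetaSliding X n (r n) (v n) ω - θ)] :
          EuclideanSpace ℝ (Fin 2))) - fun n => linearError P X θ τ n (r n) (v n)) n ω
      = !₂[√(n / r n : ℕ) * (thetaDisjoint X n (r n) (v n) ω - θ)
          + (normSum P X 1 0 0 n (r n) (v n) ω / Real.exp (-(θ * τ))
            + θ * normSum P X 0 0 1 n (r n) (v n) ω) / τ,
        √(n / r n : ℕ) * (thetaSliding X n (r n) (v n) ω - θ)
          + (normSum P X 0 1 0 n (r n) (v n) ω / Real.exp (-(θ * τ))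
            + θ * normSum P X 0 0 1 n (r n) (v n) ω) / τ] := by
    ext i
    fin_cases i <;> simp [linearError]
  rw [e]
  refine (norm_pair_le _ _).trans_lt ?_
  rw [thetaDisjoint, thetaSliding, cdfDisjoint_eq (P.map (exceed X (v n))) hk',
    cdfSliding_eq (P.map (exceed X (v n))) (hA.r_pos n) hk',
    tauHat_eq (P.map (exceed X (v n))) hk']
  simp only [normSum] at hd hs ⊢
  linarith

end Convergence

end SlidingBlocks

open SlidingBlocks
theorem corollary4p3 {Ω : Type*} [MeasurableSpace Ω] (P : Measure Ω) [IsProbabilityMeasure P]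
    (X : ℕ → Ω → ℝ) (hX : ∀ i, Measurable (X i)) (hstat : StrictlyStationary X P)
    (θ : ℝ) (hθ : HasExtremalIndex X P θ)
    -- thresholds
    (u : ℕ → ℝ) (τ : ℝ) (hτ : 0 < τ)
    (hu : Tendsto (fun r : ℕ => (r : ℝ) * tail X P (u r)) atTop (𝓝 τ))
    -- block sizes and mixing
    (r l : ℕ → ℕ) (hr : ∀ n, 0 < r n) (hl : ∀ n, 0 < l n)
    (hlr : (fun n => (l n : ℝ)) =o[atTop] fun n => (r n : ℝ))
    (hrn : (fun n => (r n : ℝ)) =o[atTop] fun n : ℕ => (n : ℝ))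
    (hmix : (fun n => ∑ j ∈ Finset.Icc (l n) n, maxCorr X P n j (u (r n)))
      =o[atTop] fun n => (r n : ℝ))
    (hmix' : (fun n => ∑ j ∈ Finset.Icc 1 n, maxCorr X P n j (u (r n)))
      =o[atTop] fun n => Real.sqrt (r n : ℝ))
    -- cluster size distribution
    (s : ℕ → ℕ) (hs : ∀ n, 0 < s n) (π : PMF ℕ+)
    (hls : (fun n => (l n : ℝ)) =o[atTop] fun n => (s n : ℝ))
    (hsr : (fun n => (s n : ℝ)) =o[atTop] fun n => (r n : ℝ))
    (hmixs : (fun n => maxCorr X P n (l n) (u (r n))) =o[atTop] fun n => (s n : ℝ) / (n : ℝ))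
    (hπ : ∀ j : ℕ+, Tendsto
      (fun n => (ProbabilityTheory.cond P
        {ω | (u (r n) : EReal) < blockMax X 0 (s n) ω}).real
          {ω | exceedances X (s n) (u (r n)) ω = (j : ℕ)})
      atTop (𝓝 (π j).toReal))
    (hπ_sum : Summable fun j : ℕ+ => (j : ℝ) ^ 2 * (π j).toReal)
    (hπ_mom : Tendsto
      (fun n => ∫ ω, (exceedances X (s n) (u (r n)) ω : ℝ) ^ 2
        ∂(ProbabilityTheory.cond P {ω | (u (r n) : EReal) < blockMax X 0 (s n) ω}))
      atTop (𝓝 (clusterMoment π 2)))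
    -- moment condition
    (p : ℝ) (hp : 1 < p)
    (hmom : (fun n => ∫ ω, (exceedances X (r n) (u (r n)) ω : ℝ) ^ (2 * p) ∂P)
      =O[atTop] fun _ => (1 : ℝ))
    -- bias condition
    (hbias : (fun n => thetaR X P (r n) (u (r n)) - θ)
      =o[atTop] fun n => 1 / Real.sqrt ((n / r n : ℕ) : ℝ)) :
    -- `V` is a covariance matrix, so that `N(0, V)` is the Gaussian law it should be
    (asympCov θ (θ * τ) (sqCoeffVar π)).PosSemidef ∧
    TendstoInDistribution
      (fun n ω => (!₂[
        Real.sqrt ((n / r n : ℕ) : ℝ) * (thetaDisjoint X n (r n) (u (r n)) ω - θ),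
        Real.sqrt ((n / r n : ℕ) : ℝ) * (thetaSliding X n (r n) (u (r n)) ω - θ)] :
          EuclideanSpace ℝ (Fin 2)))
      atTop (id : EuclideanSpace ℝ (Fin 2) → EuclideanSpace ℝ (Fin 2)) (fun _ => P)
      (multivariateGaussian 0 (asympCov θ (θ * τ) (sqCoeffVar π))) ∧
    asympCov θ (θ * τ) (sqCoeffVar π) 1 1 = asympCov θ (θ * τ) (sqCoeffVar π) 0 1 ∧
    asympCov θ (θ * τ) (sqCoeffVar π) 1 1 ≤ asympCov θ (θ * τ) (sqCoeffVar π) 0 0 := by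

  have hθ0 := hθ.1
  have hB := blockArray_exceed hX hstat hθ0 hτ hu hr hl hs hlr hrn hls hsr hmixs hbias
  have hm : clusterMoment π 1 = 1 / θ := by
    rw [clusterMoment_one_eq hX hB hπ hπ_sum hπ_mom, div_mul_cancel_right₀ hτ.ne', one_div]
  obtain ⟨p', M, hA⟩ := exists_clusterArray_exceed hX hB hπ_mom hp hmom
  refine ⟨posSemidef_asympCov hθ0 hτ hm hA, ?_, rfl,
    varSliding_le_varDisjoint (mul_pos hθ0 hτ) _ _⟩
  exact tendstoInDistribution_of_tendstoInMeasure_sub _ _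
    (tendstoInDistribution_linearError hX hθ0 hτ hm hA)
    (tendstoInMeasure_sub_linearError hX hτ hA hbias)
    fun n => (measurable_pair
      (((measurable_thetaDisjoint hX n (r n) (u (r n))).sub_const θ).const_mul _)
      (((measurable_thetaSliding hX n (r n) (u (r n))).sub_const θ).const_mul _)).aemeasurable
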